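/- **Setting.** Let $\Omega\subseteq\mathbb R^n$ be open. For $K\Subset\Omega$ (compact) and $i\in\mathbb N$ let $p_{K,i}(f)=\sup_{x\in K,|\alpha|\le i}|\partial^\alpha f(x)|$ on $\mathcal C^\infty(\Omega)$. The ring $\widetilde{\mathbb C}$ of complex generalized numbers and the Colombeau algebra $\mathcal G(\Omega)$ are the quotients of moderate nets (every $p(u_\varepsilon)$ is $O(\varepsilon^{-N})$ for some $N$) by negligible nets (every $p(u_\varepsilon)$ is $O(\varepsilon^{q})$ for all $q$), $\varepsilon\in(0,1]$, $\varepsilon\to0$, with $p=|\cdot|$, respectively $p=p_{K,i}$. A family of seminorms $A$ gives $e^{-\mathrm{val}_A(u)}$, $\mathrm{val}_A(u)=\sup\{b\in\mathbb R: p(u_\varepsilon)=O(\varepsilon^b)\ \forall p\in A\}$; write $\mathcal P_{K,i}$ for $A=\{p_{K,i}\}$, $|\cdot|_{\mathrm e}$ for $A=\{|\cdot|\}$ on $\widetilde{\mathbb C}$, and $\mathcal P_{K}^\infty$ for $A=\{p_{K,i}:i\in\mathbb N\}$. The topologies of $\widetilde{\mathbb C}$ and $\mathcal G(\Omega)$ are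 given by $|\cdot|_{\mathrm e}$ and by the $\mathcal P_{K,i}$. $\mathcal G_c(\Omega)$ consists of the elements of compact support and has the inductive limit locally convex $\widetilde{\mathbb C}$-linear topology of the spaces $\mathcal G_K(\Omega)$ of elements supported in $K$, topologized by $\mathcal P_{K',i}$, $i\in\mathbb N$, $K'$ a compact neighbourhood of $K$. $\mathcal G^\infty(\Omega)\subseteq\mathcal G(\Omega)$ consists of the elements with a representative such that for all $K\Subset\Omega$ there is $N$ with $p_{K,i}(u_\varepsilon)=O(\varepsilon^{-N})$ for all $i$, topologized by the $\mathcal P^\infty_K$; $\mathcal G^\infty_c(\Omega)=\mathcal G^\infty(\Omega)\cap\mathcal G_c(\Omega)$ has the inductive limit topology of its subspaces of elements supported in $K$, topologized by $\mathcal P^\infty_{K'}$. A continuous $\widetilde{\mathbb C}$-linear functional $T$ on $\mathcal G(\Omega)$ is *basic* if $Tu=[(T_\varepsilon u_\varepsilon)_\varepsilon]$ for a net $T_\varepsilon\in\mathcal E'(\Omega)$ such that for some $K\Subset\Omega$, $j,N\in\mathbb N$, $\eta\in(0,1]$: $|T_\varepsilon f|\le\varepsilon^{-N}p_{K,j}(f)$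 for all $f\in\mathcal C^\infty(\Omega)$, $\varepsilon\le\eta$. A continuous $\widetilde{\mathbb C}$-linear functional on $\mathcal G_c(\Omega)$ is *basic* if $Tu=[(T_\varepsilon u_\varepsilon)_\varepsilon]$ (for representatives with supports in a common compact set) for a net $T_\varepsilon\in\mathcal D'(\Omega)$ such that for every $K\Subset\Omega$ there are $j,N,\eta$ with $|T_\varepsilon f|\le\varepsilon^{-N}p_{K,j}(f)$ for all $f\in\mathcal C_c^\infty(\Omega)$ with support in $K$, $\varepsilon\le\eta$. The spaces $\mathcal L_b(\mathcal G(\Omega),\widetilde{\mathbb C})$ and $\mathcal L_b(\mathcal G_c(\Omega),\widetilde{\mathbb C})$ of basic functionals carry the topology of uniform convergence on bounded sets. Let $k\in\mathcal G(\Omega\times\Omega)$, let $R$ be the operator with kernel $k$, $Ru(x)=\int_\Omega k(x,y)u(y)\,dy$, and let ${}^tRu(y)=\int_\Omega k(x,y)u(x)\,dx$, a map $\mathcal G_c(\Omega)\to\mathcal G(\Omega)$. $R$ acts on functionals by $RT(u)=T({}^tRu)$, $u\in\mathcal G_c(\Omega)$. $R$ is *properly supported* if $S=\operatorname{supp}k$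 is proper: for every $K\Subset\Omega$ the sets $\pi_2(S\cap\pi_1^{-1}(K))$ and $\pi_1(S\cap\pi_2^{-1}(K))$ are relatively compact in $\Omega$; then ${}^tR$ maps $\mathcal G_c(\Omega)$ into itself, and $R$ also acts on functionals on $\mathcal G_c(\Omega)$ by the same formula. A generalized function $f\in\mathcal G(\Omega)$ is identified with the functional $u\mapsto\int_\Omega f u\,dx$ on $\mathcal G_c(\Omega)$, and $g\in\mathcal G_c(\Omega)$ also with the functional $u\mapsto\int_\Omega g u\,dx$ on $\mathcal G(\Omega)$. **Proposition.** (i) $R$ maps $\mathcal L_b(\mathcal G(\Omega),\widetilde{\mathbb C})$ continuously into $\mathcal G(\Omega)$: for every such $T$ the functional $RT$ is (given by) an element of $\mathcal G(\Omega)$, and $T\mapsto RT$ is continuous. (ii) If $R$ is properly supported, then $R$ maps $\mathcal L_b(\mathcal G(\Omega),\widetilde{\mathbb C})$ continuously into $\mathcal G_c(\Omega)$; here ${}^tR$ extends to a continuous $\widetilde{\mathbb C}$-linear map $\mathcal G(\Omega)\to\mathcal G(\Omega)$ and the equality $T({}^tRu)=\int_\Omega (RT)\,u\,dx$ holds for all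 $u\in\mathcal G(\Omega)$. Moreover $R$ maps $\mathcal L_b(\mathcal G_c(\Omega),\widetilde{\mathbb C})$ continuously into $\mathcal G(\Omega)$. (iii) If $k\in\mathcal G^\infty(\Omega\times\Omega)$, then (i) and (ii) hold for the same spaces of functionals with $\mathcal G^\infty(\Omega)$ and $\mathcal G^\infty_c(\Omega)$ in place of $\mathcal G(\Omega)$ and $\mathcal G_c(\Omega)$ as target spaces. -/

import Mathlib

open Filter Topology TopologicalSpace Asymptotics MeasureTheory
open scoped ENNReal NNReal ContDiff

namespace Colombeau

noncomputable section

/-! ### Nets indexed by `(0,1]` and their growth as `ε → 0` -/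

/-- The index set `(0,1]`. -/
abbrev Idx : Type := ↥(Set.Ioc (0 : ℝ) 1)

/-- The filter `ε → 0` on `(0,1]`. -/
def toZero : Filter Idx := Filter.comap (fun ε : Idx => (ε : ℝ)) (𝓝 0)

/-- `a ε = O(ε ^ b)` as `ε → 0`. -/
def BigO (a : Idx → ℝ) (b : ℝ) : Prop :=
  a =O[toZero] fun ε => (ε : ℝ) ^ b

/-- The valuation `sup {b ∈ ℝ | a ε = O(ε ^ b)}` of a net of real numbers. -/
def netVal (a : Idx → ℝ) : EReal := sSup ((fun b : ℝ => (b : EReal)) '' {b : ℝ | BigO a b})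

theorem Idx.pos (ε : Idx) : 0 < (ε : ℝ) := ε.2.1

theorem BigO.mono {a : Idx → ℝ} {b c : ℝ} (h : BigO a b) (hc : c ≤ b) : BigO a c := by
  refine IsBigO.trans h (IsBigO.of_bound 1 (Eventually.of_forall fun ε => ?_))
  have h0 := ε.pos
  rw [Real.norm_of_nonneg (by positivity), Real.norm_of_nonneg (by positivity), one_mul]
  exact Real.rpow_le_rpow_of_exponent_ge h0 ε.2.2 hc

theorem BigO.of_le {a a' : Idx → ℝ} {b : ℝ} (h : BigO a b) (h0 : ∀ ε, 0 ≤ a' ε)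
    (hle : ∀ ε, a' ε ≤ a ε) : BigO a' b := by
  refine IsBigO.trans (IsBigO.of_bound 1 (Eventually.of_forall fun ε => ?_)) h
  rw [Real.norm_of_nonneg (h0 ε), Real.norm_of_nonneg ((h0 ε).trans (hle ε)), one_mul]
  exact hle ε

theorem BigO.add {a a' : Idx → ℝ} {b : ℝ} (h : BigO a b) (h' : BigO a' b) :
    BigO (fun ε => a ε + a' ε) b := IsBigO.add h h'

theorem BigO.mul {a a' : Idx → ℝ} {b b' : ℝ} (h : BigO a b) (h' : BigO a' b') :
    BigO (fun ε => a ε * a' ε) (b + b') := by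
  refine IsBigO.congr_right (IsBigO.mul h h') fun ε => ?_
  rw [← Real.rpow_add ε.pos]

theorem BigO.const_mul {a : Idx → ℝ} {b : ℝ} (h : BigO a b) (c : ℝ) :
    BigO (fun ε => c * a ε) b := IsBigO.const_mul_left h c

theorem BigO.zero (b : ℝ) : BigO (fun _ => 0) b := isBigO_zero _ _

/-- `a ε = O(ε ^ (-N))` for some natural number `N`. -/
def IsModerateNet (a : Idx → ℝ) : Prop := ∃ N : ℕ, BigO a (-(N : ℝ))

/-- `a ε = O(ε ^ q)` for every natural number `q`. -/
def IsNegligibleNet (a : Idx → ℝ) : Prop := ∀ q : ℕ, BigO a (q : ℝ)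

theorem IsModerateNet.add {a a' : Idx → ℝ} (h : IsModerateNet a) (h' : IsModerateNet a') :
    IsModerateNet (fun ε => a ε + a' ε) := by
  obtain ⟨N, hN⟩ := h
  obtain ⟨M, hM⟩ := h'
  refine ⟨max N M, (hN.mono ?_).add (hM.mono ?_)⟩ <;> simp

theorem IsModerateNet.mul {a a' : Idx → ℝ} (h : IsModerateNet a) (h' : IsModerateNet a') :
    IsModerateNet (fun ε => a ε * a' ε) := by
  obtain ⟨N, hN⟩ := h
  obtain ⟨M, hM⟩ := h'
  refine ⟨N + M, (hN.mul hM).mono ?_⟩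
  push_cast
  linarith

theorem IsModerateNet.of_le {a a' : Idx → ℝ} (h : IsModerateNet a) (h0 : ∀ ε, 0 ≤ a' ε)
    (hle : ∀ ε, a' ε ≤ a ε) : IsModerateNet a' := by
  obtain ⟨N, hN⟩ := h
  exact ⟨N, hN.of_le h0 hle⟩

theorem IsModerateNet.const_mul {a : Idx → ℝ} (h : IsModerateNet a) (c : ℝ) :
    IsModerateNet (fun ε => c * a ε) := by
  obtain ⟨N, hN⟩ := h
  exact ⟨N, hN.const_mul c⟩

theorem IsModerateNet.const (c : ℝ) : IsModerateNet (fun _ => c) := by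
  refine ⟨0, ?_⟩
  simp only [BigO, Nat.cast_zero, neg_zero, Real.rpow_zero]
  exact isBigO_const_const c one_ne_zero _

theorem IsNegligibleNet.moderate {a : Idx → ℝ} (h : IsNegligibleNet a) : IsModerateNet a :=
  ⟨0, by simpa using h 0⟩

theorem IsNegligibleNet.zero : IsNegligibleNet (fun _ => 0) := fun _ => BigO.zero _

theorem IsNegligibleNet.add {a a' : Idx → ℝ} (h : IsNegligibleNet a) (h' : IsNegligibleNet a') :
    IsNegligibleNet (fun ε => a ε + a' ε) := fun q => (h q).add (h' q)

theorem IsNegligibleNet.const_mul {a : Idx → ℝ} (h : IsNegligibleNet a) (c : ℝ) :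
    IsNegligibleNet (fun ε => c * a ε) := fun q => (h q).const_mul c

theorem IsNegligibleNet.of_le {a a' : Idx → ℝ} (h : IsNegligibleNet a) (h0 : ∀ ε, 0 ≤ a' ε)
    (hle : ∀ ε, a' ε ≤ a ε) : IsNegligibleNet a' := fun q => (h q).of_le h0 hle

theorem IsNegligibleNet.mul_moderate {a a' : Idx → ℝ} (h : IsNegligibleNet a)
    (h' : IsModerateNet a') : IsNegligibleNet (fun ε => a ε * a' ε) := by
  intro q
  obtain ⟨N, hN⟩ := h'
  refine ((h (q + N)).mul hN).mono ?_
  push_cast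
  linarith

theorem IsNegligibleNet.bigO {a : Idx → ℝ} (h : IsNegligibleNet a) (b : ℝ) : BigO a b := by
  obtain ⟨q, hq⟩ := exists_nat_ge b
  exact (h q).mono hq

/-! ### The ring of complex generalized numbers -/

/-- The ring of moderate nets of complex numbers. -/
def modScalars : Subring (Idx → ℂ) where
  carrier := {c | IsModerateNet fun ε => ‖c ε‖}
  mul_mem' := fun ha hb => (ha.mul hb).of_le (fun _ => norm_nonneg _) fun _ => norm_mul_le _ _
  one_mem' := (IsModerateNet.const 1).of_le (fun _ => norm_nonneg _) fun _ => by simp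
  add_mem' := fun ha hb => (ha.add hb).of_le (fun _ => norm_nonneg _) fun _ => norm_add_le _ _
  zero_mem' := (IsModerateNet.const 0).of_le (fun _ => norm_nonneg _) fun _ => by simp
  neg_mem' := fun ha => ha.of_le (fun _ => norm_nonneg _) fun _ => by simp

/-- The ideal of negligible nets of complex numbers. -/
def negScalars : Ideal modScalars where
  carrier := {c | IsNegligibleNet fun ε => ‖c.1 ε‖}
  add_mem' := fun ha hb => (ha.add hb).of_le (fun _ => norm_nonneg _) fun _ => norm_add_le _ _
  zero_mem' := IsNegligibleNet.zero.of_le (fun _ => norm_nonneg _) fun _ => by simp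
  smul_mem' := fun c _ ha => (ha.mul_moderate c.2).of_le (fun _ => norm_nonneg _) fun ε => by
    simp [mul_comm]

/-- The ring `C̃` of complex generalized numbers. -/
def CTilde : Type := modScalars ⧸ negScalars

instance : CommRing CTilde := inferInstanceAs (CommRing (modScalars ⧸ negScalars))

/-- The class in `C̃` of a moderate net of complex numbers. -/
def CTilde.mk : modScalars →+* CTilde := Ideal.Quotient.mk negScalars

theorem netVal_congr {a a' d : Idx → ℝ} (h0 : ∀ ε, 0 ≤ a ε) (h0' : ∀ ε, 0 ≤ a' ε)
    (hd : IsNegligibleNet d) (h1 : ∀ ε, a ε ≤ a' ε + d ε) (h2 : ∀ ε, a' ε ≤ a ε + d ε) :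
    netVal a = netVal a' := by
  unfold netVal
  congr 2
  ext b
  exact ⟨fun h => (BigO.add h (hd.bigO b)).of_le h0' h2,
    fun h => (BigO.add h (hd.bigO b)).of_le h0 h1⟩

/-- The valuation of a complex generalized number. -/
def CTilde.val (c : CTilde) : EReal :=
  Quotient.liftOn' (s₁ := Submodule.quotientRel negScalars) c
    (fun a => netVal fun ε => ‖a.1 ε‖) (by
      intro a b hab
      have hd : IsNegligibleNet fun ε => ‖(a - b).1 ε‖ := (Submodule.quotientRel_def _).1 hab
      refine netVal_congr (fun _ => norm_nonneg _) (fun _ => norm_nonneg _) hd (fun ε => ?_)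
        fun ε => ?_
      · have := norm_add_le (b.1 ε) ((a - b).1 ε)
        simpa using this
      · have := norm_sub_le (a.1 ε) ((a - b).1 ε)
        simpa using this)

/-- The ultra-pseudo-norm `|c|ₑ = exp (-val c)` on `C̃`. -/
def CTilde.enorm (c : CTilde) : ℝ≥0∞ := EReal.exp (-c.val)

/-- The topology determined by a family of (pseudo-)distances: the finite intersections of balls
`{y | d j x y < δ}` form a neighbourhood base of `x`. -/
@[reducible] def gaugeTopology {X J : Type*} (d : J → X → X → ℝ≥0∞) : TopologicalSpace X where
  IsOpen U := ∀ x ∈ U, ∃ s : Finset J, ∃ δ : ℝ≥0∞, 0 < δ ∧ {y | ∀ j ∈ s, d j x y < δ} ⊆ U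
  isOpen_univ := fun _ _ => ⟨∅, 1, one_pos, Set.subset_univ _⟩
  isOpen_inter := by
    classical
    rintro U V hU hV x ⟨hxU, hxV⟩
    obtain ⟨s, δ, hδ, hs⟩ := hU x hxU
    obtain ⟨t, η, hη, ht⟩ := hV x hxV
    refine ⟨s ∪ t, min δ η, lt_min hδ hη, fun y hy => ⟨hs fun j hj => ?_, ht fun j hj => ?_⟩⟩
    · exact (hy j (Finset.mem_union_left _ hj)).trans_le (min_le_left _ _)
    · exact (hy j (Finset.mem_union_right _ hj)).trans_le (min_le_right _ _)
  isOpen_sUnion := by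
    rintro S hS x ⟨U, hU, hxU⟩
    obtain ⟨s, δ, hδ, hs⟩ := hS U hU x hxU
    exact ⟨s, δ, hδ, hs.trans (Set.subset_sUnion_of_mem hU)⟩

instance : TopologicalSpace CTilde :=
  gaugeTopology fun (_ : Unit) x y => CTilde.enorm (y - x)

/-! ### Generalized functions based on a locally convex space -/

section GE

variable {E ι : Type*} [AddCommGroup E] [Module ℂ E] (p : ι → Seminorm ℂ E)

/-- The module of moderate nets in `E`. -/
def moderate : Submodule modScalars (Idx → E) where
  carrier := {u | ∀ i, IsModerateNet fun ε => p i (u ε)}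
  add_mem' := fun hu hv i => ((hu i).add (hv i)).of_le (fun _ => apply_nonneg _ _)
    fun _ => map_add_le_add _ _ _
  zero_mem' := fun i => (IsModerateNet.const 0).of_le (fun _ => apply_nonneg _ _) fun _ => by simp
  smul_mem' := fun c u hu i => (IsModerateNet.mul c.2 (hu i)).of_le (fun _ => apply_nonneg _ _)
    fun ε => (map_smul_eq_mul (p i) (c.1 ε) (u ε)).le

/-- The module of negligible nets in `E`. -/
def negligible : Submodule modScalars (moderate p) where
  carrier := {u | ∀ i, IsNegligibleNet fun ε => p i (u.1 ε)}
  add_mem' := fun hu hv i => ((hu i).add (hv i)).of_le (fun _ => apply_nonneg _ _)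
    fun _ => map_add_le_add _ _ _
  zero_mem' := fun i => IsNegligibleNet.zero.of_le (fun _ => apply_nonneg _ _) fun _ => by simp
  smul_mem' := fun c u hu i => ((hu i).mul_moderate c.2).of_le (fun _ => apply_nonneg _ _)
    fun ε => by
      rw [mul_comm]
      exact (map_smul_eq_mul (p i) (c.1 ε) (u.1 ε)).le

/-- The module of generalized functions based on `E`: moderate nets modulo negligible nets. -/
def GE : Type _ := moderate p ⧸ negligible p

instance : AddCommGroup (GE p) := inferInstanceAs (AddCommGroup (moderate p ⧸ negligible p))

theorem isTorsion_GE :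
    Module.IsTorsionBySet modScalars (moderate p ⧸ negligible p) (negScalars : Set modScalars) := by
  rintro x ⟨c, hc⟩
  induction x using Submodule.Quotient.induction_on with
  | _ u =>
    change Submodule.Quotient.mk (c • u) = 0
    rw [Submodule.Quotient.mk_eq_zero]
    intro i
    have hc' : IsNegligibleNet fun ε => ‖c.1 ε‖ := hc
    exact (hc'.mul_moderate (u.2 i)).of_le (fun _ => apply_nonneg _ _)
      fun ε => (map_smul_eq_mul (p i) (c.1 ε) (u.1 ε)).le

/-- The `C̃`-module structure: `[c] • [u] = [c u]`. -/
instance : Module CTilde (GE p) :=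
  Module.IsTorsionBySet.module (R := modScalars) (M := moderate p ⧸ negligible p)
    (I := negScalars) (isTorsion_GE p)

/-- The class of a moderate net. -/
def GE.mk : moderate p →+ GE p := (negligible p).mkQ.toAddMonoidHom

variable {p}

theorem GE.mk_surjective (x : GE p) : ∃ u, GE.mk p u = x := Submodule.mkQ_surjective _ x

theorem GE.mk_eq_zero {u : moderate p} : GE.mk p u = 0 ↔ u ∈ negligible p :=
  Submodule.Quotient.mk_eq_zero _

theorem GE.mk_eq_mk {u v : moderate p} : GE.mk p u = GE.mk p v ↔ u - v ∈ negligible p :=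
  Submodule.Quotient.eq _

theorem GE.smul_mk (c : modScalars) (u : moderate p) :
    CTilde.mk c • GE.mk p u = GE.mk p (c • u) := rfl

theorem seminorm_net_le {u v : moderate p} (i : ι) (ε : Idx) :
    p i (u.1 ε) ≤ p i (v.1 ε) + p i ((u - v).1 ε) := by
  have := map_add_le_add (p i) (v.1 ε) ((u - v).1 ε)
  simpa using this

theorem seminorm_net_le' {u v : moderate p} (i : ι) (ε : Idx) :
    p i (v.1 ε) ≤ p i (u.1 ε) + p i ((u - v).1 ε) := by
  have := map_sub_le_add (p i) (u.1 ε) ((u - v).1 ε)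
  simpa using this

theorem bigO_congr {u v : moderate p} (huv : u - v ∈ negligible p) (i : ι) (b : ℝ) :
    (BigO (fun ε => p i (u.1 ε)) b) ↔ BigO (fun ε => p i (v.1 ε)) b :=
  ⟨fun h => (BigO.add h ((huv i).bigO b)).of_le (fun _ => apply_nonneg _ _)
      fun ε => seminorm_net_le' i ε,
    fun h => (BigO.add h ((huv i).bigO b)).of_le (fun _ => apply_nonneg _ _)
      fun ε => seminorm_net_le i ε⟩

/-- For a set `A` of seminorms of the family, the uniform valuation
`sup {b ∈ ℝ | p i (u ε) = O(ε ^ b) for every i ∈ A}` of `[u]`. -/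
def GE.valOn (A : Set ι) (x : GE p) : EReal :=
  Quotient.liftOn' (s₁ := Submodule.quotientRel (negligible p)) x
    (fun u => sSup ((fun b : ℝ => (b : EReal)) ''
      {b : ℝ | ∀ i ∈ A, BigO (fun ε => p i (u.1 ε)) b})) (by
      intro u v huv
      have hd : u - v ∈ negligible p := (Submodule.quotientRel_def _).1 huv
      simp only [bigO_congr hd])

/-- The ultra-pseudo-seminorm `exp (-val)` attached to `GE.valOn A`. -/
def GE.upsOn (A : Set ι) (x : GE p) : ℝ≥0∞ := EReal.exp (-x.valOn A)

/-- The ultra-pseudo-seminorm `𝒫ᵢ(x) = exp (-val_{pᵢ}(x))`, where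
`val_{pᵢ}([u]) = sup {b ∈ ℝ | pᵢ(u ε) = O(ε ^ b)}`. -/
def GE.ups (i : ι) (x : GE p) : ℝ≥0∞ := x.upsOn {i}

/-- The sharp topology, determined by the ultra-pseudo-seminorms `𝒫ᵢ`. -/
instance : TopologicalSpace (GE p) := gaugeTopology fun i x y => GE.ups i (y - x)

section Bilinear

variable {E₁ E₂ ι₁ ι₂ : Type*} [AddCommGroup E₁] [Module ℂ E₁] [AddCommGroup E₂] [Module ℂ E₂]
  {p₁ : ι₁ → Seminorm ℂ E₁} {p₂ : ι₂ → Seminorm ℂ E₂}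

/-- A bilinear map is continuous for the given families of seminorms. -/
def BilinBound (p₁ : ι₁ → Seminorm ℂ E₁) (p₂ : ι₂ → Seminorm ℂ E₂) (q : Seminorm ℂ E)
    (B : E₁ →ₗ[ℂ] E₂ →ₗ[ℂ] E) : Prop :=
  ∃ i₁ i₂, ∃ C : ℝ, ∀ a b, q (B a b) ≤ C * (p₁ i₁ a * p₂ i₂ b)

theorem BilinBound.moderate {q : Seminorm ℂ E} {B : E₁ →ₗ[ℂ] E₂ →ₗ[ℂ] E}
    (hB : BilinBound p₁ p₂ q B) (u : moderate p₁) (v : Colombeau.moderate p₂) :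
    IsModerateNet fun ε => q (B (u.1 ε) (v.1 ε)) := by
  obtain ⟨i₁, i₂, C, h⟩ := hB
  exact (((u.2 i₁).mul (v.2 i₂)).const_mul C).of_le (fun _ => apply_nonneg _ _) fun ε => h _ _

theorem BilinBound.negligible {q : Seminorm ℂ E} {B : E₁ →ₗ[ℂ] E₂ →ₗ[ℂ] E}
    (hB : BilinBound p₁ p₂ q B) {u u' : Colombeau.moderate p₁} {v v' : Colombeau.moderate p₂}
    (hu : u - u' ∈ negligible p₁) (hv : v - v' ∈ Colombeau.negligible p₂) :
    IsNegligibleNet fun ε => q (B (u.1 ε) (v.1 ε) - B (u'.1 ε) (v'.1 ε)) := by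
  obtain ⟨i₁, i₂, C, h⟩ := hB
  have h1 := ((hu i₁).mul_moderate (v.2 i₂)).const_mul C
  have h2 := ((hv i₂).mul_moderate (u'.2 i₁)).const_mul C
  refine (h1.add h2).of_le (fun _ => apply_nonneg _ _) fun ε => ?_
  have e : B (u.1 ε) (v.1 ε) - B (u'.1 ε) (v'.1 ε) =
      B ((u - u').1 ε) (v.1 ε) + B (u'.1 ε) ((v - v').1 ε) := by
    simp
  rw [e]
  refine (map_add_le_add q _ _).trans (add_le_add (h _ _) ((h _ _).trans (le_of_eq ?_)))
  ring

/-- The map `([u], [v]) ↦ [B u v]` induced by a bilinear map which is continuous for the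
families of seminorms. -/
def GE.map₂ (B : E₁ →ₗ[ℂ] E₂ →ₗ[ℂ] E) (hB : ∀ i, BilinBound p₁ p₂ (p i) B)
    (x : GE p₁) (y : GE p₂) : GE p :=
  Quotient.liftOn₂' (s₁ := Submodule.quotientRel (negligible p₁))
    (s₂ := Submodule.quotientRel (negligible p₂)) x y
    (fun u v => GE.mk p ⟨fun ε => B (u.1 ε) (v.1 ε), fun i => (hB i).moderate u v⟩) (by
      intro u v u' v' hu hv
      exact GE.mk_eq_mk.2 fun i => (hB i).negligible ((Submodule.quotientRel_def _).1 hu)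
        ((Submodule.quotientRel_def _).1 hv))

/-- The map `([u], [v]) ↦ [B u v] ∈ C̃` induced by a bilinear form which is continuous for the
families of seminorms. -/
def GE.form₂ (B : E₁ →ₗ[ℂ] E₂ →ₗ[ℂ] ℂ) (hB : BilinBound p₁ p₂ (normSeminorm ℂ ℂ) B)
    (x : GE p₁) (y : GE p₂) : CTilde :=
  Quotient.liftOn₂' (s₁ := Submodule.quotientRel (negligible p₁))
    (s₂ := Submodule.quotientRel (negligible p₂)) x y
    (fun u v => CTilde.mk ⟨fun ε => B (u.1 ε) (v.1 ε), hB.moderate u v⟩) (by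
      intro u v u' v' hu hv
      exact Ideal.Quotient.eq.2 (hB.negligible ((Submodule.quotientRel_def _).1 hu)
        ((Submodule.quotientRel_def _).1 hv)))

end Bilinear

end GE

/-! ### The algebra `𝒢(Ω)` -/

section Smooth

variable {V : Type*} [NormedAddCommGroup V] [NormedSpace ℝ V]

/-- The space `ℰ(Ω)` of smooth complex functions on `Ω`; a function on `Ω` is represented by its
extension by zero to the whole space. -/
def smoothSubmodule (Ω : Opens V) : Submodule ℂ (V → ℂ) where
  carrier := {f | ContDiffOn ℝ ∞ f Ω ∧ ∀ x ∉ Ω, f x = 0}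
  add_mem' := fun hf hg => ⟨hf.1.add hg.1, fun x hx => by simp [hf.2 x hx, hg.2 x hx]⟩
  zero_mem' := ⟨contDiffOn_const, fun _ _ => rfl⟩
  smul_mem' := fun c f hf => ⟨hf.1.const_smul c, fun x hx => by simp [hf.2 x hx]⟩

/-- The space `ℰ(Ω)` of smooth complex functions on `Ω`. -/
abbrev SmoothFn (Ω : Opens V) : Type _ := ↥(smoothSubmodule Ω)

/-- The compact subsets of `Ω`. -/
abbrev CompactIn (Ω : Opens V) : Type _ := {K : Set V // IsCompact K ∧ K ⊆ Ω}

variable {Ω : Opens V}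

theorem SmoothFn.contDiffAt (f : SmoothFn Ω) {x : V} (hx : x ∈ Ω) (m : ℕ) :
    ContDiffAt ℝ m f.1 x :=
  ((f.2.1 x hx).contDiffAt (Ω.isOpen.mem_nhds hx)).of_le (by exact_mod_cast le_top)

/-- The values `‖Dʲ f(x)‖`, `x ∈ K`, `j ≤ i`. -/
def derivValues (K : CompactIn Ω) (i : ℕ) (f : SmoothFn Ω) : Set ℝ :=
  {r | ∃ x ∈ K.1, ∃ j ≤ i, r = ‖iteratedFDeriv ℝ j f.1 x‖}

theorem bddAbove_derivValues (K : CompactIn Ω) (i : ℕ) (f : SmoothFn Ω) :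
    BddAbove (derivValues K i f) := by
  have h : derivValues K i f = ⋃ j ∈ Finset.range (i + 1),
      (fun x => ‖iteratedFDeriv ℝ j f.1 x‖) '' K.1 := by
    ext r
    simp only [derivValues, Set.mem_ofPred_eq, Set.mem_iUnion, Set.mem_image, Finset.mem_range,
      Nat.lt_succ_iff, exists_prop]
    constructor
    · rintro ⟨x, hx, j, hj, rfl⟩
      exact ⟨j, hj, x, hx, rfl⟩
    · rintro ⟨j, hj, x, hx, rfl⟩
      exact ⟨x, hx, j, hj, rfl⟩
  rw [h]
  refine (Set.Finite.bddAbove_biUnion (Finset.finite_toSet (Finset.range (i + 1)))).2 fun j _ => ?_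
  refine K.2.1.bddAbove_image fun x hx => ContinuousAt.continuousWithinAt ?_
  exact ((f.contDiffAt (K.2.2 hx) j).continuousAt_iteratedFDeriv le_rfl).norm

/-- `sup {‖Dʲ f(x)‖ | x ∈ K, j ≤ i}`. -/
def pValue (K : CompactIn Ω) (i : ℕ) (f : SmoothFn Ω) : ℝ := sSup (derivValues K i f)

theorem le_pValue (K : CompactIn Ω) {i j : ℕ} (hj : j ≤ i) (f : SmoothFn Ω) {x : V}
    (hx : x ∈ K.1) : ‖iteratedFDeriv ℝ j f.1 x‖ ≤ pValue K i f :=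
  le_csSup (bddAbove_derivValues K i f) ⟨x, hx, j, hj, rfl⟩

theorem pValue_le (K : CompactIn Ω) (i : ℕ) (f : SmoothFn Ω) {C : ℝ} (hC : 0 ≤ C)
    (h : ∀ x ∈ K.1, ∀ j ≤ i, ‖iteratedFDeriv ℝ j f.1 x‖ ≤ C) : pValue K i f ≤ C :=
  Real.sSup_le (by rintro _ ⟨x, hx, j, hj, rfl⟩; exact h x hx j hj) hC

theorem pValue_nonneg (K : CompactIn Ω) (i : ℕ) (f : SmoothFn Ω) : 0 ≤ pValue K i f :=
  Real.sSup_nonneg (by rintro _ ⟨x, hx, j, hj, rfl⟩; exact norm_nonneg _)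

/-- The seminorms `p_{K,i}(f) = sup {‖Dʲ f(x)‖ | x ∈ K, j ≤ i}` of `ℰ(Ω)`. -/
def pSeminorm (Ω : Opens V) (κ : CompactIn Ω × ℕ) : Seminorm ℂ (SmoothFn Ω) :=
  Seminorm.of (pValue κ.1 κ.2)
    (fun f g => pValue_le _ _ _ (add_nonneg (pValue_nonneg _ _ _) (pValue_nonneg _ _ _))
      fun x hx j hj => by
        have e : iteratedFDeriv ℝ j (f + g).1 x =
            iteratedFDeriv ℝ j f.1 x + iteratedFDeriv ℝ j g.1 x :=
          iteratedFDeriv_add_apply (f.contDiffAt (κ.1.2.2 hx) j) (g.contDiffAt (κ.1.2.2 hx) j)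
        rw [e]
        exact (norm_add_le _ _).trans (add_le_add (le_pValue _ hj _ hx) (le_pValue _ hj _ hx)))
    (by
      have key : ∀ (c : ℂ) (f : SmoothFn Ω), pValue κ.1 κ.2 (c • f) ≤ ‖c‖ * pValue κ.1 κ.2 f := by
        intro c f
        refine pValue_le _ _ _ (mul_nonneg (norm_nonneg _) (pValue_nonneg _ _ _))
          fun x hx j hj => ?_
        have e : iteratedFDeriv ℝ j (c • f).1 x = c • iteratedFDeriv ℝ j f.1 x :=
          iteratedFDeriv_const_smul_apply (f.contDiffAt (κ.1.2.2 hx) j)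
        rw [e, norm_smul]
        exact mul_le_mul_of_nonneg_left (le_pValue _ hj _ hx) (norm_nonneg _)
      intro c f
      refine le_antisymm (key c f) ?_
      rcases eq_or_ne c 0 with rfl | hc
      · simpa using pValue_nonneg κ.1 κ.2 ((0 : ℂ) • f)
      · have h := key c⁻¹ (c • f)
        rw [smul_smul, inv_mul_cancel₀ hc, one_smul, norm_inv] at h
        have hc' : 0 < ‖c‖ := norm_pos_iff.2 hc
        calc ‖c‖ * pValue κ.1 κ.2 f ≤ ‖c‖ * (‖c‖⁻¹ * pValue κ.1 κ.2 (c • f)) :=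
              mul_le_mul_of_nonneg_left h hc'.le
          _ = pValue κ.1 κ.2 (c • f) := by field_simp)

/-- The Colombeau algebra `𝒢(Ω)`, as a `C̃`-module. -/
abbrev G (Ω : Opens V) : Type _ := GE (pSeminorm Ω)

/-! ### Supports -/

/-- The restriction of `u` to the open set `W ⊆ Ω` is zero in `𝒢(W)`: every representative is
negligible on all compact subsets of `W`. -/
def VanishesOn (u : G Ω) (W : Set V) : Prop :=
  ∀ v : moderate (pSeminorm Ω), GE.mk _ v = u → ∀ κ : CompactIn Ω × ℕ, κ.1.1 ⊆ W →
    IsNegligibleNet fun ε => pSeminorm Ω κ (v.1 ε)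

/-- The support of `u ∈ 𝒢(Ω)`: the points of `Ω` without an open neighbourhood in `Ω` on which
`u` vanishes. -/
def supp (u : G Ω) : Set V :=
  {x | x ∈ Ω ∧ ∀ W : Set V, IsOpen W → W ⊆ Ω → x ∈ W → ¬ VanishesOn u W}

theorem vanishesOn_mk {v : moderate (pSeminorm Ω)} {W : Set V} :
    VanishesOn (GE.mk _ v) W ↔
      ∀ κ : CompactIn Ω × ℕ, κ.1.1 ⊆ W → IsNegligibleNet fun ε => pSeminorm Ω κ (v.1 ε) :=
  ⟨fun h => h v rfl, fun h _ hw κ hκ q => (bigO_congr (GE.mk_eq_mk.1 hw) κ q).2 (h κ hκ q)⟩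

theorem VanishesOn.mono {u : G Ω} {W W' : Set V} (h : VanishesOn u W) (hW : W' ⊆ W) :
    VanishesOn u W' := fun v hv κ hκ => h v hv κ (hκ.trans hW)

theorem VanishesOn.zero (W : Set V) : VanishesOn (0 : G Ω) W := by
  rw [← map_zero (GE.mk (pSeminorm Ω)), vanishesOn_mk]
  exact fun κ _ => IsNegligibleNet.zero.of_le (fun _ => apply_nonneg _ _) fun _ => by simp

theorem VanishesOn.add {u v : G Ω} {W : Set V} (hu : VanishesOn u W) (hv : VanishesOn v W) :
    VanishesOn (u + v) W := by
  obtain ⟨a, rfl⟩ := GE.mk_surjective u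
  obtain ⟨b, rfl⟩ := GE.mk_surjective v
  rw [← map_add]
  rw [vanishesOn_mk] at hu hv ⊢
  exact fun κ hκ => ((hu κ hκ).add (hv κ hκ)).of_le (fun _ => apply_nonneg _ _)
    fun _ => map_add_le_add _ _ _

theorem VanishesOn.smul {u : G Ω} {W : Set V} (c : CTilde) (hu : VanishesOn u W) :
    VanishesOn (c • u) W := by
  obtain ⟨a, rfl⟩ := GE.mk_surjective u
  obtain ⟨c, rfl⟩ := Ideal.Quotient.mk_surjective c
  change VanishesOn (CTilde.mk c • GE.mk _ a) W
  rw [GE.smul_mk]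
  rw [vanishesOn_mk] at hu ⊢
  exact fun κ hκ => ((hu κ hκ).mul_moderate c.2).of_le (fun _ => apply_nonneg _ _) fun ε => by
    rw [mul_comm]
    exact (map_smul_eq_mul (pSeminorm Ω κ) (c.1 ε) (a.1 ε)).le

theorem supp_zero : supp (0 : G Ω) = ∅ := by
  ext x
  simp only [supp, Set.mem_ofPred_eq, Set.mem_empty_iff_false, iff_false]
  exact fun h => h.2 Ω Ω.isOpen le_rfl h.1 (VanishesOn.zero _)

theorem supp_add (u v : G Ω) : supp (u + v) ⊆ supp u ∪ supp v := by
  rintro x ⟨hx, h⟩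
  by_contra hn
  simp only [Set.mem_union, not_or, supp, Set.mem_ofPred_eq, not_and, not_forall, not_not] at hn
  obtain ⟨W, hW, hWΩ, hxW, hu⟩ := hn.1 hx
  obtain ⟨W', hW', -, hxW', hv⟩ := hn.2 hx
  exact h (W ∩ W') (hW.inter hW') (Set.inter_subset_left.trans hWΩ) ⟨hxW, hxW'⟩
    ((hu.mono Set.inter_subset_left).add (hv.mono Set.inter_subset_right))

theorem supp_smul (c : CTilde) (u : G Ω) : supp (c • u) ⊆ supp u :=
  fun _ hx => ⟨hx.1, fun W hW hWΩ hxW hu => hx.2 W hW hWΩ hxW (hu.smul c)⟩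

/-! ### The module `𝒢_c(Ω)` -/

/-- The elements of `𝒢(Ω)` with compact support in `Ω`. -/
def gcSubmodule (Ω : Opens V) : Submodule CTilde (G Ω) where
  carrier := {u | ∃ K : CompactIn Ω, supp u ⊆ K.1}
  add_mem' := by
    rintro u v ⟨K, hK⟩ ⟨L, hL⟩
    exact ⟨⟨K.1 ∪ L.1, K.2.1.union L.2.1, Set.union_subset K.2.2 L.2.2⟩,
      (supp_add u v).trans (Set.union_subset_union hK hL)⟩
  zero_mem' := ⟨⟨∅, isCompact_empty, Set.empty_subset _⟩, by rw [supp_zero]⟩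
  smul_mem' := by
    rintro c u ⟨K, hK⟩
    exact ⟨K, (supp_smul c u).trans hK⟩

/-- The `C̃`-module `𝒢_c(Ω)` of generalized functions with compact support. -/
def Gc (Ω : Opens V) : Type _ := ↥(gcSubmodule Ω)

instance : AddCommGroup (Gc Ω) := inferInstanceAs (AddCommGroup ↥(gcSubmodule Ω))

instance : Module CTilde (Gc Ω) := inferInstanceAs (Module CTilde ↥(gcSubmodule Ω))

/-- The inclusion of `𝒢_c(Ω)` into `𝒢(Ω)`. -/
def Gc.toG : Gc Ω →ₗ[CTilde] G Ω := (gcSubmodule Ω).subtype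

/-- The pairs `(K', i)` with `K' ⊆ Ω` a compact neighbourhood of `K`. -/
abbrev NhdIndex (K : CompactIn Ω) : Type _ :=
  {κ : CompactIn Ω × ℕ // K.1 ⊆ interior κ.1.1}

/-- The set `𝒢_K(Ω)` of the generalized functions supported in `K`. -/
def GK (K : CompactIn Ω) : Type _ := {u : Gc Ω // supp u.toG ⊆ K.1}

/-- The topology of `𝒢_K(Ω)`, given by the ultra-pseudo-seminorms `exp (-val_{p_{K',i}})` with
`K'` a compact neighbourhood of `K` (they do not depend on `K'`). -/
instance (K : CompactIn Ω) : TopologicalSpace (GK K) :=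
  gaugeTopology fun (κ : NhdIndex K) x y => GE.ups κ.1 (y.1.toG - x.1.toG)

end Smooth

/-- An ultra-pseudo-seminorm on a `C̃`-module. -/
structure UltraPseudoSeminorm (M : Type*) [AddCommGroup M] [Module CTilde M] where
  /-- The underlying function. -/
  toFun : M → ℝ≥0
  map_zero : toFun 0 = 0
  smul_le : ∀ (c : CTilde) (u : M), (toFun (c • u) : ℝ≥0∞) ≤ c.enorm * toFun u
  add_le : ∀ u v : M, toFun (u + v) ≤ max (toFun u) (toFun v)

section Smooth

variable {V : Type*} [NormedAddCommGroup V] [NormedSpace ℝ V] {Ω : Opens V}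

/-- The ultra-pseudo-seminorms on `𝒢_c(Ω)` whose restrictions to all `𝒢_K(Ω)` are continuous. -/
abbrev GcUps (Ω : Opens V) : Type _ :=
  {Q : UltraPseudoSeminorm (Gc Ω) // ∀ K : CompactIn Ω, Continuous fun u : GK K => Q.toFun u.1}

/-- The inductive limit topology of `𝒢_c(Ω)`, i.e. the finest locally convex `C̃`-linear topology
for which the inclusions of all `𝒢_K(Ω)` are continuous. -/
instance : TopologicalSpace (Gc Ω) :=
  gaugeTopology fun (Q : GcUps Ω) x y => (Q.1.toFun (y - x) : ℝ≥0∞)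

/-! ### The modules `𝒢^∞(Ω)` and `𝒢^∞_c(Ω)` of regular generalized functions -/

/-- The elements of `𝒢(Ω)` with a representative satisfying
`∀ K, ∃ N, ∀ i, p_{K,i}(u ε) = O(ε ^ (-N))`. -/
def ginfSubmodule (Ω : Opens V) : Submodule CTilde (G Ω) where
  carrier := {u | ∃ v : moderate (pSeminorm Ω), GE.mk _ v = u ∧
    ∀ K : CompactIn Ω, ∃ N : ℕ, ∀ i : ℕ, BigO (fun ε => pSeminorm Ω (K, i) (v.1 ε)) (-(N : ℝ))}
  add_mem' := by
    rintro _ _ ⟨a, rfl, ha⟩ ⟨b, rfl, hb⟩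
    refine ⟨a + b, map_add _ _ _, fun K => ?_⟩
    obtain ⟨N, hN⟩ := ha K
    obtain ⟨M, hM⟩ := hb K
    refine ⟨max N M, fun i => ?_⟩
    refine BigO.of_le (((hN i).mono ?_).add ((hM i).mono ?_)) (fun _ => apply_nonneg _ _)
      (fun _ => map_add_le_add _ _ _) <;> simp
  zero_mem' := ⟨0, map_zero _, fun _ => ⟨0, fun _ =>
    (BigO.zero _).of_le (fun _ => apply_nonneg _ _) fun _ => by simp⟩⟩
  smul_mem' := by
    rintro c _ ⟨a, rfl, ha⟩
    obtain ⟨c, rfl⟩ := Ideal.Quotient.mk_surjective c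
    refine ⟨_, (GE.smul_mk c a).symm, fun K => ?_⟩
    obtain ⟨N, hN⟩ := ha K
    obtain ⟨M, hM⟩ := c.2
    refine ⟨M + N, fun i => ?_⟩
    refine ((hM.mul (hN i)).mono ?_).of_le (fun _ => apply_nonneg _ _)
      fun ε => (map_smul_eq_mul (pSeminorm Ω (K, i)) (c.1 ε) (a.1 ε)).le
    push_cast
    linarith

/-- The `C̃`-module `𝒢^∞(Ω)` of regular generalized functions. -/
def Ginf (Ω : Opens V) : Type _ := ↥(ginfSubmodule Ω)

instance : AddCommGroup (Ginf Ω) := inferInstanceAs (AddCommGroup ↥(ginfSubmodule Ω))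

instance : Module CTilde (Ginf Ω) := inferInstanceAs (Module CTilde ↥(ginfSubmodule Ω))

/-- The inclusion of `𝒢^∞(Ω)` into `𝒢(Ω)`. -/
def Ginf.toG : Ginf Ω →ₗ[CTilde] G Ω := (ginfSubmodule Ω).subtype

/-- The ultra-pseudo-seminorm `exp (-val)` with
`val([u]) = sup {b ∈ ℝ | p_{K,i}(u ε) = O(ε ^ b) for every i}`. -/
def upsInf (K : CompactIn Ω) (u : G Ω) : ℝ≥0∞ := u.upsOn {κ | κ.1 = K}

/-- The topology of `𝒢^∞(Ω)`. -/
instance : TopologicalSpace (Ginf Ω) :=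
  gaugeTopology fun (K : CompactIn Ω) x y => upsInf K (y.toG - x.toG)

/-- The `C̃`-module `𝒢^∞_c(Ω) = 𝒢^∞(Ω) ∩ 𝒢_c(Ω)`. -/
def Gcinf (Ω : Opens V) : Type _ := ↥(ginfSubmodule Ω ⊓ gcSubmodule Ω)

instance : AddCommGroup (Gcinf Ω) :=
  inferInstanceAs (AddCommGroup ↥(ginfSubmodule Ω ⊓ gcSubmodule Ω))

instance : Module CTilde (Gcinf Ω) :=
  inferInstanceAs (Module CTilde ↥(ginfSubmodule Ω ⊓ gcSubmodule Ω))

/-- The inclusion of `𝒢^∞_c(Ω)` into `𝒢_c(Ω)`. -/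
def Gcinf.toGc : Gcinf Ω →ₗ[CTilde] Gc Ω := Submodule.inclusion inf_le_right

/-- The set `𝒢^∞_K(Ω)` of the regular generalized functions supported in `K`. -/
def GKinf (K : CompactIn Ω) : Type _ := {u : Gcinf Ω // supp u.toGc.toG ⊆ K.1}

/-- The topology of `𝒢^∞_K(Ω)`, given by the ultra-pseudo-norm `exp (-val^∞)` computed on a
compact neighbourhood `K'` of `K` (it does not depend on `K'`). -/
instance (K : CompactIn Ω) : TopologicalSpace (GKinf K) :=
  gaugeTopology fun (L : {L : CompactIn Ω // K.1 ⊆ interior L.1}) x y =>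
    upsInf L.1 (y.1.toGc.toG - x.1.toGc.toG)

/-- The ultra-pseudo-seminorms on `𝒢^∞_c(Ω)` whose restrictions to all `𝒢^∞_K(Ω)` are
continuous. -/
abbrev GcinfUps (Ω : Opens V) : Type _ :=
  {Q : UltraPseudoSeminorm (Gcinf Ω) //
    ∀ K : CompactIn Ω, Continuous fun u : GKinf K => Q.toFun u.1}

/-- The inductive limit topology of `𝒢^∞_c(Ω)`. -/
instance : TopologicalSpace (Gcinf Ω) :=
  gaugeTopology fun (Q : GcinfUps Ω) x y => (Q.1.toFun (y - x) : ℝ≥0∞)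

/-! ### Basic functionals -/

/-- Continuity of a linear functional on `ℰ(Ω)`: the elements of `ℰ'(Ω)` are the linear
functionals with this property. -/
def IsCompactDistribution (t : SmoothFn Ω →ₗ[ℂ] ℂ) : Prop :=
  ∃ (κ : CompactIn Ω × ℕ) (C : ℝ), ∀ f, ‖t f‖ ≤ C * pSeminorm Ω κ f

/-- A functional `T` in `L(𝒢(Ω), C̃)` is basic if it is given by a net `(T_ε)` in `ℰ'(Ω)` such that
`|T_ε(f)| ≤ ε ^ (-N) p_{K,j}(f)` for some `K`, `j`, `N` and all small `ε`. -/
def IsBasicG (T : G Ω →L[CTilde] CTilde) : Prop :=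
  ∃ t : Idx → (SmoothFn Ω →ₗ[ℂ] ℂ), (∀ ε, IsCompactDistribution (t ε)) ∧
    (∃ (K : CompactIn Ω) (j N : ℕ) (η : Idx), ∀ (f : SmoothFn Ω) (ε : Idx), ε ≤ η →
      ‖t ε f‖ ≤ (ε : ℝ) ^ (-(N : ℝ)) * pSeminorm Ω (K, j) f) ∧
    ∀ u : moderate (pSeminorm Ω), ∃ h : (fun ε => t ε (u.1 ε)) ∈ modScalars,
      T (GE.mk _ u) = CTilde.mk ⟨_, h⟩

/-- A test function on `Ω`, seen as an element of `ℰ(Ω)`. -/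
def testToSmooth (f : TestFunction Ω ℂ ⊤) : SmoothFn Ω :=
  ⟨f, (f.contDiff.of_le le_rfl).contDiffOn, fun _ hx => image_eq_zero_of_notMem_tsupport
    fun h => hx (f.tsupport_subset h)⟩

/-- A functional `T` in `L(𝒢_c(Ω), C̃)` is basic if it is given by a net `(T_ε)` in `𝒟'(Ω)` such
that for every `K` there are `j`, `N` with `|T_ε(f)| ≤ ε ^ (-N) p_{K,j}(f)` for all `f ∈ 𝒟_K(Ω)` and
all small `ε`. The equality `T u = [(T_ε u_ε)]` refers to the representatives of `u` by nets of
test functions with supports in a common compact set. -/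
def IsBasicGc (T : Gc Ω →L[CTilde] CTilde) : Prop :=
  ∃ t : Idx → (TestFunction Ω ℂ ⊤ →L[ℂ] ℂ),
    (∀ K : CompactIn Ω, ∃ (j N : ℕ) (η : Idx), ∀ (f : TestFunction Ω ℂ ⊤) (ε : Idx),
      tsupport f ⊆ K.1 → ε ≤ η →
        ‖t ε f‖ ≤ (ε : ℝ) ^ (-(N : ℝ)) * pSeminorm Ω (K, j) (testToSmooth f)) ∧
    ∀ (u : Gc Ω) (f : Idx → TestFunction Ω ℂ ⊤)
      (hf : (fun ε => testToSmooth (f ε)) ∈ moderate (pSeminorm Ω)),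
      (∃ K : CompactIn Ω, ∀ ε, tsupport (f ε) ⊆ K.1) → GE.mk _ ⟨_, hf⟩ = u.toG →
        ∃ h : (fun ε => t ε (f ε)) ∈ modScalars, T u = CTilde.mk ⟨_, h⟩

/-- The basic functionals in `L(𝒢(Ω), C̃)`. -/
def BasicDualG (Ω : Opens V) : Type _ := {T : G Ω →L[CTilde] CTilde // IsBasicG T}

/-- The basic functionals in `L(𝒢_c(Ω), C̃)`. -/
def BasicDualGc (Ω : Opens V) : Type _ := {T : Gc Ω →L[CTilde] CTilde // IsBasicGc T}

/-- The bounded subsets of `𝒢(Ω)`. -/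
def IsBoundedG (B : Set (G Ω)) : Prop := ∀ κ : CompactIn Ω × ℕ, ⨆ u ∈ B, GE.ups κ u < ⊤

/-- The bounded subsets of `𝒢_c(Ω)`. -/
def IsBoundedGc (B : Set (Gc Ω)) : Prop :=
  ∀ Q : GcUps Ω, ⨆ u ∈ B, (Q.1.toFun u : ℝ≥0∞) < ⊤

/-- The topology of uniform convergence on bounded subsets of `𝒢(Ω)`. -/
instance : TopologicalSpace (BasicDualG Ω) :=
  gaugeTopology fun (B : {B : Set (G Ω) // IsBoundedG B}) S T =>
    ⨆ u ∈ B.1, CTilde.enorm (T.1 u - S.1 u)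

/-- The topology of uniform convergence on bounded subsets of `𝒢_c(Ω)`. -/
instance : TopologicalSpace (BasicDualGc Ω) :=
  gaugeTopology fun (B : {B : Set (Gc Ω) // IsBoundedGc B}) S T =>
    ⨆ u ∈ B.1, CTilde.enorm (T.1 u - S.1 u)

end Smooth

/-! ### Integration over compact sets -/

section Integral

variable {n : ℕ} {Ω : Opens (EuclideanSpace ℝ (Fin n))}

/-- The open set `Ω × Ω`. -/
def sq (Ω : Opens (EuclideanSpace ℝ (Fin n))) :
    Opens (EuclideanSpace ℝ (Fin n) × EuclideanSpace ℝ (Fin n)) :=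
  ⟨(Ω : Set (EuclideanSpace ℝ (Fin n))) ×ˢ Ω, Ω.isOpen.prod Ω.isOpen⟩

theorem slice_map (y : EuclideanSpace ℝ (Fin n)) (K : CompactIn Ω) (hy : y ∈ Ω) :
    Set.MapsTo (fun x => (x, y)) K.1 ((Ω : Set (EuclideanSpace ℝ (Fin n))) ×ˢ Ω) :=
  fun _ hx => ⟨K.2.2 hx, hy⟩

theorem hasFDerivAt_param {F : Type} [NormedAddCommGroup F] [NormedSpace ℝ F]
    {h : EuclideanSpace ℝ (Fin n) × EuclideanSpace ℝ (Fin n) → F}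
    (hs : ContDiffOn ℝ ∞ h ((Ω : Set (EuclideanSpace ℝ (Fin n))) ×ˢ Ω)) (K : CompactIn Ω)
    {y : EuclideanSpace ℝ (Fin n)} (hy : y ∈ Ω) :
    HasFDerivAt (fun y => ∫ x in K.1, h (x, y))
      (∫ x in K.1, (fderiv ℝ h (x, y)).comp (ContinuousLinearMap.inr ℝ _ _)) y := by
  have hopen : IsOpen ((Ω : Set (EuclideanSpace ℝ (Fin n))) ×ˢ (Ω : Set (EuclideanSpace ℝ (Fin n)))) :=
    Ω.isOpen.prod Ω.isOpen
  obtain ⟨r, hr, hrΩ⟩ := Metric.nhds_basis_closedBall.mem_iff.1 (Ω.isOpen.mem_nhds hy)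
  have hd : ContinuousOn (fun q => (fderiv ℝ h q).comp (ContinuousLinearMap.inr ℝ
      (EuclideanSpace ℝ (Fin n)) (EuclideanSpace ℝ (Fin n)))) ((Ω : Set (EuclideanSpace ℝ (Fin n))) ×ˢ (Ω : Set (EuclideanSpace ℝ (Fin n)))) :=
    (hs.continuousOn_fderiv_of_isOpen hopen (by simp)).clm_comp continuousOn_const
  obtain ⟨C, hC⟩ := (K.2.1.prod (isCompact_closedBall y r)).exists_bound_of_continuousOn
    (hd.mono (Set.prod_mono K.2.2 hrΩ))
  have hKfin : volume K.1 < ⊤ := K.2.1.measure_lt_top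
  have : IsFiniteMeasure (volume.restrict K.1) := ⟨by simpa using hKfin⟩
  have hmeas : ∀ {F' : Type} [NormedAddCommGroup F'] [NormedSpace ℝ F']
      {g : EuclideanSpace ℝ (Fin n) × EuclideanSpace ℝ (Fin n) → F'}
      (_ : ContinuousOn g ((Ω : Set (EuclideanSpace ℝ (Fin n))) ×ˢ (Ω : Set (EuclideanSpace ℝ (Fin n))))) {z} (_ : z ∈ Ω),
      IntegrableOn (fun x => g (x, z)) K.1 := by
    intro F' _ _ g hg z hz
    exact (hg.comp (Continuous.continuousOn (by fun_prop)) (slice_map z K hz)).integrableOn_compact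
      K.2.1
  refine hasFDerivAt_integral_of_dominated_of_fderiv_le (μ := volume.restrict K.1)
    (F := fun y x => h (x, y))
    (F' := fun y x => (fderiv ℝ h (x, y)).comp (ContinuousLinearMap.inr ℝ _ _))
    (bound := fun _ => C) (Metric.ball_mem_nhds y hr) ?_ ?_ ?_ ?_ ?_ ?_
  · filter_upwards [Ω.isOpen.mem_nhds hy] with z hz
    exact (hmeas hs.continuousOn hz).aestronglyMeasurable
  · exact hmeas hs.continuousOn hy
  · exact (hmeas hd hy).aestronglyMeasurable
  · filter_upwards [ae_restrict_mem K.2.1.measurableSet] with x hx z hz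
    exact hC (x, z) ⟨hx, Metric.ball_subset_closedBall hz⟩
  · exact integrable_const _
  · filter_upwards [ae_restrict_mem K.2.1.measurableSet] with x hx z hz
    have hz' : z ∈ Ω := hrΩ (Metric.ball_subset_closedBall hz)
    have h1 : HasFDerivAt h (fderiv ℝ h (x, z)) (x, z) :=
      ((hs.contDiffAt (hopen.mem_nhds ⟨K.2.2 hx, hz'⟩)).differentiableAt (by simp)).hasFDerivAt
    exact h1.comp z (hasFDerivAt_prodMk_right x z)

theorem contDiffOn_partial {F : Type} [NormedAddCommGroup F] [NormedSpace ℝ F]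
    {h : EuclideanSpace ℝ (Fin n) × EuclideanSpace ℝ (Fin n) → F}
    (hs : ContDiffOn ℝ ∞ h ((Ω : Set (EuclideanSpace ℝ (Fin n))) ×ˢ Ω)) :
    ContDiffOn ℝ ∞ (fun q => (fderiv ℝ h q).comp (ContinuousLinearMap.inr ℝ
      (EuclideanSpace ℝ (Fin n)) (EuclideanSpace ℝ (Fin n)))) ((Ω : Set (EuclideanSpace ℝ (Fin n))) ×ˢ (Ω : Set (EuclideanSpace ℝ (Fin n)))) :=
  (hs.fderiv_of_isOpen (Ω.isOpen.prod Ω.isOpen) (by simp)).clm_comp contDiffOn_const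

theorem contDiffOn_param (m : ℕ) : ∀ {F : Type} [NormedAddCommGroup F] [NormedSpace ℝ F]
    {h : EuclideanSpace ℝ (Fin n) × EuclideanSpace ℝ (Fin n) → F}
    (_ : ContDiffOn ℝ ∞ h ((Ω : Set (EuclideanSpace ℝ (Fin n))) ×ˢ Ω)) (K : CompactIn Ω),
    ContDiffOn ℝ m (fun y => ∫ x in K.1, h (x, y)) Ω := by
  induction m with
  | zero =>
    intro F _ _ h hs K
    exact contDiffOn_zero.2 fun y hy =>
      (hasFDerivAt_param hs K hy).continuousAt.continuousWithinAt
  | succ m ih =>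
    intro F _ _ h hs K
    rw [Nat.cast_add, Nat.cast_one, contDiffOn_succ_iff_fderiv_of_isOpen Ω.isOpen]
    refine ⟨fun y hy => (hasFDerivAt_param hs K hy).differentiableAt.differentiableWithinAt,
      by simp, ?_⟩
    exact (ih (contDiffOn_partial hs) K).congr fun y hy => (hasFDerivAt_param hs K hy).fderiv

theorem norm_param_le (j : ℕ) : ∀ {F : Type} [NormedAddCommGroup F] [NormedSpace ℝ F]
    {h : EuclideanSpace ℝ (Fin n) × EuclideanSpace ℝ (Fin n) → F}
    (_ : ContDiffOn ℝ ∞ h ((Ω : Set (EuclideanSpace ℝ (Fin n))) ×ˢ Ω)) (K : CompactIn Ω)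
    {y : EuclideanSpace ℝ (Fin n)} (_ : y ∈ Ω) {C : ℝ}
    (_ : ∀ x ∈ K.1, ‖iteratedFDeriv ℝ j (fun z => h (x, z)) y‖ ≤ C),
    ‖iteratedFDeriv ℝ j (fun y => ∫ x in K.1, h (x, y)) y‖ ≤ C * volume.real K.1 := by
  induction j with
  | zero =>
    intro F _ _ h hs K y hy C hC
    rw [norm_iteratedFDeriv_zero]
    refine norm_setIntegral_le_of_norm_le_const K.2.1.measure_lt_top fun x hx => ?_
    simpa using hC x hx
  | succ j ih =>
    intro F _ _ h hs K y hy C hC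
    rw [← norm_iteratedFDeriv_fderiv]
    have e : fderiv ℝ (fun y => ∫ x in K.1, h (x, y)) =ᶠ[𝓝 y]
        fun y => ∫ x in K.1, (fderiv ℝ h (x, y)).comp (ContinuousLinearMap.inr ℝ _ _) := by
      filter_upwards [Ω.isOpen.mem_nhds hy] with z hz
      exact (hasFDerivAt_param hs K hz).fderiv
    rw [(e.iteratedFDeriv ℝ j).eq_of_nhds]
    refine ih (contDiffOn_partial hs) K hy fun x hx => ?_
    have e' : (fun z => (fderiv ℝ h (x, z)).comp (ContinuousLinearMap.inr ℝ _ _)) =ᶠ[𝓝 y]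
        fderiv ℝ (fun z => h (x, z)) := by
      filter_upwards [Ω.isOpen.mem_nhds hy] with z hz
      have h1 : HasFDerivAt h (fderiv ℝ h (x, z)) (x, z) :=
        ((hs.contDiffAt ((Ω.isOpen.prod Ω.isOpen).mem_nhds
          ⟨K.2.2 hx, hz⟩)).differentiableAt (by simp)).hasFDerivAt
      exact (h1.comp z (hasFDerivAt_prodMk_right x z)).fderiv.symm
    rw [(e'.iteratedFDeriv ℝ j).eq_of_nhds, norm_iteratedFDeriv_fderiv]
    exact hC x hx

theorem norm_slice_le {k : EuclideanSpace ℝ (Fin n) × EuclideanSpace ℝ (Fin n) → ℂ}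
    (hs : ContDiffOn ℝ ∞ k ((Ω : Set (EuclideanSpace ℝ (Fin n))) ×ˢ Ω))
    {x y : EuclideanSpace ℝ (Fin n)} (hx : x ∈ Ω) (hy : y ∈ Ω) (j : ℕ) :
    ‖iteratedFDeriv ℝ j (fun z => k (x, z)) y‖ ≤ ‖iteratedFDeriv ℝ j k (x, y)‖ := by
  let E := EuclideanSpace ℝ (Fin n)
  let s : Set (E × E) := (fun q : E × E => (x, (0 : E)) + q) ⁻¹' ((Ω : Set E) ×ˢ (Ω : Set E))
  have hopen : IsOpen s := (Ω.isOpen.prod Ω.isOpen).preimage (by fun_prop)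
  let g : E × E → ℂ := fun q => k ((x, (0 : E)) + q)
  have hg : ContDiffOn ℝ ∞ g s := hs.comp (by fun_prop) fun q hq => hq
  have hpre : (ContinuousLinearMap.inr ℝ E E) ⁻¹' s = Ω := by
    ext z
    simp [s, hx]
  have hmem : ContinuousLinearMap.inr ℝ E E y ∈ s := by
    have : y ∈ (ContinuousLinearMap.inr ℝ E E) ⁻¹' s := by rw [hpre]; exact hy
    exact this
  have key := (ContinuousLinearMap.inr ℝ E E).iteratedFDerivWithin_comp_right (i := j) hg
    hopen.uniqueDiffOn (by rw [hpre]; exact Ω.isOpen.uniqueDiffOn) hmem (by exact_mod_cast le_top)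
  rw [hpre, iteratedFDerivWithin_of_isOpen j Ω.isOpen hy,
    iteratedFDerivWithin_of_isOpen j hopen hmem] at key
  have e1 : (g ∘ ContinuousLinearMap.inr ℝ E E) = fun z => k (x, z) := by
    funext z
    simp [g]
  have e2 : iteratedFDeriv ℝ j g (ContinuousLinearMap.inr ℝ E E y) =
      iteratedFDeriv ℝ j k (x, y) := by
    have := iteratedFDeriv_comp_add_left (𝕜 := ℝ) (f := k) j (x, (0 : E))
      (ContinuousLinearMap.inr ℝ E E y)
    simpa [g] using this
  rw [e1, e2] at key
  rw [key]
  refine (ContinuousMultilinearMap.norm_compContinuousLinearMap_le _ _).trans ?_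
  refine mul_le_of_le_one_right (norm_nonneg _) ?_
  exact Finset.prod_le_one (fun _ _ => norm_nonneg _)
    fun _ _ => ContinuousLinearMap.norm_inr_le_one ℝ E E

theorem contDiffOn_mul_left (k : SmoothFn (sq Ω)) (u : SmoothFn Ω) :
    ContDiffOn ℝ ∞ (fun q : EuclideanSpace ℝ (Fin n) × EuclideanSpace ℝ (Fin n) =>
      k.1 q * u.1 q.1) ((Ω : Set (EuclideanSpace ℝ (Fin n))) ×ˢ Ω) :=
  ContDiffOn.mul k.2.1 (u.2.1.comp contDiffOn_fst fun _ hq => hq.1)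

/-- The smooth function `y ↦ ∫_K k(x, y) u(x) dx`. -/
def intFn (K : CompactIn Ω) (k : SmoothFn (sq Ω)) (u : SmoothFn Ω) : SmoothFn Ω :=
  ⟨fun y => ∫ x in K.1, k.1 (x, y) * u.1 x,
    contDiffOn_infty.2 fun m => contDiffOn_param m (contDiffOn_mul_left k u) K,
    fun y hy => by
      have h : ∀ x, k.1 (x, y) = 0 := fun x => k.2.2 (x, y) fun h => hy h.2
      simp [h]⟩

theorem integrableOn_slice (K : CompactIn Ω) (k : SmoothFn (sq Ω)) (u : SmoothFn Ω)
    (y : EuclideanSpace ℝ (Fin n)) : IntegrableOn (fun x => k.1 (x, y) * u.1 x) K.1 := by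
  by_cases hy : y ∈ Ω
  · exact ((contDiffOn_mul_left k u).continuousOn.comp
      (Continuous.continuousOn (by fun_prop)) (slice_map y K hy)).integrableOn_compact K.2.1
  · have h : ∀ x, k.1 (x, y) = 0 := fun x => k.2.2 (x, y) fun h => hy h.2
    simp [h]

/-- The bilinear map `(k, u) ↦ ∫_K k(x, ·) u(x) dx`. -/
def intBilin (K : CompactIn Ω) : SmoothFn (sq Ω) →ₗ[ℂ] SmoothFn Ω →ₗ[ℂ] SmoothFn Ω :=
  LinearMap.mk₂ ℂ (intFn K)
    (fun k k' u => Subtype.ext <| funext fun y => by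
      change ∫ x in K.1, (k.1 (x, y) + k'.1 (x, y)) * u.1 x =
        (∫ x in K.1, k.1 (x, y) * u.1 x) + ∫ x in K.1, k'.1 (x, y) * u.1 x
      rw [← integral_add (integrableOn_slice K k u y) (integrableOn_slice K k' u y)]
      simp only [add_mul])
    (fun c k u => Subtype.ext <| funext fun y => by
      change ∫ x in K.1, (c * k.1 (x, y)) * u.1 x = c * ∫ x in K.1, k.1 (x, y) * u.1 x
      rw [← integral_const_mul]
      simp only [mul_assoc])
    (fun k u u' => Subtype.ext <| funext fun y => by
      change ∫ x in K.1, k.1 (x, y) * (u.1 x + u'.1 x) =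
        (∫ x in K.1, k.1 (x, y) * u.1 x) + ∫ x in K.1, k.1 (x, y) * u'.1 x
      rw [← integral_add (integrableOn_slice K k u y) (integrableOn_slice K k u' y)]
      simp only [mul_add])
    (fun c k u => Subtype.ext <| funext fun y => by
      change ∫ x in K.1, k.1 (x, y) * (c * u.1 x) = c * ∫ x in K.1, k.1 (x, y) * u.1 x
      rw [← integral_const_mul]
      simp only [mul_left_comm])

/-- The compact subset `K × L` of `Ω × Ω`. -/
def CompactIn.prod (K L : CompactIn Ω) : CompactIn (sq Ω) :=
  ⟨K.1 ×ˢ L.1, K.2.1.prod L.2.1, Set.prod_mono K.2.2 L.2.2⟩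

theorem norm_apply_le_pValue (K : CompactIn Ω) (i : ℕ) (u : SmoothFn Ω)
    {x : EuclideanSpace ℝ (Fin n)} (hx : x ∈ K.1) : ‖u.1 x‖ ≤ pValue K i u := by
  simpa using le_pValue K (Nat.zero_le i) u hx

theorem intBilin_le (K L : CompactIn Ω) (i : ℕ) (k : SmoothFn (sq Ω)) (u : SmoothFn Ω) :
    pSeminorm Ω (L, i) (intBilin K k u) ≤
      volume.real K.1 * (pSeminorm (sq Ω) (K.prod L, i) k * pSeminorm Ω (K, 0) u) := by
  change pValue L i (intFn K k u) ≤
    volume.real K.1 * (pValue (K.prod L) i k * pValue K 0 u)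
  refine pValue_le _ _ _ (mul_nonneg measureReal_nonneg
    (mul_nonneg (pValue_nonneg _ _ _) (pValue_nonneg _ _ _))) fun y hy j hj => ?_
  rw [mul_comm (volume.real K.1)]
  refine norm_param_le j (contDiffOn_mul_left k u) K (L.2.2 hy) fun x hx => ?_
  have e : (fun z => k.1 (x, z) * u.1 x) = (u.1 x) • fun z => k.1 (x, z) := by
    funext z
    simp [mul_comm]
  have hk : ContDiffAt ℝ j (fun z => k.1 (x, z)) y :=
    ContDiffAt.comp y (k.contDiffAt (x := (x, y)) ⟨K.2.2 hx, L.2.2 hy⟩ j) (by fun_prop)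
  change ‖iteratedFDeriv ℝ j (fun z => k.1 (x, z) * u.1 x) y‖ ≤ _
  rw [e, iteratedFDeriv_const_smul_apply hk, norm_smul, mul_comm]
  refine mul_le_mul ?_ (norm_apply_le_pValue K 0 u hx) (norm_nonneg _) (pValue_nonneg _ _ _)
  exact (norm_slice_le k.2.1 (K.2.2 hx) (L.2.2 hy) j).trans
    (le_pValue (K.prod L) hj k (x := (x, y)) ⟨hx, hy⟩)

theorem intBilin_bound (K : CompactIn Ω) (κ : CompactIn Ω × ℕ) :
    BilinBound (pSeminorm (sq Ω)) (pSeminorm Ω) (pSeminorm Ω κ) (intBilin K) :=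
  ⟨(K.prod κ.1, κ.2), (K, 0), volume.real K.1, fun k u => intBilin_le K κ.1 κ.2 k u⟩

theorem integrableOn_mul (K : CompactIn Ω) (f u : SmoothFn Ω) :
    IntegrableOn (fun x => f.1 x * u.1 x) K.1 :=
  ((f.2.1.continuousOn.mul u.2.1.continuousOn).mono K.2.2).integrableOn_compact K.2.1

/-- The bilinear form `(f, u) ↦ ∫_K f(x) u(x) dx`. -/
def intForm (K : CompactIn Ω) : SmoothFn Ω →ₗ[ℂ] SmoothFn Ω →ₗ[ℂ] ℂ :=
  LinearMap.mk₂ ℂ (fun f u => ∫ x in K.1, f.1 x * u.1 x)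
    (fun f f' u => by
      rw [← integral_add (integrableOn_mul K f u) (integrableOn_mul K f' u)]
      simp only [Submodule.coe_add, Pi.add_apply, add_mul])
    (fun c f u => by
      rw [smul_eq_mul, ← integral_const_mul]
      simp only [Submodule.coe_smul, Pi.smul_apply, smul_eq_mul, mul_assoc])
    (fun f u u' => by
      rw [← integral_add (integrableOn_mul K f u) (integrableOn_mul K f u')]
      simp only [Submodule.coe_add, Pi.add_apply, mul_add])
    (fun c f u => by
      rw [smul_eq_mul, ← integral_const_mul]
      simp only [Submodule.coe_smul, Pi.smul_apply, smul_eq_mul, mul_left_comm])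

theorem intForm_bound (K : CompactIn Ω) :
    BilinBound (pSeminorm Ω) (pSeminorm Ω) (normSeminorm ℂ ℂ) (intForm K) := by
  refine ⟨(K, 0), (K, 0), volume.real K.1, fun f u => ?_⟩
  change ‖∫ x in K.1, f.1 x * u.1 x‖ ≤ volume.real K.1 * (pValue K 0 f * pValue K 0 u)
  rw [mul_comm]
  refine norm_setIntegral_le_of_norm_le_const K.2.1.measure_lt_top fun x hx => ?_
  rw [norm_mul]
  exact mul_le_mul (norm_apply_le_pValue K 0 f hx) (norm_apply_le_pValue K 0 u hx)
    (norm_nonneg _) (pValue_nonneg _ _ _)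

/-! ### Integral operators and their transposes -/

/-- `[(∫_K k_ε(x, ·) u_ε(x) dx)_ε] ∈ 𝒢(Ω)` for `k ∈ 𝒢(Ω × Ω)` and `u ∈ 𝒢(Ω)`. -/
def intOver (K : CompactIn Ω) (k : G (sq Ω)) (u : G Ω) : G Ω :=
  GE.map₂ (intBilin K) (intBilin_bound K) k u

/-- `∫_K f(x) u(x) dx = [(∫_K f_ε(x) u_ε(x) dx)_ε] ∈ C̃` for `f, u ∈ 𝒢(Ω)`. -/
def pairOver (K : CompactIn Ω) (f u : G Ω) : CTilde :=
  GE.form₂ (intForm K) (intForm_bound K) f u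

theorem Gc.exists_nhd (u : Gc Ω) : ∃ K : CompactIn Ω, supp u.toG ⊆ interior K.1 := by
  obtain ⟨L, hL⟩ : ∃ K : CompactIn Ω, supp u.toG ⊆ K.1 := u.2
  obtain ⟨K, hK, h1, h2⟩ := exists_compact_between L.2.1 Ω.isOpen L.2.2
  exact ⟨⟨K, hK, h2⟩, hL.trans h1⟩

/-- A compact neighbourhood in `Ω` of the support of `u`. -/
def Gc.nhd (u : Gc Ω) : CompactIn Ω := u.exists_nhd.choose

/-- `∫_Ω f(x) u(x) dx ∈ C̃` for `f ∈ 𝒢(Ω)` and `u ∈ 𝒢_c(Ω)`; the integral of a generalized function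
with compact support is its integral over any compact neighbourhood of the support. -/
def pairing (f : G Ω) (u : Gc Ω) : CTilde := pairOver u.nhd f u.toG

/-- The transpose `ᵗR : 𝒢_c(Ω) → 𝒢(Ω)`, `ᵗR u (y) = ∫_Ω k(x, y) u(x) dx`, of the operator
`R u (x) = ∫_Ω k(x, y) u(y) dy` with kernel `k ∈ 𝒢(Ω × Ω)`. -/
def transposeOp (k : G (sq Ω)) (u : Gc Ω) : G Ω := intOver u.nhd k u.toG

/-- `S ⊆ Ω × Ω` is a proper subset: for compact `K ⊆ Ω`, the sets `π₂(S ∩ π₁⁻¹(K))` and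
`π₁(S ∩ π₂⁻¹(K))` are relatively compact in `Ω`. -/
def IsProperSubset (Ω : Opens (EuclideanSpace ℝ (Fin n)))
    (S : Set (EuclideanSpace ℝ (Fin n) × EuclideanSpace ℝ (Fin n))) : Prop :=
  ∀ K : CompactIn Ω, (∃ L : CompactIn Ω, Prod.snd '' (S ∩ Prod.fst ⁻¹' K.1) ⊆ L.1) ∧
    ∃ L : CompactIn Ω, Prod.fst '' (S ∩ Prod.snd ⁻¹' K.1) ⊆ L.1

/-- The operator with kernel `k` is properly supported. -/
def IsProperlySupported (k : G (sq Ω)) : Prop := IsProperSubset Ω (supp k)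

/-- A generalized function is negligible near compact sets which do not meet its support. -/
theorem negligible_of_disjoint {V : Type*} [NormedAddCommGroup V] [NormedSpace ℝ V]
    [LocallyCompactSpace V] {Ω : Opens V} (v : moderate (pSeminorm Ω)) (L : CompactIn Ω)
    (h : ∀ x ∈ L.1, x ∉ supp (GE.mk _ v)) (i : ℕ) :
    IsNegligibleNet fun ε => pSeminorm Ω (L, i) (v.1 ε) := by
  have key : ∃ K : CompactIn Ω, L.1 ⊆ K.1 ∧
      IsNegligibleNet fun ε => pSeminorm Ω (K, i) (v.1 ε) := by
    refine L.2.1.induction_on (p := fun s => ∃ K : CompactIn Ω, s ⊆ K.1 ∧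
      IsNegligibleNet fun ε => pSeminorm Ω (K, i) (v.1 ε)) ?_ ?_ ?_ ?_
    · refine ⟨⟨∅, isCompact_empty, Set.empty_subset _⟩, le_rfl, ?_⟩
      refine IsNegligibleNet.zero.of_le (fun _ => apply_nonneg _ _) fun ε => ?_
      exact pValue_le _ _ _ le_rfl fun x hx => absurd hx (Set.notMem_empty x)
    · rintro s t hst ⟨K, hK, hn⟩
      exact ⟨K, hst.trans hK, hn⟩
    · rintro s t ⟨K, hK, hn⟩ ⟨K', hK', hn'⟩
      refine ⟨⟨K.1 ∪ K'.1, K.2.1.union K'.2.1, Set.union_subset K.2.2 K'.2.2⟩,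
        Set.union_subset_union hK hK', ?_⟩
      refine (hn.add hn').of_le (fun _ => apply_nonneg _ _) fun ε => ?_
      refine pValue_le _ _ _ (add_nonneg (pValue_nonneg _ _ _) (pValue_nonneg _ _ _)) ?_
      rintro x (hx | hx) j hj
      · exact (le_pValue K hj _ hx).trans (le_add_of_nonneg_right (pValue_nonneg _ _ _))
      · exact (le_pValue K' hj _ hx).trans (le_add_of_nonneg_left (pValue_nonneg _ _ _))
    · intro x hx
      have hx' := h x hx
      simp only [supp, Set.mem_ofPred_eq, not_and, not_forall, not_not] at hx'
      obtain ⟨W, hW, hWΩ, hxW, hv⟩ := hx' (L.2.2 hx)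
      obtain ⟨K, hK, hxK, hKW⟩ := exists_compact_subset hW hxW
      exact ⟨K, mem_nhdsWithin_of_mem_nhds (mem_interior_iff_mem_nhds.1 hxK),
        ⟨⟨K, hK, hKW.trans hWΩ⟩, le_rfl, vanishesOn_mk.1 hv (⟨K, hK, hKW.trans hWΩ⟩, i) hKW⟩⟩
  obtain ⟨K, hLK, hn⟩ := key
  exact hn.of_le (fun _ => apply_nonneg _ _) fun ε =>
    pValue_le _ _ _ (pValue_nonneg _ _ _) fun x hx j hj => le_pValue K hj _ (hLK hx)

theorem transposeOp_mem (k : G (sq Ω)) (hk : IsProperlySupported k) (u : Gc Ω) :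
    transposeOp k u ∈ gcSubmodule Ω := by
  obtain ⟨L, hL⟩ := (hk u.nhd).1
  refine ⟨L, fun y hy => ?_⟩
  by_contra hyL
  refine hy.2 ((Ω : Set (EuclideanSpace ℝ (Fin n))) \ L.1) (Ω.isOpen.sdiff L.2.1.isClosed)
    Set.sdiff_subset ⟨hy.1, hyL⟩ ?_
  obtain ⟨a, rfl⟩ := GE.mk_surjective k
  obtain ⟨b, hb⟩ := GE.mk_surjective u.toG
  unfold transposeOp
  rw [← hb]
  refine vanishesOn_mk.2 fun κ hκ => ?_
  have hn := negligible_of_disjoint a (u.nhd.prod κ.1) (fun q hq hs =>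
    (hκ hq.2).2 (hL ⟨q, ⟨hs, hq.1⟩, rfl⟩)) κ.2
  exact ((hn.mul_moderate (b.2 (u.nhd, 0))).const_mul (volume.real u.nhd.1)).of_le
    (fun _ => apply_nonneg _ _) fun ε => intBilin_le _ _ _ _ _

/-- The transpose `ᵗR : 𝒢_c(Ω) → 𝒢_c(Ω)` of a properly supported operator. -/
def transposeOpC (k : G (sq Ω)) (hk : IsProperlySupported k) (u : Gc Ω) : Gc Ω :=
  ⟨transposeOp k u, transposeOp_mem k hk u⟩

/-! ### The action on basic functionals -/

/-- The functional `R T ∈ L(𝒢_c(Ω), C̃)`, `R T (u) = T (ᵗR u)`, for `T` a basic functional in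
`L(𝒢(Ω), C̃)`. -/
def opDual (k : G (sq Ω)) (T : BasicDualG Ω) : Gc Ω → CTilde := fun u => T.1 (transposeOp k u)

/-- The functional `R T ∈ L(𝒢_c(Ω), C̃)`, `R T (u) = T (ᵗR u)`, for `T` a basic functional in
`L(𝒢_c(Ω), C̃)` and `R` properly supported. -/
def opDualC (k : G (sq Ω)) (hk : IsProperlySupported k) (T : BasicDualGc Ω) : Gc Ω → CTilde :=
  fun u => T.1 (transposeOpC k hk u)

/-- The embedding of `𝒢(Ω)` into `L(𝒢_c(Ω), C̃)`: `f` acts as `u ↦ ∫_Ω f(x) u(x) dx`. -/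
def G.toDual (f : G Ω) : Gc Ω → CTilde := fun u => pairing f u

/-- The embedding of `𝒢_c(Ω)` into `L(𝒢(Ω), C̃)`: `g` acts as `u ↦ ∫_Ω u(x) g(x) dx`. -/
def Gc.toDual (g : Gc Ω) : G Ω → CTilde := fun u => pairing u g

/-- `S : 𝒢(Ω) → 𝒢(Ω)` is a continuous `C̃`-linear extension of `ᵗR : 𝒢_c(Ω) → 𝒢(Ω)`. -/
def ExtendsTranspose (k : G (sq Ω)) (S : G Ω →L[CTilde] G Ω) : Prop :=
  ∀ u : Gc Ω, S u.toG = transposeOp k u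

end Integral

end

end Colombeau

open Colombeau

/-!
A basic functional `T` on `𝒢(Ω)` is given by a net of distributions `t_ε ∈ ℰ'(Ω)` with a uniform
bound `|t_ε(f)| ≤ ε ^ (-N) p_{L,m}(f)`. If `a_ε` represents the kernel `k`, then `R T` is the class
of the net of functions `x ↦ t_ε(a_ε(x, ·))`.

**Existence.** These functions are smooth, and their derivatives are the values of `t_ε` on slices
of partial derivatives of `a_ε` in the first variable (`iteratedFDeriv_applySlices`). The bound on
`t_ε` makes the net moderate, and regular if `a_ε` is regular. Distributions commute with integrals
over compact sets (`apply_intFn`): both sides agree on products `φ(x) g(y)`, and a partition of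
unity approximates the kernel by sums of such products, uniformly with respect to `x` in the
seminorms `p_{L,m}` of the slices. Hence `T(ᵗR u) = ∫ (R T) u` (`BasicNet.opDual_eq`).

**Proper supports.** A properly supported kernel has a representative whose supports lie in a common
proper set (`exists_proper_rep`), obtained by multiplication with a cutoff function, so that
regularity is preserved. For such a representative, `ᵗR` acts on all of `𝒢(Ω)` (`transposeExt`), and
the functions `t_ε(a_ε(x, ·))` have their supports in a common compact set. For a basic functional
on `𝒢_c(Ω)`, near a compact set of points `x` the distributions `t_ε ∈ 𝒟'(Ω)` may be multiplied by a
fixed test function, which reduces this case to compactly supported distributions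
(`LocalNet.exists_basicNet_pValue`).

**Continuity.** Up to a factor `2`, the seminorm `p_{K,i}` of `x ↦ t(a_ε(x, ·))` is a value `|t(w)|`
with `w` among the derivatives of slices of `a_ε` (`exists_derivSlice`). Applied to the difference
of two functionals, this gives nets `w_ε` in a set which is bounded because `a` is moderate; if `a`
is regular, it is bounded even when all orders `i` are allowed at once. Multiplication with
`ε ^ (-c)` keeps the set bounded and turns closeness at scale `1` into a bound `O(ε ^ c)`
(`BasicNet.exists_bounded_test`, `LocalNet.exists_bounded_test`). For the inductive limit
topologies, a continuous ultra-pseudo-seminorm prescribes different compact sets, orders and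
exponents on the pieces of a partition of unity `(φ_m)`. Still a single bounded set controls all
pieces, since on every compact set of points `y` only finitely many of the kernels
`φ_m(x) a_ε(x, y)` do not vanish, and ultrametric estimates do not see the number of terms of a sum.
-/

namespace Colombeau

noncomputable section

/-! ### Growth scales -/

theorem eventually_le_toZero (η : Idx) : ∀ᶠ ε in toZero, ε ≤ η :=
  (Filter.eventually_comap.2 (by
    filter_upwards [Iio_mem_nhds η.pos] with r hr ε hε
    exact (hε ▸ hr.le : (ε : ℝ) ≤ η)))

theorem BigO.of_le_eventually {a a' : Idx → ℝ} {b : ℝ} (h : BigO a b) (h0 : ∀ ε, 0 ≤ a' ε)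
    (hle : ∀ᶠ ε in toZero, a' ε ≤ a ε) : BigO a' b := by
  refine IsBigO.trans (IsBigO.of_bound 1 (hle.mono fun ε hε => ?_)) h
  rw [Real.norm_of_nonneg (h0 ε), Real.norm_of_nonneg ((h0 ε).trans hε), one_mul]
  exact hε

theorem BigO.rpow (b : ℝ) : BigO (fun ε => (ε : ℝ) ^ b) b := isBigO_refl _ _

theorem IsModerateNet.of_le_eventually {a a' : Idx → ℝ} (h : IsModerateNet a) (h0 : ∀ ε, 0 ≤ a' ε)
    (hle : ∀ᶠ ε in toZero, a' ε ≤ a ε) : IsModerateNet a' := by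
  obtain ⟨N, hN⟩ := h
  exact ⟨N, hN.of_le_eventually h0 hle⟩

/-- The scale `e^{-c}` of the values of ultra-pseudo-seminorms: the nets of growth `O(ε ^ c)`
have size at most `e^{-c}`. -/
def scale (c : ℝ) : ℝ≥0∞ := EReal.exp (-(c : EReal))

theorem scale_pos (c : ℝ) : 0 < scale c := by
  unfold scale
  rw [EReal.zero_lt_exp_iff, ← EReal.coe_neg]
  exact EReal.bot_lt_coe _

theorem scale_lt_top (c : ℝ) : scale c < ⊤ := by
  unfold scale
  rw [EReal.exp_lt_top_iff, ← EReal.coe_neg]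
  exact EReal.coe_lt_top _

theorem scale_zero : scale 0 = 1 := by simp [scale]

theorem scale_le_scale {b c : ℝ} (h : b ≤ c) : scale c ≤ scale b := by
  unfold scale
  rw [EReal.exp_le_exp_iff, EReal.neg_le_neg_iff]
  exact_mod_cast h

theorem exists_scale_lt {δ : ℝ≥0∞} (hδ : 0 < δ) : ∃ c : ℕ, scale c < δ := by
  obtain ⟨x, -, hx⟩ := EReal.lt_iff_exists_real_btwn.1
    (show (⊥ : EReal) < ENNReal.log δ from by
      rw [← EReal.zero_lt_exp_iff, ENNReal.exp_log]; exact hδ)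
  obtain ⟨c, hc⟩ := exists_nat_ge (-x)
  refine ⟨c, (scale_le_scale hc).trans_lt ?_⟩
  unfold scale
  rw [← ENNReal.exp_log δ, EReal.exp_lt_exp_iff, ← EReal.coe_neg, neg_neg]
  exact hx

theorem exp_neg_sSup_lt_scale {B : Set ℝ} {c : ℝ} :
    EReal.exp (-sSup ((fun b : ℝ => (b : EReal)) '' B)) < scale c ↔ ∃ b ∈ B, c < b := by
  unfold scale
  rw [EReal.exp_lt_exp_iff, EReal.neg_lt_neg_iff, lt_sSup_iff]
  simp

theorem exp_neg_sSup_le_scale {B : Set ℝ} {c : ℝ} (hc : c ∈ B) :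
    EReal.exp (-sSup ((fun b : ℝ => (b : EReal)) '' B)) ≤ scale c := by
  unfold scale
  rw [EReal.exp_le_exp_iff, EReal.neg_le_neg_iff]
  exact le_sSup ⟨c, hc, rfl⟩

theorem CTilde.enorm_mk_lt_scale {a : modScalars} {c : ℝ} :
    (CTilde.mk a).enorm < scale c ↔ ∃ b, c < b ∧ BigO (fun ε => ‖a.1 ε‖) b :=
  exp_neg_sSup_lt_scale.trans
    ⟨fun ⟨b, h, hb⟩ => ⟨b, hb, h⟩, fun ⟨b, hb, h⟩ => ⟨b, h, hb⟩⟩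

theorem CTilde.enorm_mk_le_scale {a : modScalars} {c : ℝ} (h : BigO (fun ε => ‖a.1 ε‖) c) :
    (CTilde.mk a).enorm ≤ scale c :=
  exp_neg_sSup_le_scale h

theorem CTilde.mk_eq_mk {a b : modScalars} :
    CTilde.mk a = CTilde.mk b ↔ IsNegligibleNet fun ε => ‖a.1 ε - b.1 ε‖ :=
  Ideal.Quotient.eq

theorem CTilde.mk_congr {a b : modScalars} (h : ∀ ε, a.1 ε = b.1 ε) : CTilde.mk a = CTilde.mk b :=
  congrArg _ (Subtype.ext (funext h))

theorem CTilde.mk_surjective (c : CTilde) : ∃ a, CTilde.mk a = c := Ideal.Quotient.mk_surjective c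

/-- The moderate net `ε ^ b`. -/
def powScalar (b : ℝ) : modScalars :=
  ⟨fun ε => (((ε : ℝ) ^ b : ℝ) : ℂ), by
    obtain ⟨N, hN⟩ := exists_nat_ge (-b)
    refine ⟨N, ((BigO.rpow b).mono (by linarith)).of_le (fun _ => norm_nonneg _) fun ε => ?_⟩
    rw [Complex.norm_real, Real.norm_of_nonneg (Real.rpow_nonneg ε.pos.le _)]⟩

theorem norm_powScalar (b : ℝ) (ε : Idx) : ‖(powScalar b).1 ε‖ = (ε : ℝ) ^ b := by
  change ‖(((ε : ℝ) ^ b : ℝ) : ℂ)‖ = _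
  rw [Complex.norm_real, Real.norm_of_nonneg (Real.rpow_nonneg ε.pos.le _)]

theorem powScalar_mul (b c : ℝ) : powScalar b * powScalar c = powScalar (b + c) := by
  refine Subtype.ext (funext fun ε => ?_)
  change (((ε : ℝ) ^ b : ℝ) : ℂ) * (((ε : ℝ) ^ c : ℝ) : ℂ) = (((ε : ℝ) ^ (b + c) : ℝ) : ℂ)
  rw [Real.rpow_add ε.pos, Complex.ofReal_mul]

theorem enorm_powScalar_le (b : ℝ) : (CTilde.mk (powScalar b)).enorm ≤ scale b :=
  CTilde.enorm_mk_le_scale ((BigO.rpow b).of_le (fun _ => norm_nonneg _)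
    fun ε => (norm_powScalar b ε).le)

section GE

variable {E ι : Type*} [AddCommGroup E] [Module ℂ E] {p : ι → Seminorm ℂ E}

theorem GE.upsOn_mk_lt_scale {A : Set ι} {u : moderate p} {c : ℝ} :
    (GE.mk p u).upsOn A < scale c ↔ ∃ b, c < b ∧ ∀ i ∈ A, BigO (fun ε => p i (u.1 ε)) b :=
  exp_neg_sSup_lt_scale.trans
    ⟨fun ⟨b, h, hb⟩ => ⟨b, hb, h⟩, fun ⟨b, hb, h⟩ => ⟨b, h, hb⟩⟩

theorem GE.upsOn_mk_le_scale {A : Set ι} {u : moderate p} {c : ℝ}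
    (h : ∀ i ∈ A, BigO (fun ε => p i (u.1 ε)) c) : (GE.mk p u).upsOn A ≤ scale c :=
  exp_neg_sSup_le_scale h

theorem GE.ups_mk_lt_scale {i : ι} {u : moderate p} {c : ℝ} :
    (GE.mk p u).ups i < scale c ↔ ∃ b, c < b ∧ BigO (fun ε => p i (u.1 ε)) b := by
  unfold GE.ups
  rw [GE.upsOn_mk_lt_scale]
  simp

theorem GE.ups_mk_le_scale {i : ι} {u : moderate p} {c : ℝ}
    (h : BigO (fun ε => p i (u.1 ε)) c) : (GE.mk p u).ups i ≤ scale c :=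
  GE.upsOn_mk_le_scale (by simpa using h)

end GE

/-- Continuity between topologies given by families of distances can be checked one distance of
the target at a time. -/
theorem continuous_gauge {X Y J J' : Type*} {d : J → X → X → ℝ≥0∞} {d' : J' → Y → Y → ℝ≥0∞}
    {f : X → Y}
    (h : ∀ x j', ∀ δ : ℝ≥0∞, 0 < δ → ∃ s : Finset J, ∃ η : ℝ≥0∞, 0 < η ∧
      ∀ y, (∀ j ∈ s, d j x y < η) → d' j' (f x) (f y) < δ) :
    @Continuous X Y (gaugeTopology d) (gaugeTopology d') f := by
  classical
  refine @Continuous.mk X Y (gaugeTopology d) (gaugeTopology d') f fun U hU => ?_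
  intro x hx
  obtain ⟨s', δ, hδ, hs'⟩ := hU (f x) hx
  have key : ∀ s' : Finset J', ∃ s : Finset J, ∃ η : ℝ≥0∞, 0 < η ∧
      ∀ y, (∀ j ∈ s, d j x y < η) → ∀ j' ∈ s', d' j' (f x) (f y) < δ := by
    intro s'
    induction s' using Finset.induction_on with
    | empty => exact ⟨∅, 1, one_pos, fun _ _ _ hj => absurd hj (Finset.notMem_empty _)⟩
    | insert a s' _ ih =>
      obtain ⟨s, η, hη, h1⟩ := ih
      obtain ⟨t, θ, hθ, h2⟩ := h x a δ hδ
      refine ⟨s ∪ t, min η θ, lt_min hη hθ, fun y hy j' hj' => ?_⟩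
      rcases Finset.mem_insert.1 hj' with rfl | hj'
      · exact h2 y fun j hj => (hy j (Finset.mem_union_right _ hj)).trans_le (min_le_right _ _)
      · exact h1 y (fun j hj => (hy j (Finset.mem_union_left _ hj)).trans_le (min_le_left _ _))
          j' hj'
  obtain ⟨s, η, hη, h1⟩ := key s'
  exact ⟨s, η, hη, fun y hy => hs' (h1 y hy)⟩

/-- A continuous real-valued function on a space whose topology is given by distances is small on
a ball around any of its zeros. -/
theorem exists_ball_of_continuous {X J : Type*} {d : J → X → X → ℝ≥0∞} {f : X → ℝ≥0}
    (hf : @Continuous X ℝ≥0 (gaugeTopology d) _ f) {x : X} (hx : f x = 0) {δ : ℝ≥0∞}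
    (hδ : 0 < δ) :
    ∃ s : Finset J, ∃ c : ℕ, ∀ y, (∀ j ∈ s, d j x y ≤ scale c) → (f y : ℝ≥0∞) < δ := by
  have hopen : IsOpen {r : ℝ≥0 | (r : ℝ≥0∞) < δ} :=
    isOpen_Iio.preimage ENNReal.continuous_coe
  have := @IsOpen.preimage X ℝ≥0 (gaugeTopology d) _ f hf _ hopen
  obtain ⟨s, η, hη, hs⟩ := this x (by simpa [hx] using hδ)
  obtain ⟨c, hc⟩ := exists_scale_lt hη
  exact ⟨s, c, fun y hy => hs fun j hj => (hy j hj).trans_lt hc⟩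

/-! ### Partial derivatives and slices of smooth kernels -/

section Slices

variable {n : ℕ} {Ω : Opens (EuclideanSpace ℝ (Fin n))}

/-- A directional derivative commutes with the iterated derivatives, by the symmetry of second
derivatives. -/
theorem iteratedFDeriv_fderiv_apply {V F : Type*} [NormedAddCommGroup V] [NormedSpace ℝ V]
    [NormedAddCommGroup F] [NormedSpace ℝ F] {f : V → F} {s : Set V} (hs : IsOpen s)
    (hf : ContDiffOn ℝ ∞ f s) (a : V) (j : ℕ) {x : V} (hx : x ∈ s) :
    iteratedFDeriv ℝ j (fun y => fderiv ℝ f y a) x = fderiv ℝ (iteratedFDeriv ℝ j f) x a := by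
  have hsm : ∀ (i : ℕ) {y : V}, y ∈ s → ContDiffAt ℝ ∞ (iteratedFDeriv ℝ i f) y := by
    intro i y hy
    exact (hf.contDiffAt (hs.mem_nhds hy)).iteratedFDeriv_right (by exact_mod_cast le_top)
  have hga : ∀ {y : V}, y ∈ s → ContDiffAt ℝ ∞ (fun y => fderiv ℝ f y a) y := fun hy =>
    ((hf.contDiffAt (hs.mem_nhds hy)).fderiv_right (m := ∞) (by simp)).clm_apply contDiffAt_const
  have hap : ∀ (i : ℕ) {y : V} (_ : y ∈ s) (m : Fin i → V) (v : V),
      fderiv ℝ (iteratedFDeriv ℝ i f) y v m = fderiv ℝ (fun z => iteratedFDeriv ℝ i f z m) y v := by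
    intro i y hy m v
    rw [fderiv_continuousMultilinear_apply_const ((hsm i hy).differentiableAt (by simp))]
    simp
  induction j generalizing x with
  | zero =>
    ext m
    rw [hap 0 hx]
    simp
  | succ j ih =>
    ext m
    have hd : DifferentiableAt ℝ (iteratedFDeriv ℝ j fun y => fderiv ℝ f y a) x :=
      ContDiffAt.differentiableAt (n := ∞)
        ((hga hx).iteratedFDeriv_right (by exact_mod_cast le_top)) (by simp)
    have hφ : ContDiffAt ℝ ∞ (fun y => iteratedFDeriv ℝ j f y (Fin.tail m)) x :=
      (ContinuousMultilinearMap.apply ℝ (fun _ : Fin j => V) F (Fin.tail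
        m)).contDiff.contDiffAt.comp x (hsm j hx)
    have hφ' : DifferentiableAt ℝ (fderiv ℝ fun y => iteratedFDeriv ℝ j f y (Fin.tail m)) x :=
      (hφ.fderiv_right (m := ∞) (by simp)).differentiableAt (by simp)
    have e1 : (fun y => iteratedFDeriv ℝ j (fun y => fderiv ℝ f y a) y (Fin.tail m)) =ᶠ[𝓝 x]
        fun y => fderiv ℝ (fun z => iteratedFDeriv ℝ j f z (Fin.tail m)) y a := by
      filter_upwards [hs.mem_nhds hx] with y hy
      rw [ih hy, hap j hy]
    have e2 : (fun y => iteratedFDeriv ℝ (j + 1) f y m) =ᶠ[𝓝 x]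
        fun y => fderiv ℝ (fun z => iteratedFDeriv ℝ j f z (Fin.tail m)) y (m 0) := by
      filter_upwards [hs.mem_nhds hx] with y hy
      rw [iteratedFDeriv_succ_apply_left, hap j hy]
    rw [hd.iteratedFDeriv_succ_apply_left', hap (j + 1) hx, e1.fderiv_eq, e2.fderiv_eq,
      fderiv_clm_apply hφ' (differentiableAt_const a),
      fderiv_clm_apply hφ' (differentiableAt_const (m 0))]
    have hsym := hφ.isSymmSndFDerivAt (by
      rw [minSmoothness_of_isRCLikeNormedField]
      exact WithTop.coe_le_coe.2 le_top)
    simp [hsym.eq (m 0) a]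

theorem isOpen_sq : IsOpen ((sq Ω : Opens _) :
    Set (EuclideanSpace ℝ (Fin n) × EuclideanSpace ℝ (Fin n))) := (sq Ω).isOpen

theorem SmoothFn.contDiffAt_top {V : Type*} [NormedAddCommGroup V] [NormedSpace ℝ V] {Ω : Opens V}
    (f : SmoothFn Ω) {x : V} (hx : x ∈ Ω) : ContDiffAt ℝ ∞ f.1 x :=
  f.2.1.contDiffAt (Ω.isOpen.mem_nhds hx)

theorem SmoothFn.ext {V : Type*} [NormedAddCommGroup V] [NormedSpace ℝ V] {Ω : Opens V}
    {f g : SmoothFn Ω} (h : ∀ x ∈ Ω, f.1 x = g.1 x) : f = g := by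
  refine Subtype.ext (funext fun x => ?_)
  by_cases hx : x ∈ Ω
  · exact h x hx
  · rw [f.2.2 x hx, g.2.2 x hx]

/-- The slice `h(x, ·)` of a kernel; it is zero for `x ∉ Ω`. -/
def slice (x : EuclideanSpace ℝ (Fin n)) : SmoothFn (sq Ω) →ₗ[ℂ] SmoothFn Ω where
  toFun h := ⟨fun y => h.1 (x, y), by
    by_cases hx : x ∈ Ω
    · exact h.2.1.comp (by fun_prop) fun y hy => ⟨hx, hy⟩
    · have : (fun y => h.1 (x, y)) = fun _ => 0 :=
        funext fun y => h.2.2 _ fun hq => hx hq.1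
      rw [this]
      exact contDiffOn_const,
    fun y hy => h.2.2 _ fun hq => hy hq.2⟩
  map_add' _ _ := rfl
  map_smul' _ _ := rfl

theorem slice_apply (x y : EuclideanSpace ℝ (Fin n)) (h : SmoothFn (sq Ω)) :
    (slice x h).1 y = h.1 (x, y) := rfl

theorem slice_eq_zero {x : EuclideanSpace ℝ (Fin n)} (hx : x ∉ Ω) (h : SmoothFn (sq Ω)) :
    slice x h = 0 :=
  Subtype.ext <| funext fun _ => h.2.2 _ fun hq => hx hq.1

/-- The partial derivative `∂_v h(x, y)` of a kernel in the direction `v` of the first variable. -/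
def partialDerivFn (v : EuclideanSpace ℝ (Fin n)) (h : SmoothFn (sq Ω)) : SmoothFn (sq Ω) :=
  ⟨Set.indicator (sq Ω : Set _) fun q => fderiv ℝ h.1 q (v, 0),
    ((h.2.1.fderiv_of_isOpen isOpen_sq (m := ∞) (by simp)).clm_apply contDiffOn_const).congr
      fun q hq => Set.indicator_of_mem hq _,
    fun q hq => Set.indicator_of_notMem hq _⟩

theorem partialDerivFn_apply (v : EuclideanSpace ℝ (Fin n)) (h : SmoothFn (sq Ω))
    {q : EuclideanSpace ℝ (Fin n) × EuclideanSpace ℝ (Fin n)} (hq : q ∈ sq Ω) :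
    (partialDerivFn v h).1 q = fderiv ℝ h.1 q (v, 0) :=
  Set.indicator_of_mem (s := (sq Ω : Set _)) hq fun q => fderiv ℝ h.1 q (v, 0)

/-- The partial derivative `∂_v h(x, y)`, as a linear map. -/
def partialDeriv (v : EuclideanSpace ℝ (Fin n)) : SmoothFn (sq Ω) →ₗ[ℂ] SmoothFn (sq Ω) where
  toFun := partialDerivFn v
  map_add' f g := SmoothFn.ext fun q hq => by
    have e : fderiv ℝ (f + g).1 q = fderiv ℝ f.1 q + fderiv ℝ g.1 q :=
      fderiv_add ((f.contDiffAt_top hq).differentiableAt (by simp))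
        ((g.contDiffAt_top hq).differentiableAt (by simp))
    change _ = (partialDerivFn v f).1 q + (partialDerivFn v g).1 q
    rw [partialDerivFn_apply v _ hq, partialDerivFn_apply v _ hq, partialDerivFn_apply v _ hq, e]
    rfl
  map_smul' c f := SmoothFn.ext fun q hq => by
    have e : fderiv ℝ (c • f).1 q = c • fderiv ℝ f.1 q :=
      fderiv_const_smul ((f.contDiffAt_top hq).differentiableAt (by simp)) c
    change _ = c * (partialDerivFn v f).1 q
    rw [partialDerivFn_apply v _ hq, partialDerivFn_apply v _ hq, e]
    rfl

theorem partialDeriv_apply (v : EuclideanSpace ℝ (Fin n)) (h : SmoothFn (sq Ω))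
    {q : EuclideanSpace ℝ (Fin n) × EuclideanSpace ℝ (Fin n)} (hq : q ∈ sq Ω) :
    (partialDeriv v h).1 q = fderiv ℝ h.1 q (v, 0) := partialDerivFn_apply v h hq

theorem iteratedFDeriv_partialDeriv (v : EuclideanSpace ℝ (Fin n)) (h : SmoothFn (sq Ω)) (j : ℕ)
    {q : EuclideanSpace ℝ (Fin n) × EuclideanSpace ℝ (Fin n)} (hq : q ∈ sq Ω) :
    iteratedFDeriv ℝ j (partialDeriv v h).1 q = fderiv ℝ (iteratedFDeriv ℝ j h.1) q (v, 0) := by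
  rw [← iteratedFDeriv_fderiv_apply isOpen_sq h.2.1 (v, 0) j hq]
  refine ((?_ : (partialDeriv v h).1 =ᶠ[𝓝 q] _).iteratedFDeriv ℝ j).eq_of_nhds
  filter_upwards [isOpen_sq.mem_nhds hq] with z hz using partialDeriv_apply v h hz

theorem iteratedFDeriv_slice (h : SmoothFn (sq Ω)) (j : ℕ) {x y : EuclideanSpace ℝ (Fin n)}
    (hx : x ∈ Ω) (hy : y ∈ Ω) :
    iteratedFDeriv ℝ j (slice x h).1 y = (iteratedFDeriv ℝ j h.1 (x, y)).compContinuousLinearMap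
      fun _ => ContinuousLinearMap.inr ℝ _ _ := by
  let E := EuclideanSpace ℝ (Fin n)
  let s : Set (E × E) := (fun q : E × E => (x, (0 : E)) + q) ⁻¹' (sq Ω : Set (E × E))
  have hopen : IsOpen s := isOpen_sq.preimage (by fun_prop)
  let g : E × E → ℂ := fun q => h.1 ((x, (0 : E)) + q)
  have hg : ContDiffOn ℝ ∞ g s := h.2.1.comp (by fun_prop) fun q hq => hq
  have hpre : (ContinuousLinearMap.inr ℝ E E) ⁻¹' s = Ω := by
    ext z
    simp [s, sq, hx]
  have hmem : ContinuousLinearMap.inr ℝ E E y ∈ s := by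
    have : y ∈ (ContinuousLinearMap.inr ℝ E E) ⁻¹' s := by rw [hpre]; exact hy
    exact this
  have key := (ContinuousLinearMap.inr ℝ E E).iteratedFDerivWithin_comp_right (i := j) hg
    hopen.uniqueDiffOn (by rw [hpre]; exact Ω.isOpen.uniqueDiffOn) hmem (by exact_mod_cast le_top)
  rw [hpre, iteratedFDerivWithin_of_isOpen j Ω.isOpen hy,
    iteratedFDerivWithin_of_isOpen j hopen hmem] at key
  have e1 : (g ∘ ContinuousLinearMap.inr ℝ E E) = (slice x h).1 := by
    funext z
    simp [g, slice]
  have e2 : iteratedFDeriv ℝ j g (ContinuousLinearMap.inr ℝ E E y) =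
      iteratedFDeriv ℝ j h.1 (x, y) := by
    have := iteratedFDeriv_comp_add_left (𝕜 := ℝ) (f := h.1) j (x, (0 : E))
      (ContinuousLinearMap.inr ℝ E E y)
    simpa [g] using this
  rw [e1, e2] at key
  exact key

theorem norm_compContinuousLinearMap_inr_le {j : ℕ}
    (A : ContinuousMultilinearMap ℝ
      (fun _ : Fin j => EuclideanSpace ℝ (Fin n) × EuclideanSpace ℝ (Fin n)) ℂ) :
    ‖A.compContinuousLinearMap fun _ => ContinuousLinearMap.inr ℝ (EuclideanSpace ℝ (Fin n))
      (EuclideanSpace ℝ (Fin n))‖ ≤ ‖A‖ := by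
  refine (ContinuousMultilinearMap.norm_compContinuousLinearMap_le _ _).trans ?_
  refine mul_le_of_le_one_right (norm_nonneg _) ?_
  exact Finset.prod_le_one (fun _ _ => norm_nonneg _)
    fun _ _ => ContinuousLinearMap.norm_inr_le_one ℝ _ _

/-- The compact set `{x} ⊆ Ω`. -/
def CompactIn.single (x : EuclideanSpace ℝ (Fin n)) (hx : x ∈ Ω) : CompactIn Ω :=
  ⟨{x}, isCompact_singleton, Set.singleton_subset_iff.2 hx⟩

theorem pValue_slice_le (h : SmoothFn (sq Ω)) {K : CompactIn Ω} (L : CompactIn Ω) (m : ℕ)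
    {x : EuclideanSpace ℝ (Fin n)} (hx : x ∈ K.1) :
    pValue L m (slice x h) ≤ pValue (K.prod L) m h := by
  refine pValue_le _ _ _ (pValue_nonneg _ _ _) fun y hy j hj => ?_
  rw [iteratedFDeriv_slice h j (K.2.2 hx) (L.2.2 hy)]
  exact (norm_compContinuousLinearMap_inr_le _).trans
    (le_pValue (K.prod L) hj h (x := (x, y)) ⟨hx, hy⟩)

theorem pValue_mono {V : Type*} [NormedAddCommGroup V] [NormedSpace ℝ V] {Ω : Opens V}
    {K L : CompactIn Ω} (hKL : K.1 ⊆ L.1) {i j : ℕ} (hij : i ≤ j) (f : SmoothFn Ω) :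
    pValue K i f ≤ pValue L j f :=
  pValue_le _ _ _ (pValue_nonneg _ _ _) fun _ hx _ hl => le_pValue L (hl.trans hij) f (hKL hx)

theorem norm_prod_zero (v : EuclideanSpace ℝ (Fin n)) :
    ‖((v, 0) : EuclideanSpace ℝ (Fin n) × EuclideanSpace ℝ (Fin n))‖ = ‖v‖ := by
  simp [Prod.norm_def]

theorem pValue_partialDeriv_le (v : EuclideanSpace ℝ (Fin n)) (h : SmoothFn (sq Ω))
    (K : CompactIn (sq Ω)) (m : ℕ) :
    pValue K m (partialDeriv v h) ≤ ‖v‖ * pValue K (m + 1) h := by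
  refine pValue_le _ _ _ (mul_nonneg (norm_nonneg _) (pValue_nonneg _ _ _)) fun q hq j hj => ?_
  rw [iteratedFDeriv_partialDeriv v h j (K.2.2 hq), mul_comm, ← norm_prod_zero v]
  refine (ContinuousLinearMap.le_opNorm _ _).trans ?_
  refine mul_le_mul_of_nonneg_right ?_ (norm_nonneg _)
  rw [norm_fderiv_iteratedFDeriv]
  exact le_pValue K (Nat.add_le_add_right hj 1) h hq

/-- First order Taylor expansion in the first variable, uniformly on compact sets and with all
derivatives in the second variable. -/
theorem exists_pValue_taylor_le (h : SmoothFn (sq Ω)) (L : CompactIn Ω) (m : ℕ)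
    {x : EuclideanSpace ℝ (Fin n)} (hx : x ∈ Ω) :
    ∃ C r : ℝ, 0 ≤ C ∧ 0 < r ∧ ∀ v, ‖v‖ < r →
      pValue L m (slice (x + v) h - slice x h - slice x (partialDeriv v h)) ≤ C * ‖v‖ ^ 2 := by
  obtain ⟨r, hr, hrΩ⟩ := Metric.nhds_basis_closedBall.mem_iff.1 (Ω.isOpen.mem_nhds hx)
  let K : CompactIn Ω := ⟨Metric.closedBall x r, isCompact_closedBall x r, hrΩ⟩
  refine ⟨pValue (K.prod L) (m + 2) h, r, pValue_nonneg _ _ _, hr, fun v hv => ?_⟩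
  refine pValue_le _ _ _ (mul_nonneg (pValue_nonneg _ _ _) (by positivity)) fun y hy j hj => ?_
  have hmemK : ∀ z ∈ Metric.closedBall x ‖v‖, z ∈ K.1 := fun z hz =>
    Metric.closedBall_subset_closedBall hv.le hz
  have hxv : x + v ∈ Metric.closedBall x ‖v‖ := by simp
  have hx0 : x ∈ Metric.closedBall x ‖v‖ := by simp
  have hyΩ : y ∈ Ω := L.2.2 hy
  have e : iteratedFDeriv ℝ j (slice (x + v) h - slice x h - slice x (partialDeriv v h)).1 y =
      (iteratedFDeriv ℝ j h.1 (x + v, y) - iteratedFDeriv ℝ j h.1 (x, y) -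
        fderiv ℝ (iteratedFDeriv ℝ j h.1) (x, y) (v, 0)).compContinuousLinearMap
          fun _ => ContinuousLinearMap.inr ℝ _ _ := by
    have e1 : iteratedFDeriv ℝ j ((slice (x + v) h).1 - (slice x h).1 -
        (slice x (partialDeriv v h)).1) y = iteratedFDeriv ℝ j (slice (x + v) h).1 y -
          iteratedFDeriv ℝ j (slice x h).1 y -
          iteratedFDeriv ℝ j (slice x (partialDeriv v h)).1 y := by
      rw [iteratedFDeriv_sub_apply, iteratedFDeriv_sub_apply]
      · exact SmoothFn.contDiffAt _ hyΩ _
      · exact SmoothFn.contDiffAt _ hyΩ _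
      · exact (SmoothFn.contDiffAt _ hyΩ _).sub (SmoothFn.contDiffAt _ hyΩ _)
      · exact SmoothFn.contDiffAt _ hyΩ _
    refine e1.trans ?_
    rw [iteratedFDeriv_slice h j (K.2.2 (hmemK _ hxv)) hyΩ, iteratedFDeriv_slice h j hx hyΩ,
      iteratedFDeriv_slice _ j hx hyΩ, iteratedFDeriv_partialDeriv v h j ⟨hx, hyΩ⟩]
    ext w
    simp
  rw [e]
  refine (norm_compContinuousLinearMap_inr_le _).trans ?_
  set C := pValue (K.prod L) (m + 2) h with hC
  have hCD : ∀ z ∈ Metric.closedBall x ‖v‖, ∀ i ≤ m + 2, ‖iteratedFDeriv ℝ i h.1 (z, y)‖ ≤ C :=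
    fun z hz i hi => le_pValue (K.prod L) hi h (x := (z, y)) ⟨hmemK z hz, hy⟩
  have hdiff : ∀ (i : ℕ), ∀ z ∈ Metric.closedBall x ‖v‖,
      HasFDerivAt (iteratedFDeriv ℝ i h.1) (fderiv ℝ (iteratedFDeriv ℝ i h.1) (z, y)) (z, y) := by
    intro i z hz
    have hq : (z, y) ∈ sq Ω := ⟨K.2.2 (hmemK z hz), hyΩ⟩
    exact (ContDiffAt.differentiableAt (n := ∞) ((h.contDiffAt_top hq).iteratedFDeriv_right
      (by exact_mod_cast le_top)) (by simp)).hasFDerivAt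
  have hseg : ∀ (i : ℕ), ∀ z ∈ Metric.closedBall x ‖v‖,
      HasFDerivWithinAt (fun z => iteratedFDeriv ℝ i h.1 (z, y))
        ((fderiv ℝ (iteratedFDeriv ℝ i h.1) (z, y)).comp (ContinuousLinearMap.inl ℝ _ _))
        (Metric.closedBall x ‖v‖) z := fun i z hz =>
    ((hdiff i z hz).comp z (hasFDerivAt_prodMk_left z y)).hasFDerivWithinAt
  have hle1 : ∀ {F : Type} [NormedAddCommGroup F] [NormedSpace ℝ F]
      (A : EuclideanSpace ℝ (Fin n) × EuclideanSpace ℝ (Fin n) →L[ℝ] F),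
      ‖A.comp (ContinuousLinearMap.inl ℝ _ _)‖ ≤ ‖A‖ := by
    intro F _ _ A
    refine (ContinuousLinearMap.opNorm_comp_le _ _).trans ?_
    exact mul_le_of_le_one_right (norm_nonneg _) (ContinuousLinearMap.norm_inl_le_one ℝ _ _)
  -- the derivative of order `j + 1` is Lipschitz with constant `C` along the ball
  have hLip : ∀ z ∈ Metric.closedBall x ‖v‖,
      ‖iteratedFDeriv ℝ (j + 1) h.1 (z, y) - iteratedFDeriv ℝ (j + 1) h.1 (x, y)‖ ≤ C * ‖v‖ := by
    intro z hz
    refine ((convex_closedBall x ‖v‖).norm_image_sub_le_of_norm_hasFDerivWithin_le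
      (C := C) (hseg (j + 1)) (fun w hw => (hle1 _).trans ?_) hx0 hz).trans ?_
    · rw [norm_fderiv_iteratedFDeriv]
      exact hCD w hw _ (by omega)
    · refine mul_le_mul_of_nonneg_left ?_ (pValue_nonneg _ _ _)
      simpa [dist_eq_norm] using hz
  have hfin := (convex_closedBall x ‖v‖).norm_image_sub_le_of_norm_hasFDerivWithin_le'
    (hseg j) (φ := (fderiv ℝ (iteratedFDeriv ℝ j h.1) (x, y)).comp (ContinuousLinearMap.inl ℝ _ _))
    (C := C * ‖v‖) (fun z hz => ?_) hx0 hxv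
  · rw [pow_two, ← mul_assoc]
    simpa using hfin
  · rw [← ContinuousLinearMap.sub_comp]
    refine (hle1 _).trans ((le_of_eq ?_).trans (hLip z hz))
    exact (continuousMultilinearCurryLeftEquiv ℝ (fun _ : Fin (j + 1) =>
      EuclideanSpace ℝ (Fin n) × EuclideanSpace ℝ (Fin n)) ℂ).norm_map
        (iteratedFDeriv ℝ (j + 1) h.1 (z, y) - iteratedFDeriv ℝ (j + 1) h.1 (x, y))

end Slices

section Slices

variable {n : ℕ} {Ω : Opens (EuclideanSpace ℝ (Fin n))}

/-! ### Applying a distribution to the slices of a kernel -/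

theorem IsCompactDistribution.exists_bound {V : Type*} [NormedAddCommGroup V] [NormedSpace ℝ V]
    {Ω : Opens V} {t : SmoothFn Ω →ₗ[ℂ] ℂ} (ht : IsCompactDistribution t) :
    ∃ (L : CompactIn Ω) (m : ℕ) (C : ℝ), 0 ≤ C ∧ ∀ f, ‖t f‖ ≤ C * pValue L m f := by
  obtain ⟨⟨L, m⟩, C, h⟩ := ht
  exact ⟨L, m, |C|, abs_nonneg C, fun f => (h f).trans
    (mul_le_mul_of_nonneg_right (le_abs_self C) (pValue_nonneg _ _ _))⟩

theorem partialDeriv_add (v w : EuclideanSpace ℝ (Fin n)) (h : SmoothFn (sq Ω)) :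
    partialDeriv (v + w) h = partialDeriv v h + partialDeriv w h :=
  SmoothFn.ext fun q hq => by
    change _ = (partialDeriv v h).1 q + (partialDeriv w h).1 q
    rw [partialDeriv_apply _ _ hq, partialDeriv_apply _ _ hq, partialDeriv_apply _ _ hq, ← map_add]
    simp

theorem partialDeriv_smul (c : ℝ) (v : EuclideanSpace ℝ (Fin n)) (h : SmoothFn (sq Ω)) :
    partialDeriv (c • v) h = (c : ℂ) • partialDeriv v h :=
  SmoothFn.ext fun q hq => by
    change _ = (c : ℂ) * (partialDeriv v h).1 q
    rw [partialDeriv_apply _ _ hq, partialDeriv_apply _ _ hq, ← Complex.real_smul, ← map_smul]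
    simp

/-- The derivative `v ↦ t(∂_v h(x, ·))` of `x ↦ t(h(x, ·))`. -/
def sliceDeriv (t : SmoothFn Ω →ₗ[ℂ] ℂ) (h : SmoothFn (sq Ω)) (x : EuclideanSpace ℝ (Fin n)) :
    EuclideanSpace ℝ (Fin n) →L[ℝ] ℂ :=
  LinearMap.toContinuousLinearMap
    { toFun := fun v => t (slice x (partialDeriv v h))
      map_add' := fun v w => by rw [partialDeriv_add, map_add, map_add]
      map_smul' := fun c v => by
        rw [partialDeriv_smul, map_smul, map_smul, RingHom.id_apply, Complex.real_smul,
          smul_eq_mul] }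

theorem sliceDeriv_apply (t : SmoothFn Ω →ₗ[ℂ] ℂ) (h : SmoothFn (sq Ω))
    (x v : EuclideanSpace ℝ (Fin n)) :
    sliceDeriv t h x v = t (slice x (partialDeriv v h)) := rfl

theorem hasFDerivAt_slice {t : SmoothFn Ω →ₗ[ℂ] ℂ} (ht : IsCompactDistribution t)
    (h : SmoothFn (sq Ω)) {x : EuclideanSpace ℝ (Fin n)} (hx : x ∈ Ω) :
    HasFDerivAt (fun x => t (slice x h)) (sliceDeriv t h x) x := by
  obtain ⟨L, m, D, hD, htD⟩ := ht.exists_bound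
  obtain ⟨C, r, hC, hr, hle⟩ := exists_pValue_taylor_le h L m hx
  rw [hasFDerivAt_iff_isLittleO_nhds_zero]
  refine IsBigO.trans_isLittleO (g := fun v : EuclideanSpace ℝ (Fin n) => ‖v‖ ^ 2) ?_ ?_
  · refine IsBigO.of_bound (D * C) ?_
    filter_upwards [Metric.ball_mem_nhds (0 : EuclideanSpace ℝ (Fin n)) hr] with v hv
    rw [sliceDeriv_apply, ← map_sub, ← map_sub]
    refine (htD _).trans ?_
    rw [mul_assoc, Real.norm_of_nonneg (by positivity)]
    exact mul_le_mul_of_nonneg_left (hle v (by simpa using hv)) hD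
  · exact isLittleO_norm_pow_id one_lt_two

theorem contDiffOn_slice {t : SmoothFn Ω →ₗ[ℂ] ℂ} (ht : IsCompactDistribution t) (m : ℕ)
    (h : SmoothFn (sq Ω)) : ContDiffOn ℝ m (fun x => t (slice x h)) Ω := by
  induction m generalizing h with
  | zero =>
    exact contDiffOn_zero.2 fun x hx => (hasFDerivAt_slice ht h hx).continuousAt.continuousWithinAt
  | succ m ih =>
    rw [Nat.cast_add, Nat.cast_one, contDiffOn_succ_iff_fderiv_of_isOpen Ω.isOpen]
    refine ⟨fun x hx => (hasFDerivAt_slice ht h hx).differentiableAt.differentiableWithinAt,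
      by simp, contDiffOn_clm_apply.2 fun v => (ih (partialDeriv v h)).congr fun x hx => ?_⟩
    rw [(hasFDerivAt_slice ht h hx).fderiv, sliceDeriv_apply]

/-- The smooth function `x ↦ t(h(x, ·))`, for `t ∈ ℰ'(Ω)` and a smooth kernel `h`. -/
def applySlices (t : SmoothFn Ω →ₗ[ℂ] ℂ) (ht : IsCompactDistribution t) (h : SmoothFn (sq Ω)) :
    SmoothFn Ω :=
  ⟨fun x => t (slice x h), contDiffOn_infty.2 fun m => contDiffOn_slice ht m h,
    fun x hx => by
      change t (slice x h) = 0
      rw [slice_eq_zero hx, map_zero]⟩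

/-- The iterated partial derivative `∂_{v₁} ⋯ ∂_{vⱼ} h(x, y)` in directions of the first
variable. -/
def iterPartial : (j : ℕ) → (Fin j → EuclideanSpace ℝ (Fin n)) →
    SmoothFn (sq Ω) →ₗ[ℂ] SmoothFn (sq Ω)
  | 0, _ => LinearMap.id
  | j + 1, v => (partialDeriv (v 0)).comp (iterPartial j (Fin.tail v))

theorem iteratedFDeriv_applySlices {t : SmoothFn Ω →ₗ[ℂ] ℂ} (ht : IsCompactDistribution t)
    (h : SmoothFn (sq Ω)) (j : ℕ) (v : Fin j → EuclideanSpace ℝ (Fin n))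
    {x : EuclideanSpace ℝ (Fin n)} (hx : x ∈ Ω) :
    iteratedFDeriv ℝ j (applySlices t ht h).1 x v = t (slice x (iterPartial j v h)) := by
  induction j generalizing x with
  | zero => rfl
  | succ j ih =>
    have hd : DifferentiableAt ℝ (iteratedFDeriv ℝ j (applySlices t ht h).1) x :=
      ContDiffAt.differentiableAt (n := ∞)
        (((applySlices t ht h).contDiffAt_top hx).iteratedFDeriv_right
          (by exact_mod_cast le_top)) (by simp)
    rw [hd.iteratedFDeriv_succ_apply_left']
    have e : (fun y => iteratedFDeriv ℝ j (applySlices t ht h).1 y (Fin.tail v)) =ᶠ[𝓝 x]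
        fun y => t (slice y (iterPartial j (Fin.tail v) h)) := by
      filter_upwards [Ω.isOpen.mem_nhds hx] with y hy using ih (Fin.tail v) hy
    rw [e.fderiv_eq, (hasFDerivAt_slice ht _ hx).fderiv]
    rfl

theorem pValue_iterPartial_le (K : CompactIn (sq Ω)) (m j : ℕ)
    (v : Fin j → EuclideanSpace ℝ (Fin n)) (hv : ∀ l, ‖v l‖ ≤ 1) (h : SmoothFn (sq Ω)) :
    pValue K m (iterPartial j v h) ≤ pValue K (m + j) h := by
  induction j generalizing m with
  | zero => exact le_rfl
  | succ j ih =>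
    calc pValue K m (partialDeriv (v 0) (iterPartial j (Fin.tail v) h))
        ≤ ‖v 0‖ * pValue K (m + 1) (iterPartial j (Fin.tail v) h) := pValue_partialDeriv_le _ _ _ _
      _ ≤ pValue K (m + 1) (iterPartial j (Fin.tail v) h) :=
          mul_le_of_le_one_left (pValue_nonneg _ _ _) (hv 0)
      _ ≤ pValue K (m + 1 + j) h := ih (m + 1) (Fin.tail v) fun l => hv l.succ
      _ = pValue K (m + (j + 1)) h := by rw [add_assoc, add_comm 1 j]

theorem pValue_slice_iterPartial_le {K : CompactIn Ω} (L : CompactIn Ω) (m j : ℕ)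
    (v : Fin j → EuclideanSpace ℝ (Fin n)) (hv : ∀ l, ‖v l‖ ≤ 1) (h : SmoothFn (sq Ω))
    {x : EuclideanSpace ℝ (Fin n)} (hx : x ∈ K.1) :
    pValue L m (slice x (iterPartial j v h)) ≤ pValue (K.prod L) (m + j) h :=
  (pValue_slice_le _ L m hx).trans (pValue_iterPartial_le _ _ _ _ hv _)

/-- The functions `∂_{v₁} ⋯ ∂_{vⱼ} h(x, ·)` with `x ∈ K`, `j ≤ i` and `‖v_l‖ ≤ 1`, together with
zero: the values of `t` on them control the seminorm `p_{K,i}` of `x ↦ t(h(x, ·))`. -/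
def derivSlices (K : CompactIn Ω) (i : ℕ) (h : SmoothFn (sq Ω)) : Set (SmoothFn Ω) :=
  {w | w = 0 ∨ ∃ x ∈ K.1, ∃ j ≤ i, ∃ v : Fin j → EuclideanSpace ℝ (Fin n),
    (∀ l, ‖v l‖ ≤ 1) ∧ w = slice x (iterPartial j v h)}

theorem pValue_le_of_mem_derivSlices {K : CompactIn Ω} {i : ℕ} {h : SmoothFn (sq Ω)}
    {w : SmoothFn Ω} (hw : w ∈ derivSlices K i h) (L : CompactIn Ω) (m : ℕ) :
    pValue L m w ≤ pValue (K.prod L) (m + i) h := by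
  rcases hw with rfl | ⟨x, hx, j, hj, v, hv, rfl⟩
  · exact (pValue_le _ _ _ le_rfl fun y _ l _ => by
      change ‖iteratedFDeriv ℝ l (fun _ => (0 : ℂ)) y‖ ≤ 0
      simp).trans (pValue_nonneg _ _ _)
  · exact (pValue_slice_iterPartial_le L m j v hv h hx).trans
      (pValue_mono le_rfl (Nat.add_le_add_left hj m) h)

theorem ContinuousMultilinearMap.opNorm_le_of_unit_bound {V : Type*} [NormedAddCommGroup V]
    [NormedSpace ℝ V] {j : ℕ} (A : ContinuousMultilinearMap ℝ (fun _ : Fin j => V) ℂ) {C : ℝ}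
    (hC : 0 ≤ C) (h : ∀ v : Fin j → V, (∀ l, ‖v l‖ ≤ 1) → ‖A v‖ ≤ C) : ‖A‖ ≤ C := by
  refine A.opNorm_le_bound hC fun v => ?_
  have e : v = fun l => ‖v l‖ • (‖v l‖⁻¹ • v l) := by
    funext l
    rcases eq_or_ne (v l) 0 with h0 | h0
    · simp [h0]
    · rw [smul_smul, mul_inv_cancel₀ (norm_ne_zero_iff.2 h0), one_smul]
  have e' : A v = (∏ l, ‖v l‖) • A fun l => ‖v l‖⁻¹ • v l := by
    conv_lhs => rw [e]
    exact A.map_smul_univ _ _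
  rw [e', norm_smul, Real.norm_of_nonneg (Finset.prod_nonneg fun _ _ => norm_nonneg _), mul_comm]
  refine mul_le_mul_of_nonneg_right (h _ fun l => ?_) (Finset.prod_nonneg fun _ _ => norm_nonneg _)
  rw [norm_smul, norm_inv, norm_norm]
  exact inv_mul_le_one

/-- The seminorm `p_{K,i}` of `x ↦ t(h(x, ·))` is attained, up to a factor `2`, as a value of `t`
on one of the functions `derivSlices K i h`. -/
theorem exists_derivSlice (K : CompactIn Ω) (i : ℕ) {t : SmoothFn Ω →ₗ[ℂ] ℂ}
    (ht : IsCompactDistribution t) (h : SmoothFn (sq Ω)) :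
    ∃ w ∈ derivSlices K i h, pValue K i (applySlices t ht h) ≤ 2 * ‖t w‖ := by
  by_contra! hcon
  have hpos : 0 < pValue K i (applySlices t ht h) := by
    simpa using hcon 0 (Or.inl rfl)
  have hle : pValue K i (applySlices t ht h) ≤ pValue K i (applySlices t ht h) / 2 := by
    refine pValue_le _ _ _ (by positivity) fun x hx j hj => ?_
    refine ContinuousMultilinearMap.opNorm_le_of_unit_bound _ (by positivity) fun v hv => ?_
    rw [iteratedFDeriv_applySlices ht h j v (K.2.2 hx)]
    have := hcon _ (Or.inr ⟨x, hx, j, hj, v, hv, rfl⟩)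
    linarith
  linarith

end Slices

section Slices

variable {n : ℕ} {Ω : Opens (EuclideanSpace ℝ (Fin n))}

/-! ### Interchanging a distribution with an integral -/

/-- The kernel `φ(x) g(y)`. -/
def tensor (φ g : SmoothFn Ω) : SmoothFn (sq Ω) :=
  ⟨fun q => φ.1 q.1 * g.1 q.2,
    (φ.2.1.comp contDiffOn_fst fun _ hq => hq.1).mul (g.2.1.comp contDiffOn_snd fun _ hq => hq.2),
    fun q hq => by
      beta_reduce
      by_cases h : q.1 ∈ Ω
      · rw [g.2.2 q.2 fun h' => hq ⟨h, h'⟩, mul_zero]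
      · rw [φ.2.2 q.1 h, zero_mul]⟩

theorem slice_tensor (φ g : SmoothFn Ω) (x : EuclideanSpace ℝ (Fin n)) :
    slice x (tensor φ g) = φ.1 x • g := rfl

theorem pValue_add_le {V : Type*} [NormedAddCommGroup V] [NormedSpace ℝ V] {Ω : Opens V}
    (K : CompactIn Ω) (i : ℕ) (f g : SmoothFn Ω) :
    pValue K i (f + g) ≤ pValue K i f + pValue K i g := map_add_le_add (pSeminorm Ω (K, i)) f g

theorem pValue_sum_le {V : Type*} [NormedAddCommGroup V] [NormedSpace ℝ V] {Ω : Opens V}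
    (K : CompactIn Ω) (i : ℕ) {J : Type*} (s : Finset J) (f : J → SmoothFn Ω) :
    pValue K i (∑ j ∈ s, f j) ≤ ∑ j ∈ s, pValue K i (f j) := by
  classical
  induction s using Finset.induction_on with
  | empty => exact (map_zero (pSeminorm Ω (K, i))).le
  | insert a s ha ih =>
    rw [Finset.sum_insert ha, Finset.sum_insert ha]
    exact (pValue_add_le _ _ _ _).trans (add_le_add_right ih _)

theorem pValue_smul {V : Type*} [NormedAddCommGroup V] [NormedSpace ℝ V] {Ω : Opens V}
    (K : CompactIn Ω) (i : ℕ) (c : ℂ) (f : SmoothFn Ω) :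
    pValue K i (c • f) = ‖c‖ * pValue K i f := map_smul_eq_mul (pSeminorm Ω (K, i)) c f

theorem pValue_zero {V : Type*} [NormedAddCommGroup V] [NormedSpace ℝ V] {Ω : Opens V}
    (K : CompactIn Ω) (i : ℕ) : pValue K i (0 : SmoothFn Ω) = 0 := map_zero (pSeminorm Ω (K, i))

theorem eventually_pValue_slice_sub_lt (h : SmoothFn (sq Ω)) (L : CompactIn Ω) (m : ℕ)
    {x : EuclideanSpace ℝ (Fin n)} (hx : x ∈ Ω) {c : ℝ} (hc : 0 < c) :
    ∀ᶠ x' in 𝓝 x, pValue L m (slice x' h - slice x h) < c := by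
  obtain ⟨C, r, hC, hr, hle⟩ := exists_pValue_taylor_le h L m hx
  set D := pValue ((CompactIn.single x hx).prod L) (m + 1) h with hD
  have hlim : Tendsto (fun v : EuclideanSpace ℝ (Fin n) => C * ‖v‖ ^ 2 + ‖v‖ * D) (𝓝 0) (𝓝 0) := by
    have : Continuous fun v : EuclideanSpace ℝ (Fin n) => C * ‖v‖ ^ 2 + ‖v‖ * D := by fun_prop
    simpa using this.tendsto 0
  have h1 : ∀ᶠ v in 𝓝 (0 : EuclideanSpace ℝ (Fin n)),
      pValue L m (slice (x + v) h - slice x h) < c := by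
    filter_upwards [hlim.eventually_lt_const hc, Metric.ball_mem_nhds _ hr] with v hv hvr
    refine lt_of_le_of_lt ?_ hv
    have e : slice (x + v) h - slice x h =
        (slice (x + v) h - slice x h - slice x (partialDeriv v h)) +
          slice x (partialDeriv v h) := by
      abel
    rw [e]
    refine (pValue_add_le _ _ _ _).trans (add_le_add (hle v (by simpa using hvr)) ?_)
    exact (pValue_slice_le (K := CompactIn.single x hx) _ L m (Set.mem_singleton x)).trans
      (pValue_partialDeriv_le _ _ _ _)
  have hsub : Tendsto (fun x' => x' - x) (𝓝 x) (𝓝 0) := by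
    have : Continuous fun x' : EuclideanSpace ℝ (Fin n) => x' - x := by fun_prop
    simpa using this.tendsto x
  filter_upwards [hsub.eventually h1] with x' hx'
  simpa using hx'

/-- Uniformly for `x` in a compact set, the slices of a kernel are approximated by those of finite
sums of kernels `φ(x) g(y)`. -/
theorem exists_tensor_approx (h : SmoothFn (sq Ω)) (K L : CompactIn Ω) (m : ℕ) {c : ℝ}
    (hc : 0 < c) :
    ∃ (s : Finset (EuclideanSpace ℝ (Fin n))) (φ : s → SmoothFn Ω),
      ∀ x ∈ K.1, pValue L m (slice x (h - ∑ a, tensor (φ a) (slice a.1 h))) ≤ c := by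
  have hU : ∀ x ∈ K.1, ∃ U : Set (EuclideanSpace ℝ (Fin n)), IsOpen U ∧ x ∈ U ∧
      ∀ x' ∈ U, pValue L m (slice x' h - slice x h) < c := by
    intro x hx
    obtain ⟨U, h1, h2, h3⟩ := mem_nhds_iff.1 (eventually_pValue_slice_sub_lt h L m (K.2.2 hx) hc)
    exact ⟨U, h2, h3, h1⟩
  choose! U hUo hxU hUc using hU
  obtain ⟨s, hsK, hs⟩ := K.2.1.elim_nhds_subcover U fun x hx => (hUo x hx).mem_nhds (hxU x hx)
  obtain ⟨f, hf⟩ := SmoothPartitionOfUnity.exists_isSubordinate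
    (modelWithCornersSelf ℝ (EuclideanSpace ℝ (Fin n)))
    K.2.1.isClosed (fun a : s => U a.1) (fun a => hUo a.1 (hsK a.1 a.2)) (by
      intro x hx
      obtain ⟨a, ha, hxa⟩ := Set.mem_iUnion₂.1 (hs hx)
      exact Set.mem_iUnion.2 ⟨⟨a, ha⟩, hxa⟩)
  have hsm : ∀ a, ContDiff ℝ ∞ (f a) := fun a => (f a).contMDiff.contDiff
  refine ⟨s, fun a => ⟨Set.indicator (Ω : Set _) fun x => ((f a x : ℝ) : ℂ),
    (Complex.ofRealCLM.contDiff.comp (hsm a)).contDiffOn.congr fun x hx =>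
      Set.indicator_of_mem hx _, fun x hx => Set.indicator_of_notMem hx _⟩, fun x hx => ?_⟩
  have hsum : ∑ a, f a x = 1 := by
    rw [← f.sum_eq_one hx, finsum_eq_sum_of_fintype]
  have e : slice x (h - ∑ a, tensor (⟨Set.indicator (Ω : Set _) fun x => ((f a x : ℝ) : ℂ),
      (Complex.ofRealCLM.contDiff.comp (hsm a)).contDiffOn.congr fun x hx =>
        Set.indicator_of_mem hx _, fun x hx => Set.indicator_of_notMem hx _⟩ : SmoothFn Ω)
        (slice a.1 h)) =
      ∑ a, ((f a x : ℝ) : ℂ) • (slice x h - slice a.1 h) := by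
    simp only [map_sub, map_sum, slice_tensor, Set.indicator_of_mem (K.2.2 hx), smul_sub,
      Finset.sum_sub_distrib, ← Finset.sum_smul]
    rw [← Complex.ofReal_sum, hsum, Complex.ofReal_one, one_smul]
  rw [e]
  calc _ ≤ ∑ a, pValue L m (((f a x : ℝ) : ℂ) • (slice x h - slice a.1 h)) := pValue_sum_le _ _ _ _
    _ ≤ ∑ a, f a x * c := Finset.sum_le_sum fun a _ => by
        rw [pValue_smul, Complex.norm_real, Real.norm_of_nonneg (f.nonneg a x)]
        by_cases h0 : f a x = 0
        · simp [h0]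
        · exact mul_le_mul_of_nonneg_left (hUc a.1 (hsK a.1 a.2) x
            (hf a (subset_tsupport _ h0))).le (f.nonneg a x)
    _ = c := by rw [← Finset.sum_mul, hsum, one_mul]

theorem pValue_intFn_le (K L : CompactIn Ω) (i : ℕ) (k : SmoothFn (sq Ω)) (u : SmoothFn Ω) {C : ℝ}
    (hC : 0 ≤ C) (h : ∀ x ∈ K.1, pValue L i (slice x k) ≤ C) :
    pValue L i (intFn K k u) ≤ C * pValue K 0 u * volume.real K.1 := by
  refine pValue_le _ _ _ (mul_nonneg (mul_nonneg hC (pValue_nonneg _ _ _)) measureReal_nonneg)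
    fun y hy j hj => ?_
  refine norm_param_le j (contDiffOn_mul_left k u) K (L.2.2 hy) fun x hx => ?_
  have e : (fun z => k.1 (x, z) * u.1 x) = (u.1 x) • (slice x k).1 := by
    funext z
    simp [slice_apply, mul_comm]
  change ‖iteratedFDeriv ℝ j (fun z => k.1 (x, z) * u.1 x) y‖ ≤ _
  rw [e, iteratedFDeriv_const_smul_apply ((slice x k).contDiffAt (L.2.2 hy) j), norm_smul, mul_comm]
  exact mul_le_mul ((le_pValue L hj _ hy).trans (h x hx)) (norm_apply_le_pValue K 0 u hx)
    (norm_nonneg _) hC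

theorem intFn_tensor (K : CompactIn Ω) (φ g u : SmoothFn Ω) :
    intFn K (tensor φ g) u = (∫ x in K.1, φ.1 x * u.1 x) • g := by
  refine Subtype.ext (funext fun y => ?_)
  change ∫ x in K.1, φ.1 x * g.1 y * u.1 x = (∫ x in K.1, φ.1 x * u.1 x) * g.1 y
  rw [← integral_mul_const]
  exact integral_congr_ae (Eventually.of_forall fun x => by simp only; ring)

/-- A compactly supported distribution commutes with the integral over a parameter. -/
theorem apply_intFn {t : SmoothFn Ω →ₗ[ℂ] ℂ} (ht : IsCompactDistribution t) (K : CompactIn Ω)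
    (k : SmoothFn (sq Ω)) (u : SmoothFn Ω) :
    t (intFn K k u) = ∫ x in K.1, (applySlices t ht k).1 x * u.1 x := by
  obtain ⟨L, m, D, hD, htD⟩ := ht.exists_bound
  let err : SmoothFn (sq Ω) →ₗ[ℂ] ℂ :=
    { toFun := fun k => t (intBilin K k u) - intForm K (applySlices t ht k) u
      map_add' := fun k k' => by
        have e : applySlices t ht (k + k') = applySlices t ht k + applySlices t ht k' :=
          Subtype.ext <| funext fun x => by
            change t (slice x (k + k')) = t (slice x k) + t (slice x k')
            rw [map_add, map_add]
        simp only [e, map_add, LinearMap.add_apply]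
        ring
      map_smul' := fun c k => by
        have e : applySlices t ht (c • k) = c • applySlices t ht k :=
          Subtype.ext <| funext fun x => by
            change t (slice x (c • k)) = c • t (slice x k)
            rw [map_smul, map_smul]
        simp only [e, map_smul, LinearMap.smul_apply, RingHom.id_apply, smul_sub] }
  have herr : ∀ k, err k = t (intFn K k u) - ∫ x in K.1, (applySlices t ht k).1 x * u.1 x :=
    fun _ => rfl
  have hten : ∀ φ g, err (tensor φ g) = 0 := by
    intro φ g
    rw [herr, intFn_tensor, map_smul, smul_eq_mul, ← integral_mul_const, sub_eq_zero]
    refine integral_congr_ae (Eventually.of_forall fun x => ?_)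
    change φ.1 x * u.1 x * t g = t (slice x (tensor φ g)) * u.1 x
    rw [slice_tensor, map_smul, smul_eq_mul]
    ring
  set A : ℝ := 2 * D * pValue K 0 u * volume.real K.1 with hA
  have hAnn : 0 ≤ A := by have := pValue_nonneg K 0 u; positivity
  have hbound : ∀ (k : SmoothFn (sq Ω)) {c : ℝ}, 0 ≤ c →
      (∀ x ∈ K.1, pValue L m (slice x k) ≤ c) → ‖err k‖ ≤ A * c := by
    intro k c hc hk
    have h1 : ‖t (intFn K k u)‖ ≤ D * (c * pValue K 0 u * volume.real K.1) :=
      (htD _).trans (mul_le_mul_of_nonneg_left (pValue_intFn_le K L m k u hc hk) hD)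
    have h2 : ‖∫ x in K.1, (applySlices t ht k).1 x * u.1 x‖ ≤
        (D * c * pValue K 0 u) * volume.real K.1 := by
      refine norm_setIntegral_le_of_norm_le_const K.2.1.measure_lt_top fun x hx => ?_
      rw [norm_mul]
      refine mul_le_mul ?_ (norm_apply_le_pValue K 0 u hx) (norm_nonneg _) (by positivity)
      exact (htD _).trans (mul_le_mul_of_nonneg_left (hk x hx) hD)
    rw [herr]
    refine (norm_sub_le _ _).trans ((add_le_add h1 h2).trans (le_of_eq ?_))
    rw [hA]
    ring
  have hzero : ‖err k‖ ≤ 0 := by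
    refine le_of_forall_pos_le_add fun δ hδ => ?_
    obtain ⟨s, φ, hφ⟩ := exists_tensor_approx k K L m (c := δ / (A + 1)) (by positivity)
    have e : err k = err (k - ∑ a, tensor (φ a) (slice a.1 k)) := by
      rw [map_sub, map_sum, Finset.sum_eq_zero fun a _ => hten _ _, sub_zero]
    rw [e, zero_add]
    refine (hbound _ (by positivity) hφ).trans ?_
    rw [mul_div_assoc', div_le_iff₀ (by positivity)]
    nlinarith
  have := norm_le_zero_iff.1 hzero
  rw [herr] at this
  exact sub_eq_zero.1 this

end Slices

/-! ### Cutoff functions -/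

section Cutoff

variable {V : Type*} [NormedAddCommGroup V] [NormedSpace ℝ V] {Ω : Opens V}

/-- Multiplication by a fixed smooth function. -/
def mulBy (χ : SmoothFn Ω) : SmoothFn Ω →ₗ[ℂ] SmoothFn Ω where
  toFun f := ⟨fun x => χ.1 x * f.1 x, χ.2.1.mul f.2.1, fun x hx => by
    beta_reduce
    rw [χ.2.2 x hx, zero_mul]⟩
  map_add' _ _ := Subtype.ext <| funext fun _ => mul_add _ _ _
  map_smul' _ _ := Subtype.ext <| funext fun _ => mul_left_comm _ _ _

theorem mulBy_apply (χ f : SmoothFn Ω) (x : V) : (mulBy χ f).1 x = χ.1 x * f.1 x := rfl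

theorem pValue_mulBy_le (χ f : SmoothFn Ω) (K : CompactIn Ω) (i : ℕ) :
    pValue K i (mulBy χ f) ≤ 2 ^ i * pValue K i χ * pValue K i f := by
  have hχ := pValue_nonneg K i χ
  have hf := pValue_nonneg K i f
  refine pValue_le _ _ _ (by positivity) fun x hx j hj => ?_
  have hxΩ := K.2.2 hx
  have key := norm_iteratedFDerivWithin_mul_le (n := j) χ.2.1 f.2.1 Ω.isOpen.uniqueDiffOn hxΩ
    (by exact_mod_cast le_top)
  rw [iteratedFDerivWithin_of_isOpen j Ω.isOpen hxΩ] at key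
  refine key.trans ?_
  calc ∑ l ∈ Finset.range (j + 1), (j.choose l : ℝ) * ‖iteratedFDerivWithin ℝ l χ.1 Ω x‖ *
        ‖iteratedFDerivWithin ℝ (j - l) f.1 Ω x‖
      ≤ ∑ l ∈ Finset.range (j + 1), (j.choose l : ℝ) * (pValue K i χ * pValue K i f) := by
        refine Finset.sum_le_sum fun l hl => ?_
        have hl' : l ≤ j := Nat.lt_succ_iff.1 (Finset.mem_range.1 hl)
        rw [iteratedFDerivWithin_of_isOpen l Ω.isOpen hxΩ,
          iteratedFDerivWithin_of_isOpen (j - l) Ω.isOpen hxΩ, mul_assoc]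
        exact mul_le_mul_of_nonneg_left (mul_le_mul (le_pValue K (hl'.trans hj) _ hx)
          (le_pValue K ((Nat.sub_le j l).trans hj) _ hx) (norm_nonneg _) hχ) (Nat.cast_nonneg _)
    _ = 2 ^ j * (pValue K i χ * pValue K i f) := by
        rw [← Finset.sum_mul, ← Nat.cast_sum, Nat.sum_range_choose]
        norm_cast
    _ ≤ 2 ^ i * (pValue K i χ * pValue K i f) := by
        gcongr
        norm_num
    _ = 2 ^ i * pValue K i χ * pValue K i f := by ring

theorem pValue_congr {K : CompactIn Ω} (i : ℕ) {f g : SmoothFn Ω}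
    (h : ∀ x ∈ K.1, f.1 =ᶠ[𝓝 x] g.1) : pValue K i f = pValue K i g := by
  unfold pValue derivValues
  congr 1
  ext r
  constructor
  · rintro ⟨x, hx, j, hj, rfl⟩
    exact ⟨x, hx, j, hj, by rw [((h x hx).iteratedFDeriv ℝ j).eq_of_nhds]⟩
  · rintro ⟨x, hx, j, hj, rfl⟩
    exact ⟨x, hx, j, hj, by rw [((h x hx).iteratedFDeriv ℝ j).eq_of_nhds]⟩

theorem pValue_eq_zero {K : CompactIn Ω} (i : ℕ) {f : SmoothFn Ω}
    (h : ∀ x ∈ K.1, ∀ᶠ y in 𝓝 x, f.1 y = 0) : pValue K i f = 0 := by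
  rw [← pValue_zero K i]
  exact pValue_congr i h

/-- A relatively closed subset `S` of `Ω` has a smooth cutoff function supported in a given open
neighbourhood `U`: the ratio `f₁ / (f₁ + f₂)` of smooth functions with supports `U` and
`{x | infEDist x S > infEDist x Uᶜ}` does not require `S` to be compact. -/
theorem exists_cutoff [FiniteDimensional ℝ V] {S U : Set V} (hU : IsOpen U) (hUΩ : U ⊆ Ω)
    (hSU : S ⊆ U) (hS : closure S ∩ Ω ⊆ S) :
    ∃ χ : SmoothFn Ω, (∃ W, IsOpen W ∧ S ⊆ W ∧ W ⊆ Ω ∧ ∀ x ∈ W, χ.1 x = 1) ∧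
      ∀ x ∉ U, χ.1 x = 0 := by
  let W : Set V := {x | Metric.infEDist x Uᶜ < Metric.infEDist x S}
  let W' : Set V := {x | Metric.infEDist x S < Metric.infEDist x Uᶜ}
  have hW : IsOpen W := isOpen_lt Metric.continuous_infEDist Metric.continuous_infEDist
  have hW' : IsOpen W' := isOpen_lt Metric.continuous_infEDist Metric.continuous_infEDist
  have hUc : IsClosed Uᶜ := hU.isClosed_compl
  have hpos : ∀ x ∈ U, 0 < Metric.infEDist x Uᶜ := fun x hx =>
    pos_iff_ne_zero.2 fun h => ((Metric.mem_iff_infEDist_zero_of_closed hUc).2 h) hx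
  have hcov : ∀ x ∈ Ω, x ∈ U ∨ x ∈ W := by
    intro x hx
    by_cases hxU : x ∈ U
    · exact Or.inl hxU
    · refine Or.inr ?_
      change Metric.infEDist x Uᶜ < Metric.infEDist x S
      rw [(Metric.mem_iff_infEDist_zero_of_closed hUc).1 hxU, pos_iff_ne_zero]
      intro h
      exact hxU (hSU (hS ⟨Metric.mem_closure_iff_infEDist_zero.2 h, hx⟩))
  obtain ⟨f₁, hs₁, hd₁, hr₁⟩ := hU.exists_contDiff_support_eq (n := ⊤)
  obtain ⟨f₂, hs₂, hd₂, hr₂⟩ := hW.exists_contDiff_support_eq (n := ⊤)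
  have h₁ : ∀ x, 0 ≤ f₁ x := fun x => (hr₁ ⟨x, rfl⟩).1
  have h₂ : ∀ x, 0 ≤ f₂ x := fun x => (hr₂ ⟨x, rfl⟩).1
  have hne : ∀ x ∈ Ω, f₁ x + f₂ x ≠ 0 := by
    intro x hx h
    have e1 : f₁ x = 0 := by linarith [h₁ x, h₂ x]
    have e2 : f₂ x = 0 := by linarith [h₁ x, h₂ x]
    rcases hcov x hx with hx | hx
    · exact (hs₁ ▸ hx : x ∈ Function.support f₁) e1
    · exact (hs₂ ▸ hx : x ∈ Function.support f₂) e2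
  have hz₁ : ∀ x ∉ U, f₁ x = 0 := fun x hx => Function.notMem_support.1 (hs₁ ▸ hx)
  have hz₂ : ∀ x ∉ W, f₂ x = 0 := fun x hx => Function.notMem_support.1 (hs₂ ▸ hx)
  refine ⟨⟨fun x => ((f₁ x / (f₁ x + f₂ x) : ℝ) : ℂ),
    Complex.ofRealCLM.contDiff.comp_contDiffOn
      (hd₁.contDiffOn.div (hd₁.add hd₂).contDiffOn hne), fun x hx => ?_⟩,
    ⟨W' ∩ U, hW'.inter hU, fun x hx => ⟨?_, hSU hx⟩, Set.inter_subset_right.trans hUΩ,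
      fun x hx => ?_⟩, fun x hx => ?_⟩
  · simp [hz₁ x fun h => hx (hUΩ h)]
  · change Metric.infEDist x S < Metric.infEDist x Uᶜ
    rw [Metric.infEDist_zero_of_mem hx]
    exact hpos x (hSU hx)
  · have h0 : f₂ x = 0 := hz₂ x fun h => lt_asymm (show Metric.infEDist x Uᶜ < _ from h) hx.1
    have h1 : f₁ x ≠ 0 := (hs₁ ▸ hx.2 : x ∈ Function.support f₁)
    simp [h0, h1]
  · simp [hz₁ x hx]

theorem closure_supp_inter (u : G Ω) : closure (supp u) ∩ Ω ⊆ supp u := by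
  rintro x ⟨hx, hxΩ⟩
  refine ⟨hxΩ, fun W hW hWΩ hxW hv => ?_⟩
  obtain ⟨y, hyW, hy⟩ := mem_closure_iff.1 hx W hW hxW
  exact hy.2 W hW hWΩ hyW hv

theorem supp_subset_of_vanish {v : moderate (pSeminorm Ω)} {K : CompactIn Ω}
    (h : ∀ ε, ∀ x ∉ K.1, (v.1 ε).1 x = 0) : supp (GE.mk _ v) ⊆ K.1 := by
  intro x hx
  by_contra hxK
  refine hx.2 ((Ω : Set V) \ K.1) (Ω.isOpen.sdiff K.2.1.isClosed) Set.sdiff_subset ⟨hx.1, hxK⟩ ?_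
  refine vanishesOn_mk.2 fun κ hκ =>
    IsNegligibleNet.zero.of_le (fun _ => apply_nonneg _ _) fun ε => ?_
  refine (pValue_eq_zero (K := κ.1) κ.2 fun y hy => ?_).le
  filter_upwards [K.2.1.isClosed.isOpen_compl.mem_nhds (hκ hy).2] with z hz using h ε z hz

/-- The net `χ v_ε`. -/
def mulNet (χ : SmoothFn Ω) (v : moderate (pSeminorm Ω)) : moderate (pSeminorm Ω) :=
  ⟨fun ε => mulBy χ (v.1 ε), fun κ =>
    ((v.2 κ).const_mul (2 ^ κ.2 * pValue κ.1 κ.2 χ)).of_le (fun _ => apply_nonneg _ _)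
      fun _ => pValue_mulBy_le _ _ _ _⟩

theorem mulNet_apply (χ : SmoothFn Ω) (v : moderate (pSeminorm Ω)) (ε : Idx) (x : V) :
    ((mulNet χ v).1 ε).1 x = χ.1 x * (v.1 ε).1 x := rfl

/-- A cutoff function which is `1` near the support does not change a generalized function. -/
theorem mk_mulNet [LocallyCompactSpace V] (χ : SmoothFn Ω) (v : moderate (pSeminorm Ω))
    {W : Set V} (hW : IsOpen W) (hvW : supp (GE.mk _ v) ⊆ W) (hχ : ∀ x ∈ W, χ.1 x = 1) :
    GE.mk _ (mulNet χ v) = GE.mk _ v := by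
  refine GE.mk_eq_mk.2 fun κ => ?_
  -- on `W` the difference is zero, and off `W` the net `v` is negligible
  let L : CompactIn Ω := ⟨κ.1.1 \ W, κ.1.2.1.diff hW, Set.sdiff_subset.trans κ.1.2.2⟩
  have hn := negligible_of_disjoint v L (fun x hx hs => hx.2 (hvW hs)) κ.2
  have hn' := (hn.const_mul (2 ^ κ.2 * pValue L κ.2 χ)).add hn
  refine hn'.of_le (fun _ => apply_nonneg _ _) fun ε => ?_
  have hnn : 0 ≤ 2 ^ κ.2 * pValue L κ.2 χ * pValue L κ.2 (v.1 ε) + pValue L κ.2 (v.1 ε) := by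
    have := pValue_nonneg L κ.2 χ
    have := pValue_nonneg L κ.2 (v.1 ε)
    positivity
  refine pValue_le _ _ _ hnn fun x hx j hj => ?_
  by_cases hxW : x ∈ W
  · have e : ((mulNet χ v - v).1 ε).1 =ᶠ[𝓝 x] fun _ => 0 := by
      filter_upwards [hW.mem_nhds hxW] with y hy
      change χ.1 y * (v.1 ε).1 y - (v.1 ε).1 y = 0
      rw [hχ y hy, one_mul, sub_self]
    rw [(e.iteratedFDeriv ℝ j).eq_of_nhds]
    exact (by simp : ‖iteratedFDeriv ℝ j (fun _ : V => (0 : ℂ)) x‖ = 0).le.trans hnn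
  · refine (le_pValue L hj _ (⟨hx, hxW⟩ : x ∈ L.1)).trans ?_
    refine (map_sub_le_add (pSeminorm Ω (L, κ.2)) (mulBy χ (v.1 ε)) (v.1 ε)).trans ?_
    exact add_le_add_left (pValue_mulBy_le χ (v.1 ε) L κ.2) _

/-- A generalized function with support in an open set has a representative which vanishes outside
this set. -/
theorem exists_rep_of_supp_subset [FiniteDimensional ℝ V] (u : G Ω) {U : Set V} (hU : IsOpen U)
    (hUΩ : U ⊆ Ω) (hu : supp u ⊆ U) :
    ∃ v : moderate (pSeminorm Ω), GE.mk _ v = u ∧ ∀ ε, ∀ x ∉ U, (v.1 ε).1 x = 0 := by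
  have := FiniteDimensional.proper_real V
  obtain ⟨a, rfl⟩ := GE.mk_surjective u
  obtain ⟨χ, ⟨W, hW, hSW, -, h1⟩, h0⟩ := exists_cutoff hU hUΩ hu (closure_supp_inter _)
  refine ⟨mulNet χ a, mk_mulNet χ a hW hSW h1, fun ε x hx => ?_⟩
  rw [mulNet_apply, h0 x hx, zero_mul]

/-- A cutoff function equal to `1` near `K` with compact support in the open set `U`. -/
theorem exists_compact_cutoff [FiniteDimensional ℝ V] (K : CompactIn Ω) {U : Set V}
    (hU : IsOpen U) (hUΩ : U ⊆ Ω) (hKU : K.1 ⊆ U) :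
    ∃ (χ : SmoothFn Ω) (L : CompactIn Ω), L.1 ⊆ U ∧
      (∃ W, IsOpen W ∧ K.1 ⊆ W ∧ W ⊆ Ω ∧ ∀ x ∈ W, χ.1 x = 1) ∧ ∀ x ∉ interior L.1, χ.1 x = 0 := by
  have := FiniteDimensional.proper_real V
  obtain ⟨L, hL, h1, h2⟩ := exists_compact_between K.2.1 hU hKU
  obtain ⟨χ, h, h0⟩ := exists_cutoff (Ω := Ω) isOpen_interior
    (interior_subset.trans (h2.trans hUΩ)) h1
    (Set.inter_subset_left.trans K.2.1.isClosed.closure_subset)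
  exact ⟨χ, ⟨L, hL, h2.trans hUΩ⟩, h2, h, h0⟩

/-- An exhaustion of `Ω` by compact sets. -/
theorem exists_exhaustion [FiniteDimensional ℝ V] (Ω : Opens V) :
    ∃ L : ℕ → CompactIn Ω, (∀ m, (L m).1 ⊆ interior (L (m + 1)).1) ∧
      (∀ i j, i ≤ j → (L i).1 ⊆ (L j).1) ∧ ∀ K : CompactIn Ω, ∃ m, K.1 ⊆ interior (L m).1 := by
  have := FiniteDimensional.proper_real V
  have : LocallyCompactSpace Ω := Ω.isOpen.locallyCompactSpace
  let e := CompactExhaustion.choice (Ω : Set V)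
  have hint : ∀ m, Subtype.val '' (e m) ⊆ interior (Subtype.val '' (e (m + 1)) : Set V) := by
    intro m
    refine (Set.image_mono (e.subset_interior_succ m)).trans ?_
    exact interior_maximal (Set.image_mono interior_subset)
      (Ω.isOpen.isOpenMap_subtype_val _ isOpen_interior)
  have hmono : ∀ i j, i ≤ j → (Subtype.val '' (e i) : Set V) ⊆ Subtype.val '' (e j) :=
    fun i j hij => Set.image_mono (e.subset hij)
  refine ⟨fun m => ⟨Subtype.val '' (e m), (e.isCompact m).image continuous_subtype_val, by
    rintro _ ⟨x, -, rfl⟩; exact x.2⟩, hint, hmono, fun K => ?_⟩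
  obtain ⟨m, hm⟩ := K.2.1.elim_directed_cover
    (fun m => interior (Subtype.val '' (e m) : Set V)) (fun _ => isOpen_interior) (by
      intro x hx
      obtain ⟨m, hm⟩ := e.exists_mem ⟨x, K.2.2 hx⟩
      exact Set.mem_iUnion.2 ⟨m + 1, hint m ⟨_, hm, rfl⟩⟩)
    (directed_of_isDirected_le fun i j hij => interior_mono (hmono i j hij))
  exact ⟨m, hm⟩

end Cutoff

section Kernels

variable {n : ℕ} {Ω : Opens (EuclideanSpace ℝ (Fin n))}

/-! ### Properly supported representatives of kernels -/

theorem CompactIn.exists_nhd {V : Type*} [NormedAddCommGroup V] [NormedSpace ℝ V]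
    [LocallyCompactSpace V] {Ω : Opens V} (K : CompactIn Ω) :
    ∃ L : CompactIn Ω, K.1 ⊆ interior L.1 := by
  obtain ⟨L, hL, h1, h2⟩ := exists_compact_between K.2.1 Ω.isOpen K.2.2
  exact ⟨⟨L, hL, h2⟩, h1⟩

/-- A set which is proper over the second factor has an open neighbourhood with this property:
over the part of `Ω` outside the first `m` sets of an exhaustion, the `m`-th compact
neighbourhood of a fibre is allowed. -/
theorem exists_open_proper_snd {S : Set (EuclideanSpace ℝ (Fin n) × EuclideanSpace ℝ (Fin n))}
    (hSΩ : S ⊆ (sq Ω : Set _))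
    (hS : ∀ K : CompactIn Ω, ∃ L : CompactIn Ω, Prod.fst '' (S ∩ Prod.snd ⁻¹' K.1) ⊆ L.1) :
    ∃ U : Set (EuclideanSpace ℝ (Fin n) × EuclideanSpace ℝ (Fin n)), IsOpen U ∧ S ⊆ U ∧
      U ⊆ (sq Ω : Set _) ∧
      ∀ K : CompactIn Ω, ∃ L : CompactIn Ω, ∀ q ∈ U, q.2 ∈ K.1 → q.1 ∈ L.1 := by
  obtain ⟨L, -, hmono, hex⟩ := exists_exhaustion Ω
  choose C hC using fun m => hS (L m)
  choose D hD using fun m => (C m).exists_nhd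
  refine ⟨⋃ m, interior (D m).1 ×ˢ ((Ω : Set _) \ ⋃ l ∈ Set.Iio m, (L l).1), ?_, ?_, ?_, ?_⟩
  · refine isOpen_iUnion fun m => isOpen_interior.prod (Ω.isOpen.sdiff ?_)
    exact (Set.finite_Iio m).isClosed_biUnion fun l _ => (L l).2.1.isClosed
  · intro q hq
    have hqΩ := hSΩ hq
    have hex' : ∃ m, q.2 ∈ (L m).1 := by
      obtain ⟨m, hm⟩ := hex (CompactIn.single q.2 hqΩ.2)
      exact ⟨m, interior_subset (hm (Set.mem_singleton _))⟩
    classical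
    refine Set.mem_iUnion.2 ⟨Nat.find hex', hD _ (hC _ ⟨q, ⟨hq, Nat.find_spec hex'⟩, rfl⟩),
      hqΩ.2, fun h => ?_⟩
    obtain ⟨l, hl, hql⟩ := Set.mem_iUnion₂.1 h
    exact Nat.find_min hex' hl hql
  · refine Set.iUnion_subset fun m q hq => ⟨(D m).2.2 (interior_subset hq.1), hq.2.1⟩
  · intro K
    obtain ⟨M, hM⟩ := hex K
    refine ⟨⟨⋃ m ∈ Set.Iic M, (D m).1, (Set.finite_Iic M).isCompact_biUnion fun m _ => (D m).2.1,
      Set.iUnion₂_subset fun m _ => (D m).2.2⟩, fun q hq hqK => ?_⟩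
    obtain ⟨m, hm⟩ := Set.mem_iUnion.1 hq
    refine Set.mem_iUnion₂.2 ⟨m, ?_, interior_subset hm.1⟩
    by_contra hlt
    exact hm.2.2 (Set.mem_iUnion₂.2 ⟨M, Set.mem_Iio.2 (not_le.1 hlt), interior_subset (hM hqK)⟩)

/-- A net of kernels whose supports lie in a common proper subset of `Ω × Ω`. -/
def IsProperNet (a : moderate (pSeminorm (sq Ω))) : Prop :=
  ∀ K : CompactIn Ω, ∃ L : CompactIn Ω, ∀ ε x y,
    (x ∈ K.1 → y ∉ L.1 → (a.1 ε).1 (x, y) = 0) ∧ (y ∈ K.1 → x ∉ L.1 → (a.1 ε).1 (x, y) = 0)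

/-- The estimate which defines the regular generalized functions, for a net of smooth
functions. -/
def IsRegularNet {V : Type*} [NormedAddCommGroup V] [NormedSpace ℝ V] {Ω : Opens V}
    (a : moderate (pSeminorm Ω)) : Prop :=
  ∀ K : CompactIn Ω, ∃ N : ℕ, ∀ i : ℕ, BigO (fun ε => pSeminorm Ω (K, i) (a.1 ε)) (-(N : ℝ))

theorem IsRegularNet.mulNet {V : Type*} [NormedAddCommGroup V] [NormedSpace ℝ V] {Ω : Opens V}
    {a : moderate (pSeminorm Ω)} (ha : IsRegularNet a) (χ : SmoothFn Ω) :
    IsRegularNet (mulNet χ a) := by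
  intro K
  obtain ⟨N, hN⟩ := ha K
  exact ⟨N, fun i => ((hN i).const_mul (2 ^ i * pValue K i χ)).of_le (fun _ => apply_nonneg _ _)
    fun _ => pValue_mulBy_le _ _ _ _⟩

/-- A properly supported kernel has properly supported representatives, obtained from any
representative by multiplication with a smooth function. -/
theorem exists_proper_rep (a : moderate (pSeminorm (sq Ω)))
    (hk : IsProperlySupported (GE.mk _ a)) :
    ∃ χ : SmoothFn (sq Ω), IsProperNet (mulNet χ a) ∧ GE.mk _ (mulNet χ a) = GE.mk _ a := by
  have hsub : supp (GE.mk _ a) ⊆ (sq Ω : Set _) := fun q hq => hq.1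
  obtain ⟨U₁, hU₁, hS₁, hΩ₁, hp₁⟩ := exists_open_proper_snd hsub fun K => (hk K).2
  obtain ⟨U₂, hU₂, hS₂, -, hp₂⟩ := exists_open_proper_snd (Ω := Ω)
    (S := Prod.swap ⁻¹' supp (GE.mk _ a)) (fun q hq => ⟨(hsub hq).2, (hsub hq).1⟩) (fun K => by
      obtain ⟨L, hL⟩ := (hk K).1
      refine ⟨L, ?_⟩
      rintro _ ⟨q, hq, rfl⟩
      exact hL ⟨q.swap, hq, rfl⟩)
  obtain ⟨χ, ⟨W, hW, hSW, -, h1⟩, h0⟩ := exists_cutoff (Ω := sq Ω)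
    (hU₁.inter (hU₂.preimage continuous_swap)) (Set.inter_subset_left.trans hΩ₁)
    (Set.subset_inter hS₁ fun q hq => hS₂ (by simpa using hq)) (closure_supp_inter (GE.mk _ a))
  refine ⟨χ, fun K => ?_, mk_mulNet χ a hW hSW h1⟩
  obtain ⟨L₁, hL₁⟩ := hp₁ K
  obtain ⟨L₂, hL₂⟩ := hp₂ K
  refine ⟨⟨L₁.1 ∪ L₂.1, L₁.2.1.union L₂.2.1, Set.union_subset L₁.2.2 L₂.2.2⟩,
    fun ε x y => ⟨fun hx hy => ?_, fun hy hx => ?_⟩⟩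
  · rw [mulNet_apply, h0 _ fun hq => hy (Or.inr (hL₂ (y, x) hq.2 hx)), zero_mul]
  · rw [mulNet_apply, h0 _ fun hq => hx (Or.inl (hL₁ (x, y) hq.1 hy)), zero_mul]

/-! ### Nets of compactly supported distributions -/

/-- A net in `ℰ'(Ω)` with the uniform moderate bound of a basic functional on `𝒢(Ω)`, normalized to
hold for all `ε`. -/
structure BasicNet (Ω : Opens (EuclideanSpace ℝ (Fin n))) where
  /-- The functionals of the net. -/
  t : Idx → SmoothFn Ω →ₗ[ℂ] ℂ
  isCompact : ∀ ε, IsCompactDistribution (t ε)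
  /-- A common compact set carrying the functionals. -/
  L : CompactIn Ω
  /-- A common order. -/
  m : ℕ
  /-- The exponent of growth. -/
  N : ℕ
  bound : ∀ f ε, ‖t ε f‖ ≤ (ε : ℝ) ^ (-(N : ℝ)) * pValue L m f

namespace BasicNet

theorem moderate_apply (τ : BasicNet Ω) (u : moderate (pSeminorm Ω)) :
    (fun ε => τ.t ε (u.1 ε)) ∈ modScalars :=
  (IsModerateNet.mul ⟨τ.N, BigO.rpow _⟩ (u.2 (τ.L, τ.m))).of_le (fun _ => norm_nonneg _)
    fun ε => τ.bound _ ε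

/-- The net `t_ε(u_ε)`. -/
def eval (τ : BasicNet Ω) (u : moderate (pSeminorm Ω)) : modScalars :=
  ⟨fun ε => τ.t ε (u.1 ε), τ.moderate_apply u⟩

/-- The functional on `𝒢(Ω)` is given by the net. -/
def Represents (τ : BasicNet Ω) (T : BasicDualG Ω) : Prop :=
  ∀ u, T.1 (GE.mk _ u) = CTilde.mk (τ.eval u)

theorem exists_represents (T : BasicDualG Ω) : ∃ τ : BasicNet Ω, τ.Represents T := by
  classical
  obtain ⟨T, t, ht, ⟨K, j, N, η, hb⟩, hT⟩ := T
  refine ⟨⟨fun ε => if ε ≤ η then t ε else 0, fun ε => ?_, K, j, N, fun f ε => ?_⟩, fun u => ?_⟩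
  · split_ifs
    · exact ht ε
    · exact ⟨(K, 0), 0, fun f => by simp⟩
  · split_ifs with h
    · exact hb f ε h
    · rw [LinearMap.zero_apply, norm_zero]
      exact mul_nonneg (Real.rpow_nonneg ε.pos.le _) (pValue_nonneg K j f)
  · obtain ⟨h, e⟩ := hT u
    refine e.trans (CTilde.mk_eq_mk.2 ?_)
    intro q
    refine (BigO.zero q).of_le_eventually (fun _ => norm_nonneg _) ?_
    filter_upwards [eventually_le_toZero η] with ε hε
    simp [eval, hε]

theorem apply_eq_zero (τ : BasicNet Ω) (ε : Idx) {f : SmoothFn Ω}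
    (h : ∀ x ∈ τ.L.1, ∀ᶠ y in 𝓝 x, f.1 y = 0) : τ.t ε f = 0 := by
  have := τ.bound f ε
  rw [pValue_eq_zero τ.m h, mul_zero] at this
  exact norm_le_zero_iff.1 this

theorem pValue_applySlices_le (τ : BasicNet Ω) (ε : Idx) (h : SmoothFn (sq Ω)) (K : CompactIn Ω)
    (i : ℕ) : pValue K i (applySlices (τ.t ε) (τ.isCompact ε) h) ≤
      2 * ((ε : ℝ) ^ (-(τ.N : ℝ)) * pValue (K.prod τ.L) (τ.m + i) h) := by
  obtain ⟨w, hw, hle⟩ := exists_derivSlice K i (τ.isCompact ε) h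
  refine hle.trans (mul_le_mul_of_nonneg_left ((τ.bound w ε).trans ?_) two_pos.le)
  exact mul_le_mul_of_nonneg_left (pValue_le_of_mem_derivSlices hw _ _)
    (Real.rpow_nonneg ε.pos.le _)

theorem bigO_applySlices (τ : BasicNet Ω) (a : Idx → SmoothFn (sq Ω)) (K : CompactIn Ω)
    (i : ℕ) {N : ℕ} (h : BigO (fun ε => pSeminorm (sq Ω) (K.prod τ.L, τ.m + i) (a ε)) (-(N : ℝ))) :
    BigO (fun ε => pSeminorm Ω (K, i) (applySlices (τ.t ε) (τ.isCompact ε) (a ε)))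
      (-((τ.N + N : ℕ) : ℝ)) := by
  refine ((((BigO.rpow (-(τ.N : ℝ))).mul h).const_mul 2).mono ?_).of_le
    (fun _ => apply_nonneg _ _) fun ε => τ.pValue_applySlices_le ε (a ε) K i
  push_cast
  linarith

/-- The net of smooth functions `x ↦ t_ε(a_ε(x, ·))`. -/
def apply (τ : BasicNet Ω) (a : moderate (pSeminorm (sq Ω))) : moderate (pSeminorm Ω) :=
  ⟨fun ε => applySlices (τ.t ε) (τ.isCompact ε) (a.1 ε), fun κ => by
    obtain ⟨N, hN⟩ := a.2 (κ.1.prod τ.L, τ.m + κ.2)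
    exact ⟨τ.N + N, τ.bigO_applySlices a.1 κ.1 κ.2 hN⟩⟩

theorem isRegularNet_apply (τ : BasicNet Ω) {a : moderate (pSeminorm (sq Ω))}
    (ha : IsRegularNet a) : IsRegularNet (τ.apply a) := by
  intro K
  obtain ⟨N, hN⟩ := ha (K.prod τ.L)
  exact ⟨τ.N + N, fun i => τ.bigO_applySlices a.1 K i (hN _)⟩

/-- If the kernels are properly supported, then the functions `x ↦ t_ε(a_ε(x, ·))` have their
supports in a common compact set. -/
theorem exists_compact_apply (τ : BasicNet Ω) {a : moderate (pSeminorm (sq Ω))}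
    (ha : IsProperNet a) : ∃ K L : CompactIn Ω, τ.L.1 ⊆ interior L.1 ∧
      (∀ ε x y, y ∈ L.1 → x ∉ interior K.1 → (a.1 ε).1 (x, y) = 0) ∧
      ∀ ε, ∀ x ∉ interior K.1, ((τ.apply a).1 ε).1 x = 0 := by
  obtain ⟨L, hL⟩ := τ.L.exists_nhd
  obtain ⟨K₀, hK₀⟩ := ha L
  obtain ⟨K, hK⟩ := K₀.exists_nhd
  have h0 : ∀ ε x y, y ∈ L.1 → x ∉ interior K.1 → (a.1 ε).1 (x, y) = 0 :=
    fun ε x y hy hx => (hK₀ ε x y).2 hy fun h => hx (hK h)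
  refine ⟨K, L, hL, h0, fun ε x hx => τ.apply_eq_zero ε fun y hy => ?_⟩
  filter_upwards [isOpen_interior.mem_nhds (hL hy)] with z hz
    using h0 ε x z (interior_subset hz) hx

theorem apply_intOver {τ : BasicNet Ω} {T : BasicDualG Ω} (hτ : τ.Represents T) (K : CompactIn Ω)
    (a : moderate (pSeminorm (sq Ω))) (u : G Ω) :
    T.1 (intOver K (GE.mk _ a) u) = pairOver K (GE.mk _ (τ.apply a)) u := by
  obtain ⟨u, rfl⟩ := GE.mk_surjective u
  refine (hτ ⟨fun ε => intBilin K (a.1 ε) (u.1 ε), _⟩).trans (CTilde.mk_congr fun ε => ?_)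
  exact apply_intFn (τ.isCompact ε) K (a.1 ε) (u.1 ε)

theorem opDual_eq {τ : BasicNet Ω} {T : BasicDualG Ω} (hτ : τ.Represents T)
    (a : moderate (pSeminorm (sq Ω))) :
    opDual (GE.mk _ a) T = G.toDual (GE.mk _ (τ.apply a)) :=
  funext fun u => apply_intOver hτ u.nhd a u.toG

end BasicNet

end Kernels

section Extension

/-! ### Linear maps induced by moderate nets of linear maps -/

variable {E₁ E₂ ι₁ ι₂ : Type*} [AddCommGroup E₁] [Module ℂ E₁] [AddCommGroup E₂] [Module ℂ E₂]
  {p₁ : ι₁ → Seminorm ℂ E₁} {p₂ : ι₂ → Seminorm ℂ E₂}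

/-- A net of linear maps is bounded for the families of seminorms, with moderate constants. -/
def IsModerateMap (p₁ : ι₁ → Seminorm ℂ E₁) (p₂ : ι₂ → Seminorm ℂ E₂)
    (A : Idx → E₁ →ₗ[ℂ] E₂) : Prop :=
  ∀ i₂, ∃ i₁, ∃ c : Idx → ℝ, IsModerateNet c ∧ ∀ ε u, p₂ i₂ (A ε u) ≤ c ε * p₁ i₁ u

/-- The action of a moderate net of linear maps on moderate nets. -/
def IsModerateMap.mapNet {A : Idx → E₁ →ₗ[ℂ] E₂} (hA : IsModerateMap p₁ p₂ A) :
    moderate p₁ →ₗ[modScalars] moderate p₂ where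
  toFun u := ⟨fun ε => A ε (u.1 ε), fun i₂ => by
    obtain ⟨i₁, c, hc, h⟩ := hA i₂
    exact (hc.mul (u.2 i₁)).of_le (fun _ => apply_nonneg _ _) fun ε => h ε _⟩
  map_add' u v := Subtype.ext <| funext fun ε => map_add (A ε) (u.1 ε) (v.1 ε)
  map_smul' c u := Subtype.ext <| funext fun ε => map_smul (A ε) (c.1 ε) (u.1 ε)

/-- The continuous `C̃`-linear map `[u] ↦ [A_ε u_ε]` induced by a moderate net of linear maps. -/
def IsModerateMap.toCLM {A : Idx → E₁ →ₗ[ℂ] E₂} (hA : IsModerateMap p₁ p₂ A) :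
    GE p₁ →L[CTilde] GE p₂ where
  toFun := (negligible p₁).mapQ (negligible p₂) hA.mapNet (by
    intro u hu i₂
    obtain ⟨i₁, c, hc, h⟩ := hA i₂
    refine ((hu i₁).mul_moderate hc).of_le (fun _ => apply_nonneg _ _) fun ε => ?_
    rw [mul_comm]
    exact h ε _)
  map_add' := map_add _
  map_smul' := by
    intro c x
    obtain ⟨c, rfl⟩ := CTilde.mk_surjective c
    obtain ⟨u, rfl⟩ := GE.mk_surjective x
    exact congrArg (GE.mk p₂) (map_smul hA.mapNet c u)
  cont := continuous_gauge fun x i₂ δ hδ => by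
    obtain ⟨i₁, c, ⟨N, hc⟩, h⟩ := hA i₂
    obtain ⟨d, hd⟩ := exists_scale_lt hδ
    refine ⟨{i₁}, scale (d + N), scale_pos _, fun y hy => ?_⟩
    obtain ⟨x, rfl⟩ := GE.mk_surjective x
    obtain ⟨y, rfl⟩ := GE.mk_surjective y
    have hy' := hy i₁ (Finset.mem_singleton_self _)
    rw [← map_sub, GE.ups_mk_lt_scale] at hy'
    obtain ⟨b, hb, hO⟩ := hy'
    refine lt_of_le_of_lt ?_ hd
    change GE.ups i₂ (GE.mk p₂ (hA.mapNet y) - GE.mk p₂ (hA.mapNet x)) ≤ _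
    rw [← map_sub, ← map_sub]
    refine GE.ups_mk_le_scale ?_
    refine ((hc.mul hO).mono ?_).of_le (fun _ => apply_nonneg _ _) fun ε => h ε _
    linarith

end Extension

section Transpose

variable {n : ℕ} {Ω : Opens (EuclideanSpace ℝ (Fin n))}

/-! ### The transpose of a properly supported operator on `𝒢(Ω)` -/

/-- The function `y ↦ ∫_Ω h(x, y) u(x) dx`, for a kernel `h` such that for `y` in a compact set the
integrand is supported in a compact set. -/
def intWhole (h : SmoothFn (sq Ω))
    (hh : ∀ K : CompactIn Ω, ∃ L : CompactIn Ω, ∀ x y, y ∈ K.1 → x ∉ L.1 → h.1 (x, y) = 0) :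
    SmoothFn Ω →ₗ[ℂ] SmoothFn Ω :=
  have key : ∀ (K L : CompactIn Ω), (∀ x y, y ∈ K.1 → x ∉ L.1 → h.1 (x, y) = 0) →
      ∀ (u : SmoothFn Ω), ∀ y ∈ K.1, ∫ x, h.1 (x, y) * u.1 x = (intFn L h u).1 y := by
    intro K L hL u y hy
    refine (setIntegral_eq_integral_of_forall_compl_eq_zero fun x hx => ?_).symm
    rw [hL x y hy hx, zero_mul]
  have point : ∀ y ∈ Ω, ∃ L : CompactIn Ω, ∀ u : SmoothFn Ω,
      ∫ x, h.1 (x, y) * u.1 x = (intBilin L h u).1 y := by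
    intro y hy
    obtain ⟨L, hL⟩ := hh (CompactIn.single y hy)
    exact ⟨L, fun u => key _ L hL u y (Set.mem_singleton y)⟩
  { toFun := fun u => ⟨fun y => ∫ x, h.1 (x, y) * u.1 x, fun y hy => by
      obtain ⟨K, hK⟩ := (CompactIn.single y hy).exists_nhd
      obtain ⟨L, hL⟩ := hh K
      refine (((intFn L h u).contDiffAt_top hy).congr_of_eventuallyEq ?_).contDiffWithinAt
      filter_upwards [isOpen_interior.mem_nhds (hK (Set.mem_singleton y))] with z hz
        using key K L hL u z (interior_subset hz), fun y hy => by
      have h0 : ∀ x, h.1 (x, y) = 0 := fun x => h.2.2 (x, y) fun h => hy h.2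
      simp [h0]⟩
    map_add' := fun u v => SmoothFn.ext fun y hy => by
      obtain ⟨L, hL⟩ := point y hy
      refine (hL (u + v)).trans ?_
      rw [map_add]
      exact congrArg₂ (· + ·) (hL u).symm (hL v).symm
    map_smul' := fun c u => SmoothFn.ext fun y hy => by
      obtain ⟨L, hL⟩ := point y hy
      refine (hL (c • u)).trans ?_
      rw [map_smul]
      exact congrArg (c * ·) (hL u).symm }

theorem intWhole_eq_intFn {h : SmoothFn (sq Ω)}
    (hh : ∀ K : CompactIn Ω, ∃ L : CompactIn Ω, ∀ x y, y ∈ K.1 → x ∉ L.1 → h.1 (x, y) = 0)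
    (u : SmoothFn Ω) {y : EuclideanSpace ℝ (Fin n)} {L : CompactIn Ω}
    (hL : ∀ x ∉ L.1, h.1 (x, y) * u.1 x = 0) :
    (intWhole h hh u).1 y = (intFn L h u).1 y :=
  (setIntegral_eq_integral_of_forall_compl_eq_zero hL).symm

theorem IsProperNet.snd {a : moderate (pSeminorm (sq Ω))} (ha : IsProperNet a) (ε : Idx)
    (K : CompactIn Ω) :
    ∃ L : CompactIn Ω, ∀ x y, y ∈ K.1 → x ∉ L.1 → (a.1 ε).1 (x, y) = 0 := by
  obtain ⟨L, hL⟩ := ha K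
  exact ⟨L, fun x y => (hL ε x y).2⟩

theorem IsProperNet.isModerateMap {a : moderate (pSeminorm (sq Ω))} (ha : IsProperNet a) :
    IsModerateMap (pSeminorm Ω) (pSeminorm Ω) fun ε => intWhole (a.1 ε) (ha.snd ε) := by
  rintro ⟨K, i⟩
  obtain ⟨K', hK'⟩ := K.exists_nhd
  obtain ⟨L, hL⟩ := ha K'
  refine ⟨(L, 0), fun ε => volume.real L.1 * pSeminorm (sq Ω) (L.prod K, i) (a.1 ε),
    (a.2 _).const_mul _, fun ε u => ?_⟩
  refine le_trans (le_of_eq ?_)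
    ((intBilin_le L K i (a.1 ε) u).trans (le_of_eq (mul_assoc _ _ _).symm))
  refine pValue_congr i fun y hy => ?_
  filter_upwards [isOpen_interior.mem_nhds (hK' hy)] with z hz
  exact intWhole_eq_intFn _ u fun x hx => by
    rw [(hL ε x z).2 (interior_subset hz) hx, zero_mul]

/-- The extension of the transpose of a properly supported operator to `𝒢(Ω)`, given by
`y ↦ ∫_Ω a_ε(x, y) u_ε(x) dx` for a properly supported representative `a` of the kernel. -/
def transposeExt {a : moderate (pSeminorm (sq Ω))} (ha : IsProperNet a) : G Ω →L[CTilde] G Ω :=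
  ha.isModerateMap.toCLM

theorem extendsTranspose {a : moderate (pSeminorm (sq Ω))} (ha : IsProperNet a) :
    ExtendsTranspose (GE.mk _ a) (transposeExt ha) := by
  intro u
  have hsupp : supp u.toG ⊆ interior u.nhd.1 := u.exists_nhd.choose_spec
  obtain ⟨v, hv, h0⟩ := exists_rep_of_supp_subset u.toG isOpen_interior
    (interior_subset.trans u.nhd.2.2) hsupp
  unfold transposeOp
  rw [← hv]
  refine congrArg (GE.mk _) (Subtype.ext (funext fun ε => Subtype.ext (funext fun y => ?_)))
  exact intWhole_eq_intFn _ _ fun x hx => by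
    rw [h0 ε x fun h => hx (interior_subset h), mul_zero]

/-- `∫_K f u` does not depend on the compact neighbourhood `K` of the support of `u`. -/
theorem pairOver_congr (f u : G Ω) {K K' : CompactIn Ω} (hK : supp u ⊆ interior K.1)
    (hK' : supp u ⊆ interior K'.1) : pairOver K f u = pairOver K' f u := by
  obtain ⟨f, rfl⟩ := GE.mk_surjective f
  obtain ⟨v, rfl, h0⟩ := exists_rep_of_supp_subset u (isOpen_interior.inter isOpen_interior)
    (Set.inter_subset_left.trans (interior_subset.trans K.2.2)) (Set.subset_inter hK hK')
  refine CTilde.mk_congr fun ε => ?_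
  have h1 : ∀ x ∉ K.1, (f.1 ε).1 x * (v.1 ε).1 x = 0 := fun x hx => by
    rw [h0 ε x fun h => hx (interior_subset h.1), mul_zero]
  have h2 : ∀ x ∉ K'.1, (f.1 ε).1 x * (v.1 ε).1 x = 0 := fun x hx => by
    rw [h0 ε x fun h => hx (interior_subset h.2), mul_zero]
  exact (setIntegral_eq_integral_of_forall_compl_eq_zero h1).trans
    (setIntegral_eq_integral_of_forall_compl_eq_zero h2).symm

namespace BasicNet

theorem supp_apply_subset (τ : BasicNet Ω) {a : moderate (pSeminorm (sq Ω))} {K : CompactIn Ω}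
    (h : ∀ ε, ∀ x ∉ interior K.1, ((τ.apply a).1 ε).1 x = 0) :
    supp (GE.mk _ (τ.apply a)) ⊆ K.1 :=
  supp_subset_of_vanish fun ε x hx => h ε x fun h => hx (interior_subset h)

/-- The class of `x ↦ t_ε(a_ε(x, ·))` for properly supported kernels, an element of `𝒢_c(Ω)`. -/
def applyC (τ : BasicNet Ω) {a : moderate (pSeminorm (sq Ω))} (ha : IsProperNet a) : Gc Ω :=
  ⟨GE.mk _ (τ.apply a), by
    obtain ⟨K, -, -, -, h⟩ := τ.exists_compact_apply ha
    exact ⟨K, τ.supp_apply_subset h⟩⟩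

theorem apply_transposeExt {τ : BasicNet Ω} {T : BasicDualG Ω} (hτ : τ.Represents T)
    {a : moderate (pSeminorm (sq Ω))} (ha : IsProperNet a) :
    (fun u => T.1 (transposeExt ha u)) = (τ.applyC ha).toDual := by
  funext u
  obtain ⟨u, rfl⟩ := GE.mk_surjective u
  obtain ⟨K₀, L, hL, h0, hK₀⟩ := τ.exists_compact_apply ha
  obtain ⟨K, hK⟩ := K₀.exists_nhd
  have e : (τ.applyC ha).toDual (GE.mk _ u) =
      pairOver K (GE.mk _ u) (GE.mk _ (τ.apply a)) :=
    pairOver_congr (GE.mk _ u) (τ.applyC ha).toG (τ.applyC ha).exists_nhd.choose_spec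
      ((τ.supp_apply_subset hK₀).trans hK)
  rw [e]
  refine (hτ (ha.isModerateMap.mapNet u)).trans (CTilde.mk_congr fun ε => ?_)
  have e1 : τ.t ε (intWhole (a.1 ε) (ha.snd ε) (u.1 ε)) = τ.t ε (intFn K (a.1 ε) (u.1 ε)) := by
    rw [← sub_eq_zero, ← map_sub]
    refine τ.apply_eq_zero ε fun y hy => ?_
    filter_upwards [isOpen_interior.mem_nhds (hL hy)] with z hz
    refine sub_eq_zero.2 (intWhole_eq_intFn _ _ fun x hx => ?_)
    rw [h0 ε x z (interior_subset hz) fun h => hx (interior_subset (hK (interior_subset h))),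
      zero_mul]
  refine e1.trans ((apply_intFn (τ.isCompact ε) K (a.1 ε) (u.1 ε)).trans ?_)
  exact integral_congr_ae (Eventually.of_forall fun x => mul_comm _ _)

end BasicNet

end Transpose

section Scaling

variable {E ι : Type*} [AddCommGroup E] [Module ℂ E] {p : ι → Seminorm ℂ E}

/-- The net `ε ^ b u_ε`. -/
def scaleNet (b : ℝ) (u : moderate p) : moderate p := powScalar b • u

theorem scaleNet_apply (b : ℝ) (u : moderate p) (ε : Idx) :
    (scaleNet b u).1 ε = (powScalar b).1 ε • u.1 ε := rfl

theorem seminorm_scaleNet (b : ℝ) (u : moderate p) (i : ι) (ε : Idx) :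
    p i ((scaleNet b u).1 ε) = (ε : ℝ) ^ b * p i (u.1 ε) := by
  rw [scaleNet_apply, map_smul_eq_mul, norm_powScalar]

end Scaling

section Continuity

variable {n : ℕ} {Ω : Opens (EuclideanSpace ℝ (Fin n))}

/-! ### Bounded sets which test the difference of two functionals -/

/-- The constant function `1` on `Ω`. -/
def oneFn (Ω : Opens (EuclideanSpace ℝ (Fin n))) : SmoothFn Ω :=
  ⟨Set.indicator (Ω : Set _) fun _ => 1, contDiffOn_const.congr fun _ hx =>
    Set.indicator_of_mem hx _, fun _ hx => Set.indicator_of_notMem hx _⟩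

theorem oneFn_apply {x : EuclideanSpace ℝ (Fin n)} (hx : x ∈ Ω) : (oneFn Ω).1 x = 1 :=
  Set.indicator_of_mem (s := (Ω : Set (EuclideanSpace ℝ (Fin n)))) hx fun _ => (1 : ℂ)

theorem mulBy_tensor_oneFn_apply (ψ : SmoothFn Ω) (h : SmoothFn (sq Ω))
    (x y : EuclideanSpace ℝ (Fin n)) :
    (mulBy (tensor ψ (oneFn Ω)) h).1 (x, y) = ψ.1 x * h.1 (x, y) := by
  by_cases hq : (x, y) ∈ sq Ω
  · change ψ.1 x * (oneFn Ω).1 y * h.1 (x, y) = _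
    rw [oneFn_apply hq.2, mul_one]
  · rw [mulBy_apply, h.2.2 _ hq, mul_zero, mul_zero]

theorem mulBy_applySlices (ψ : SmoothFn Ω) {t : SmoothFn Ω →ₗ[ℂ] ℂ} (ht : IsCompactDistribution t)
    (h : SmoothFn (sq Ω)) :
    mulBy ψ (applySlices t ht h) = applySlices t ht (mulBy (tensor ψ (oneFn Ω)) h) := by
  refine Subtype.ext (funext fun x => ?_)
  have e : slice x (mulBy (tensor ψ (oneFn Ω)) h) = ψ.1 x • slice x h :=
    Subtype.ext (funext fun y => mulBy_tensor_oneFn_apply ψ h x y)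
  change ψ.1 x * t (slice x h) = t (slice x (mulBy (tensor ψ (oneFn Ω)) h))
  rw [e, map_smul, smul_eq_mul]

theorem IsCompactDistribution.sub {t s : SmoothFn Ω →ₗ[ℂ] ℂ} (ht : IsCompactDistribution t)
    (hs : IsCompactDistribution s) : IsCompactDistribution (t - s) := by
  obtain ⟨L, m, C, hC, h⟩ := ht.exists_bound
  obtain ⟨L', m', C', hC', h'⟩ := hs.exists_bound
  refine ⟨(⟨L.1 ∪ L'.1, L.2.1.union L'.2.1, Set.union_subset L.2.2 L'.2.2⟩, max m m'), C + C',
    fun f => (norm_sub_le _ _).trans ?_⟩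
  rw [add_mul]
  exact add_le_add
    ((h f).trans (mul_le_mul_of_nonneg_left
      (pValue_mono Set.subset_union_left (le_max_left _ _) f) hC))
    ((h' f).trans (mul_le_mul_of_nonneg_left
      (pValue_mono Set.subset_union_right (le_max_right _ _) f) hC'))

theorem moderate_of_derivSlices {K : CompactIn Ω} {i : ℕ} {b : moderate (pSeminorm (sq Ω))}
    {w : Idx → SmoothFn Ω} (hw : ∀ ε, w ε ∈ derivSlices K i (b.1 ε)) :
    w ∈ moderate (pSeminorm Ω) := fun κ =>
  (b.2 (K.prod κ.1, κ.2 + i)).of_le (fun _ => apply_nonneg _ _)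
    fun ε => pValue_le_of_mem_derivSlices (hw ε) κ.1 κ.2

namespace BasicNet

theorem exists_derivSlice_sub (σ τ : BasicNet Ω) (b : moderate (pSeminorm (sq Ω)))
    (K : CompactIn Ω) (i : ℕ) :
    ∃ w : Idx → SmoothFn Ω, (∀ ε, w ε ∈ derivSlices K i (b.1 ε)) ∧
      ∀ ε, pValue K i ((τ.apply b - σ.apply b).1 ε) ≤ 2 * ‖τ.t ε (w ε) - σ.t ε (w ε)‖ := by
  choose w hw hle using fun ε => exists_derivSlice K i
    ((τ.isCompact ε).sub (σ.isCompact ε)) (b.1 ε)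
  exact ⟨w, hw, hle⟩

theorem mulNet_apply_sub (σ τ : BasicNet Ω) (ψ : SmoothFn Ω) (a : moderate (pSeminorm (sq Ω))) :
    mulNet ψ (τ.apply a - σ.apply a) =
      τ.apply (mulNet (tensor ψ (oneFn Ω)) a) - σ.apply (mulNet (tensor ψ (oneFn Ω)) a) := by
  refine Subtype.ext (funext fun ε => ?_)
  change mulBy ψ (_ - _) = _
  rw [map_sub]
  exact congrArg₂ (· - ·) (mulBy_applySlices ψ (τ.isCompact ε) (a.1 ε))
    (mulBy_applySlices ψ (σ.isCompact ε) (a.1 ε))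

/-- Closeness of two basic functionals on one bounded set controls countably many seminorms of the
difference of the functions `x ↦ t_ε(a_ε(x, ·))`, localized by functions `φ_m` such that
`φ_m(x) a_ε(x, y)` vanishes over every compact set of points `y` for large `m`. The bounded set
consists of the derivatives of slices of `φ_m(x) a_ε(x, y)`, multiplied by `ε ^ (-c_m)`. -/
theorem exists_bounded_test (a : moderate (pSeminorm (sq Ω))) (φ : ℕ → SmoothFn Ω)
    (K : ℕ → CompactIn Ω) (I : ℕ → Set ℕ) (c : ℕ → ℕ)
    (hbd : ∀ m (L : CompactIn Ω) j, ∃ N : ℕ, ∀ i ∈ I m,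
      BigO (fun ε => pSeminorm (sq Ω) ((K m).prod L, j + i) (a.1 ε)) (-(N : ℝ)))
    (hfin : ∀ L : CompactIn Ω, ∃ M, ∀ m ≥ M, ∀ ε x, ∀ y ∈ L.1,
      (φ m).1 x * (a.1 ε).1 (x, y) = 0) :
    ∃ B : Set (G Ω), IsBoundedG B ∧ ∀ (S T : BasicDualG Ω) (σ τ : BasicNet Ω),
      σ.Represents S → τ.Represents T → ⨆ u ∈ B, CTilde.enorm (T.1 u - S.1 u) < 1 →
      ∀ m, ∀ i ∈ I m, BigO
        (fun ε => pSeminorm Ω (K m, i) ((mulNet (φ m) (τ.apply a - σ.apply a)).1 ε)) (c m) := by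
  let b : ℕ → moderate (pSeminorm (sq Ω)) := fun m => mulNet (tensor (φ m) (oneFn Ω)) a
  refine ⟨{u | ∃ m, ∃ i ∈ I m, ∃ w : moderate (pSeminorm Ω),
    (∀ ε, w.1 ε ∈ derivSlices (K m) i ((b m).1 ε)) ∧
      u = GE.mk _ (scaleNet (-(c m : ℝ)) w)}, ?_, ?_⟩
  · rintro ⟨L, j⟩
    obtain ⟨L', hL'⟩ := L.exists_nhd
    obtain ⟨M, hM⟩ := hfin L'
    choose N hN using fun m => hbd m L j
    refine lt_of_le_of_lt (b := scale (-(∑ m ∈ Finset.range M, (c m + N m) : ℕ))) ?_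
      (scale_lt_top _)
    refine iSup₂_le fun u hu => ?_
    obtain ⟨m, i, hi, w, hw, rfl⟩ := hu
    have hle : ∀ ε : Idx, pSeminorm Ω (L, j) ((scaleNet (-(c m : ℝ)) w).1 ε) ≤
        (ε : ℝ) ^ (-(c m : ℝ)) * pSeminorm (sq Ω) ((K m).prod L, j + i) ((b m).1 ε) := by
      intro ε
      rw [seminorm_scaleNet]
      exact mul_le_mul_of_nonneg_left (pValue_le_of_mem_derivSlices (hw ε) L j)
        (Real.rpow_nonneg ε.pos.le _)
    refine GE.ups_mk_le_scale (BigO.of_le ?_ (fun _ => apply_nonneg _ _) hle)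
    -- the pieces with `m < M` have the moderate bounds of `a`, the others vanish near `L`
    by_cases hm : m < M
    · have h1 := ((hN m i hi).const_mul (2 ^ (j + i) *
        pValue ((K m).prod L) (j + i) (tensor (φ m) (oneFn Ω)))).of_le
        (a' := fun ε => pSeminorm (sq Ω) ((K m).prod L, j + i) ((b m).1 ε))
        (fun _ => apply_nonneg _ _) fun ε => pValue_mulBy_le _ _ _ _
      refine ((BigO.rpow (-(c m : ℝ))).mul h1).mono ?_
      have hs : c m + N m ≤ ∑ m ∈ Finset.range M, (c m + N m) :=
        Finset.single_le_sum (f := fun m => c m + N m) (fun _ _ => Nat.zero_le _)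
          (Finset.mem_range.2 hm)
      have hs' : ((c m + N m : ℕ) : ℝ) ≤ ((∑ m ∈ Finset.range M, (c m + N m) : ℕ) : ℝ) := by
        exact_mod_cast hs
      push_cast at hs' ⊢
      linarith
    · refine (BigO.zero _).of_le (fun ε => mul_nonneg (Real.rpow_nonneg ε.pos.le _)
        (apply_nonneg _ _)) fun ε => le_of_eq ?_
      have hz : pSeminorm (sq Ω) ((K m).prod L, j + i) ((b m).1 ε) = 0 := by
        refine pValue_eq_zero (K := (K m).prod L) _ fun q hq => ?_
        filter_upwards [(isOpen_interior.preimage continuous_snd).mem_nhds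
          (show q ∈ Prod.snd ⁻¹' interior L'.1 from hL' hq.2)] with z hz
        exact (mulBy_tensor_oneFn_apply _ _ z.1 z.2).trans
          (hM m (not_lt.1 hm) ε z.1 z.2 (interior_subset hz))
      rw [hz, mul_zero]
  · intro S T σ τ hσ hτ hlt m i hi
    obtain ⟨w, hw, hle⟩ := exists_derivSlice_sub σ τ (b m) (K m) i
    let w' : moderate (pSeminorm Ω) := ⟨w, moderate_of_derivSlices hw⟩
    have h1 : CTilde.enorm (T.1 (GE.mk _ (scaleNet (-(c m : ℝ)) w')) -
        S.1 (GE.mk _ (scaleNet (-(c m : ℝ)) w'))) < 1 :=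
      (le_iSup₂ (f := fun u _ => CTilde.enorm (T.1 u - S.1 u)) _
        ⟨m, i, hi, w', hw, rfl⟩).trans_lt hlt
    rw [hσ, hτ, ← map_sub, ← scale_zero, CTilde.enorm_mk_lt_scale] at h1
    obtain ⟨b', hb', hO⟩ := h1
    rw [mulNet_apply_sub]
    refine ((((BigO.rpow (c m)).mul hO).const_mul 2).mono (by linarith)).of_le
      (fun _ => apply_nonneg _ _) fun ε => (hle ε).trans (le_of_eq ?_)
    have e : ∀ ρ : BasicNet Ω, (ρ.eval (scaleNet (-(c m : ℝ)) w')).1 ε =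
        (powScalar (-(c m : ℝ))).1 ε * ρ.t ε (w ε) := fun ρ =>
      map_smul (ρ.t ε) ((powScalar (-(c m : ℝ))).1 ε) (w ε)
    have e' : (τ.eval (scaleNet (-(c m : ℝ)) w') - σ.eval (scaleNet (-(c m : ℝ)) w')).1 ε =
        (powScalar (-(c m : ℝ))).1 ε * (τ.t ε (w ε) - σ.t ε (w ε)) := by
      rw [mul_sub, ← e, ← e]
      rfl
    -- the factors `ε ^ c` and `ε ^ (-c)` cancel
    rw [e', norm_mul, norm_powScalar, ← mul_assoc, ← mul_assoc, mul_assoc 2,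
      ← Real.rpow_add ε.pos, add_neg_cancel, Real.rpow_zero, mul_one]

/-- The case of a single localizing function, constant equal to `1`, of the existence of a bounded
test set. -/
theorem exists_bounded_test_single (a : moderate (pSeminorm (sq Ω))) (K : CompactIn Ω) (I : Set ℕ)
    (c : ℕ)
    (hbd : ∀ (L : CompactIn Ω) j, ∃ N : ℕ, ∀ i ∈ I,
      BigO (fun ε => pSeminorm (sq Ω) (K.prod L, j + i) (a.1 ε)) (-(N : ℝ))) :
    ∃ B : Set (G Ω), IsBoundedG B ∧ ∀ (S T : BasicDualG Ω) (σ τ : BasicNet Ω),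
      σ.Represents S → τ.Represents T → ⨆ u ∈ B, CTilde.enorm (T.1 u - S.1 u) < 1 →
      ∀ i ∈ I, BigO (fun ε => pSeminorm Ω (K, i) ((τ.apply a - σ.apply a).1 ε)) c := by
  obtain ⟨B, hB, h⟩ := exists_bounded_test a (fun m => if m = 0 then oneFn Ω else 0)
    (fun _ => K) (fun _ => I) (fun _ => c) (fun _ => hbd)
    (fun _ => ⟨1, fun m hm ε x y _ => by
      rw [if_neg (by omega)]
      exact zero_mul _⟩)
  refine ⟨B, hB, fun S T σ τ hσ hτ hlt i hi => ?_⟩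
  have := h S T σ τ hσ hτ hlt 0 i hi
  have e : mulNet (oneFn Ω) (τ.apply a - σ.apply a) = τ.apply a - σ.apply a :=
    Subtype.ext <| funext fun ε => SmoothFn.ext fun x hx => by
      rw [mulNet_apply, oneFn_apply hx, one_mul]
  rwa [if_pos rfl, e] at this

/-- A net of distributions which represents a basic functional. -/
def of (T : BasicDualG Ω) : BasicNet Ω := (exists_represents T).choose

theorem of_represents (T : BasicDualG Ω) : (of T).Represents T := (exists_represents T).choose_spec

theorem continuous_apply (a : moderate (pSeminorm (sq Ω))) :
    Continuous fun T : BasicDualG Ω => (GE.mk _ ((of T).apply a) : G Ω) := by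
  refine continuous_gauge fun S κ δ hδ => ?_
  obtain ⟨c, hc⟩ := exists_scale_lt hδ
  obtain ⟨B, hB, h⟩ := exists_bounded_test_single a κ.1 {κ.2} c fun L j => by
    obtain ⟨N, hN⟩ := a.2 (κ.1.prod L, j + κ.2)
    refine ⟨N, fun i hi => ?_⟩
    rw [Set.mem_singleton_iff.1 hi]
    exact hN
  refine ⟨{⟨B, hB⟩}, 1, one_pos, fun T hT => lt_of_le_of_lt ?_ hc⟩
  rw [← map_sub]
  exact GE.ups_mk_le_scale (h S T _ _ (of_represents S) (of_represents T)
    (hT _ (Finset.mem_singleton_self _)) κ.2 rfl)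

/-- The class of `x ↦ t_ε(a_ε(x, ·))` for regular kernels, an element of `𝒢^∞(Ω)`. -/
def applyInf (τ : BasicNet Ω) {a : moderate (pSeminorm (sq Ω))} (ha : IsRegularNet a) : Ginf Ω :=
  ⟨GE.mk _ (τ.apply a), τ.apply a, rfl, τ.isRegularNet_apply ha⟩

theorem _root_.Colombeau.IsRegularNet.exists_bound {a : moderate (pSeminorm (sq Ω))}
    (ha : IsRegularNet a) (K L : CompactIn Ω) (j : ℕ) (I : Set ℕ) : ∃ N : ℕ, ∀ i ∈ I,
      BigO (fun ε => pSeminorm (sq Ω) (K.prod L, j + i) (a.1 ε)) (-(N : ℝ)) := by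
  obtain ⟨N, hN⟩ := ha (K.prod L)
  exact ⟨N, fun i _ => hN _⟩

theorem continuous_applyInf {a : moderate (pSeminorm (sq Ω))} (ha : IsRegularNet a) :
    Continuous fun T : BasicDualG Ω => (of T).applyInf ha := by
  refine continuous_gauge fun S K δ hδ => ?_
  obtain ⟨c, hc⟩ := exists_scale_lt hδ
  obtain ⟨B, hB, h⟩ := exists_bounded_test_single a K Set.univ c fun L j =>
    ha.exists_bound K L j _
  refine ⟨{⟨B, hB⟩}, 1, one_pos, fun T hT => lt_of_le_of_lt ?_ hc⟩
  change upsInf K (GE.mk _ ((of T).apply a) - GE.mk _ ((of S).apply a)) ≤ _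
  rw [← map_sub]
  refine GE.upsOn_mk_le_scale ?_
  rintro ⟨K', i⟩ rfl
  exact h S T _ _ (of_represents S) (of_represents T) (hT _ (Finset.mem_singleton_self _)) i
    (Set.mem_univ i)

end BasicNet

end Continuity

section CompactTarget

variable {n : ℕ} {Ω : Opens (EuclideanSpace ℝ (Fin n))}

/-! ### Continuity into inductive limits -/

/-- A sequence of test functions which sums up to `1`, finitely on every compact set. -/
theorem exists_telescope (Ω : Opens (EuclideanSpace ℝ (Fin n))) :
    ∃ (φ : ℕ → SmoothFn Ω) (C : ℕ → CompactIn Ω), (∀ m, ∀ x ∉ (C m).1, (φ m).1 x = 0) ∧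
      ∀ K : CompactIn Ω, ∃ M, (∀ m ≥ M, ∀ x ∈ K.1, (φ m).1 x = 0) ∧
        ∀ x ∈ K.1, (∑ m ∈ Finset.range M, φ m).1 x = 1 := by
  obtain ⟨L, hL, hmono, hex⟩ := exists_exhaustion Ω
  choose χ D hD h1 h0 using fun m => exists_compact_cutoff (L m) isOpen_interior
    (interior_subset.trans (L (m + 1)).2.2) (hL m)
  have h1' : ∀ m, ∀ x ∈ (L m).1, (χ m).1 x = 1 := fun m x hx => by
    obtain ⟨W, -, hW, -, h⟩ := h1 m
    exact h x (hW hx)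
  have h0' : ∀ m, ∀ x ∉ (L (m + 1)).1, (χ m).1 x = 0 := fun m x hx =>
    h0 m x fun h => hx (interior_subset (hD m (interior_subset h)))
  -- the summands are the differences of consecutive cutoff functions, beginning with `0`
  let θ : ℕ → SmoothFn Ω := fun m => Nat.casesOn m 0 χ
  refine ⟨fun m => θ (m + 1) - θ m, fun m => L (m + 1), fun m x hx => ?_, fun K => ?_⟩
  · rcases m with _ | m
    · change (χ 0).1 x - 0 = 0
      rw [h0' 0 x hx, sub_zero]
    · change (χ (m + 1)).1 x - (χ m).1 x = 0
      rw [h0' (m + 1) x hx, h0' m x fun h => hx (hmono _ _ (Nat.le_succ _) h), sub_zero]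
  · obtain ⟨M, hM⟩ := hex K
    have hKL : ∀ m ≥ M, ∀ x ∈ K.1, (χ m).1 x = 1 := fun m hm x hx =>
      h1' m x (hmono _ _ hm (interior_subset (hM hx)))
    refine ⟨M + 1, fun m hm x hx => ?_, fun x hx => ?_⟩
    · obtain ⟨m, rfl⟩ := Nat.exists_eq_add_of_le' (Nat.one_le_of_lt hm)
      change (χ (m + 1)).1 x - (χ m).1 x = 0
      rw [hKL _ (by omega) x hx, hKL _ (by omega) x hx, sub_self]
    · rw [Finset.sum_range_sub]
      change (χ M).1 x - 0 = 1
      rw [hKL M le_rfl x hx, sub_zero]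

theorem CompactIn.exists_union {J : Type*} (s : Finset J) (f : J → CompactIn Ω) :
    ∃ K : CompactIn Ω, ∀ j ∈ s, (f j).1 ⊆ K.1 :=
  ⟨⟨⋃ j ∈ s, (f j).1, s.isCompact_biUnion fun j _ => (f j).2.1,
    Set.iUnion₂_subset fun j _ => (f j).2.2⟩, fun _ hj =>
      Set.subset_biUnion_of_mem (u := fun j => (f j).1) hj⟩

theorem UltraPseudoSeminorm.sum_lt {M : Type*} [AddCommGroup M] [Module CTilde M]
    (Q : UltraPseudoSeminorm M) {δ : ℝ≥0∞} (hδ : 0 < δ) (u : ℕ → M)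
    (hu : ∀ m, (Q.toFun (u m) : ℝ≥0∞) < δ) (N : ℕ) :
    (Q.toFun (∑ m ∈ Finset.range N, u m) : ℝ≥0∞) < δ := by
  induction N with
  | zero => simpa [Q.map_zero] using hδ
  | succ N ih =>
    rw [Finset.sum_range_succ]
    refine lt_of_le_of_lt (ENNReal.coe_le_coe.2 (Q.add_le _ _)) ?_
    rw [ENNReal.coe_max]
    exact max_lt ih (hu N)

theorem mk_mulNet_sum (φ : ℕ → SmoothFn Ω) (v : moderate (pSeminorm Ω)) (M : ℕ) :
    GE.mk _ (mulNet (∑ m ∈ Finset.range M, φ m) v) =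
      ∑ m ∈ Finset.range M, GE.mk _ (mulNet (φ m) v) := by
  induction M with
  | zero =>
    have e : mulNet (∑ m ∈ Finset.range 0, φ m) v = 0 :=
      Subtype.ext <| funext fun ε => Subtype.ext <| funext fun x => zero_mul _
    rw [e, map_zero, Finset.sum_range_zero]
  | succ M ih =>
    rw [Finset.sum_range_succ, Finset.sum_range_succ, ← ih, ← map_add]
    exact congrArg _ (Subtype.ext <| funext fun ε => Subtype.ext <| funext fun x => add_mul _ _ _)

namespace BasicNet

theorem mk_apply_sub_eq_sum (σ τ : BasicNet Ω) {a : moderate (pSeminorm (sq Ω))}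
    (ha : IsProperNet a) {φ : ℕ → SmoothFn Ω}
    (hφ : ∀ K : CompactIn Ω, ∃ M, ∀ x ∈ K.1, (∑ m ∈ Finset.range M, φ m).1 x = 1) :
    ∃ M, (GE.mk _ (τ.apply a) - GE.mk _ (σ.apply a) : G Ω) =
      ∑ m ∈ Finset.range M, GE.mk _ (mulNet (φ m) (τ.apply a - σ.apply a)) := by
  obtain ⟨K, -, -, -, hK⟩ := τ.exists_compact_apply ha
  obtain ⟨K', -, -, -, hK'⟩ := σ.exists_compact_apply ha
  obtain ⟨M, hM⟩ := hφ ⟨K.1 ∪ K'.1, K.2.1.union K'.2.1, Set.union_subset K.2.2 K'.2.2⟩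
  refine ⟨M, ?_⟩
  rw [← mk_mulNet_sum, ← map_sub]
  refine congrArg _ (Subtype.ext <| funext fun ε => Subtype.ext <| funext fun x => ?_)
  rw [mulNet_apply]
  by_cases hx : x ∈ K.1 ∪ K'.1
  · rw [hM x hx, one_mul]
  · have h0 : ((τ.apply a - σ.apply a).1 ε).1 x = 0 := by
      change ((τ.apply a).1 ε).1 x - ((σ.apply a).1 ε).1 x = 0
      rw [hK ε x fun h => hx (Or.inl (interior_subset h)),
        hK' ε x fun h => hx (Or.inr (interior_subset h)), sub_zero]
    rw [h0, mul_zero]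

theorem _root_.Colombeau.IsProperNet.exists_mul_eq_zero {a : moderate (pSeminorm (sq Ω))}
    (ha : IsProperNet a) {φ : ℕ → SmoothFn Ω}
    (hφ : ∀ K : CompactIn Ω, ∃ M, ∀ m ≥ M, ∀ x ∈ K.1, (φ m).1 x = 0) (L : CompactIn Ω) :
    ∃ M, ∀ m ≥ M, ∀ ε x, ∀ y ∈ L.1, (φ m).1 x * (a.1 ε).1 (x, y) = 0 := by
  obtain ⟨K, hK⟩ := ha L
  obtain ⟨M, hM⟩ := hφ K
  refine ⟨M, fun m hm ε x y hy => ?_⟩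
  by_cases hx : x ∈ K.1
  · rw [hM m hm x hx, zero_mul]
  · rw [(hK ε x y).2 hy hx, mul_zero]

/-- The seminorms of the inductive limit are controlled piecewise: the difference of two values is
a finite sum of its products with the functions of `exists_telescope`, and the number of terms does
not matter in an ultrametric estimate. -/
theorem continuous_applyC {a : moderate (pSeminorm (sq Ω))} (ha : IsProperNet a) :
    Continuous fun T : BasicDualG Ω => (of T).applyC ha := by
  obtain ⟨φ, C, hC, hφ⟩ := exists_telescope Ω
  refine continuous_gauge fun S Q δ hδ => ?_
  choose s c hs using fun m => exists_ball_of_continuous (Q.2 (C m))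
    (x := ⟨0, by rw [map_zero, supp_zero]; exact Set.empty_subset _⟩) Q.1.map_zero hδ
  choose K hK using fun m => CompactIn.exists_union (s m) fun κ => κ.1.1
  obtain ⟨B, hB, h⟩ := exists_bounded_test a φ K (fun m => {(s m).sup fun κ => κ.1.2}) c
    (fun m L j => by
      obtain ⟨N, hN⟩ := a.2 ((K m).prod L, j + (s m).sup fun κ => κ.1.2)
      refine ⟨N, fun i hi => ?_⟩
      rw [Set.mem_singleton_iff.1 hi]
      exact hN)
    (ha.exists_mul_eq_zero fun K => (hφ K).imp fun _ h => h.1)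
  refine ⟨{⟨B, hB⟩}, 1, one_pos, fun T hT => ?_⟩
  have hT' := h S T _ _ (of_represents S) (of_represents T) (hT _ (Finset.mem_singleton_self _))
  -- the number `M` of pieces depends on `T`, but the bounded set does not
  obtain ⟨M, hM⟩ := mk_apply_sub_eq_sum (of S) (of T) ha fun K => (hφ K).imp fun _ h => h.2
  have hsupp : ∀ m, supp (GE.mk _ (mulNet (φ m) ((of T).apply a - (of S).apply a))) ⊆ (C m).1 :=
    fun m => supp_subset_of_vanish fun ε x hx => by rw [mulNet_apply, hC m x hx, zero_mul]
  let d : ℕ → Gc Ω := fun m => ⟨_, C m, hsupp m⟩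
  have hd : (of T).applyC ha - (of S).applyC ha = ∑ m ∈ Finset.range M, d m := by
    refine Subtype.val_injective ?_
    change GE.mk _ ((of T).apply a) - GE.mk _ ((of S).apply a) =
      Gc.toG (∑ m ∈ Finset.range M, d m)
    rw [hM, map_sum]
    rfl
  rw [hd]
  refine Q.1.sum_lt hδ d (fun m => hs m ⟨d m, hsupp m⟩ fun κ hκ => ?_) M
  rw [map_zero, sub_zero]
  exact GE.ups_mk_le_scale ((hT' m _ rfl).of_le (fun _ => apply_nonneg _ _) fun ε =>
    pValue_mono (hK m κ hκ) (Finset.le_sup (f := fun κ : NhdIndex (C m) => κ.1.2) hκ) _)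

/-- The class of `x ↦ t_ε(a_ε(x, ·))` for regular properly supported kernels, an element of
`𝒢^∞_c(Ω)`. -/
def applyCInf (τ : BasicNet Ω) {a : moderate (pSeminorm (sq Ω))} (ha : IsProperNet a)
    (ha' : IsRegularNet a) : Gcinf Ω :=
  ⟨GE.mk _ (τ.apply a), (τ.applyInf ha').2, (τ.applyC ha).2⟩

/-- As in `continuous_applyC`, with all orders of differentiation controlled at once by the
regularity of the kernel. -/
theorem continuous_applyCInf {a : moderate (pSeminorm (sq Ω))} (ha : IsProperNet a)
    (ha' : IsRegularNet a) : Continuous fun T : BasicDualG Ω => (of T).applyCInf ha ha' := by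
  obtain ⟨φ, C, hC, hφ⟩ := exists_telescope Ω
  refine continuous_gauge fun S Q δ hδ => ?_
  choose s c hs using fun m => exists_ball_of_continuous (Q.2 (C m))
    (x := ⟨0, by rw [map_zero, map_zero, supp_zero]; exact Set.empty_subset _⟩) Q.1.map_zero hδ
  choose K hK using fun m => CompactIn.exists_union (s m) fun L => L.1
  obtain ⟨B, hB, h⟩ := exists_bounded_test a φ K (fun _ => Set.univ) c
    (fun m L j => ha'.exists_bound (K m) L j _)
    (ha.exists_mul_eq_zero fun K => (hφ K).imp fun _ h => h.1)
  refine ⟨{⟨B, hB⟩}, 1, one_pos, fun T hT => ?_⟩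
  have hT' := h S T _ _ (of_represents S) (of_represents T) (hT _ (Finset.mem_singleton_self _))
  obtain ⟨M, hM⟩ := mk_apply_sub_eq_sum (of S) (of T) ha fun K => (hφ K).imp fun _ h => h.2
  have hsupp : ∀ m, supp (GE.mk _ (mulNet (φ m) ((of T).apply a - (of S).apply a))) ⊆ (C m).1 :=
    fun m => supp_subset_of_vanish fun ε x hx => by rw [mulNet_apply, hC m x hx, zero_mul]
  have hreg : ∀ m, GE.mk _ (mulNet (φ m) ((of T).apply a - (of S).apply a)) ∈ ginfSubmodule Ω := by
    intro m
    rw [mulNet_apply_sub]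
    exact Submodule.sub_mem _ ((of T).applyInf (ha'.mulNet _)).2 ((of S).applyInf (ha'.mulNet _)).2
  let d : ℕ → Gcinf Ω := fun m => ⟨_, hreg m, C m, hsupp m⟩
  have hd : (of T).applyCInf ha ha' - (of S).applyCInf ha ha' = ∑ m ∈ Finset.range M, d m := by
    refine Subtype.val_injective ?_
    change GE.mk _ ((of T).apply a) - GE.mk _ ((of S).apply a) =
      Gc.toG (Gcinf.toGc (∑ m ∈ Finset.range M, d m))
    rw [hM, map_sum, map_sum]
    rfl
  rw [hd]
  refine Q.1.sum_lt hδ d (fun m => hs m ⟨d m, hsupp m⟩ fun L hL => ?_) M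
  rw [map_zero, map_zero, sub_zero]
  refine GE.upsOn_mk_le_scale ?_
  rintro ⟨K', i⟩ rfl
  exact (hT' m i (Set.mem_univ i)).of_le (fun _ => apply_nonneg _ _) fun ε =>
    pValue_mono (hK m L hL) le_rfl _

end BasicNet

end CompactTarget

section TestFunctions

variable {n : ℕ} {Ω : Opens (EuclideanSpace ℝ (Fin n))}

/-! ### Cutting off distributions -/

theorem exists_bound_of_tsupport_subset (t : TestFunction Ω ℂ ⊤ →L[ℂ] ℂ) (K : CompactIn Ω) :
    ∃ (m : ℕ) (C : ℝ), 0 ≤ C ∧ ∀ f : TestFunction Ω ℂ ⊤, tsupport f ⊆ K.1 →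
      ‖t f‖ ≤ C * pValue K m (testToSmooth f) := by
  let K' : Compacts (EuclideanSpace ℝ (Fin n)) := ⟨K.1, K.2.1⟩
  let s : ContDiffMapSupportedIn (EuclideanSpace ℝ (Fin n)) ℂ ⊤ K' →L[ℂ] ℂ :=
    t.comp (TestFunction.ofSupportedInCLM ℂ K.2.2)
  obtain ⟨J, C, -, hC⟩ := Seminorm.bound_of_continuous
    (ContDiffMapSupportedIn.withSeminorms ℂ (EuclideanSpace ℝ (Fin n)) ℂ ⊤ K')
    ((normSeminorm ℂ ℂ).comp s.toLinearMap) (continuous_norm.comp s.continuous)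
  refine ⟨J.sup id, C, C.2, fun f hf => ?_⟩
  let g : ContDiffMapSupportedIn (EuclideanSpace ℝ (Fin n)) ℂ ⊤ K' :=
    .of_support_subset f.contDiff ((subset_tsupport _).trans hf)
  have hg : TestFunction.ofSupportedIn K.2.2 g = f := TestFunction.ext fun x => rfl
  have h1 : ‖t (TestFunction.ofSupportedIn K.2.2 g)‖ ≤ C * (J.sup
    (ContDiffMapSupportedIn.seminorm ℂ (EuclideanSpace ℝ (Fin n)) ℂ ⊤ K')) g := hC g
  rw [hg] at h1
  refine h1.trans (mul_le_mul_of_nonneg_left ?_ C.2)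
  refine Seminorm.finset_sup_apply_le (pValue_nonneg _ _ _) fun j hj => ?_
  exact (ContDiffMapSupportedIn.seminorm_top_le_iff ℂ (pValue_nonneg _ _ _) j g).2 fun x hx =>
    le_pValue K (Finset.le_sup (f := id) hj) (testToSmooth f) hx

/-- Multiplication with a test function, as a map from smooth functions to test functions. -/
def mulTest (θ : TestFunction Ω ℂ ⊤) : SmoothFn Ω →ₗ[ℂ] TestFunction Ω ℂ ⊤ where
  toFun f :=
    { toFun := fun x => θ x * f.1 x
      contDiff' := contDiff_iff_contDiffAt.2 fun x => by
        by_cases hx : x ∈ tsupport θ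
        · exact θ.contDiff.contDiffAt.mul (f.contDiffAt_top (θ.tsupport_subset hx))
        · refine (contDiffAt_const (c := (0 : ℂ))).congr_of_eventuallyEq ?_
          filter_upwards [notMem_tsupport_iff_eventuallyEq.1 hx] with y hy
          rw [hy]
          exact zero_mul _
      hasCompactSupport' := θ.hasCompactSupport.mul_right
      tsupport_subset' := (tsupport_mul_subset_left).trans θ.tsupport_subset }
  map_add' f g := TestFunction.ext fun x => mul_add _ _ _
  map_smul' c f := TestFunction.ext fun x => mul_left_comm _ _ _

theorem tsupport_mulTest_subset (θ : TestFunction Ω ℂ ⊤) (f : SmoothFn Ω) :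
    tsupport (mulTest θ f) ⊆ tsupport θ := tsupport_mul_subset_left

/-- The support of a test function. -/
def testSupport (θ : TestFunction Ω ℂ ⊤) : CompactIn Ω :=
  ⟨tsupport θ, θ.hasCompactSupport, θ.tsupport_subset⟩

theorem isCompactDistribution_mulTest (t : TestFunction Ω ℂ ⊤ →L[ℂ] ℂ) (θ : TestFunction Ω ℂ ⊤) :
    IsCompactDistribution (t.toLinearMap.comp (mulTest θ)) := by
  obtain ⟨m, C, hC, h⟩ := exists_bound_of_tsupport_subset t (testSupport θ)
  refine ⟨(testSupport θ, m), C * (2 ^ m * pValue (testSupport θ) m (testToSmooth θ)), fun f => ?_⟩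
  have h1 : ‖t (mulTest θ f)‖ ≤ C * pValue (testSupport θ) m (mulBy (testToSmooth θ) f) :=
    h (mulTest θ f) (tsupport_mulTest_subset θ f)
  have h2 := mul_le_mul_of_nonneg_left
    (pValue_mulBy_le (testToSmooth θ) f (testSupport θ) m) hC
  exact h1.trans (h2.trans (mul_assoc _ _ _).symm.le)

/-- A net in `𝒟'(Ω)` with the moderate bounds of a basic functional on `𝒢_c(Ω)`. -/
structure LocalNet (Ω : Opens (EuclideanSpace ℝ (Fin n))) where
  /-- The distributions of the net. -/
  t : Idx → (TestFunction Ω ℂ ⊤ →L[ℂ] ℂ)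
  bound : ∀ K : CompactIn Ω, ∃ (j N : ℕ) (η : Idx), ∀ (f : TestFunction Ω ℂ ⊤) (ε : Idx),
    tsupport f ⊆ K.1 → ε ≤ η → ‖t ε f‖ ≤ (ε : ℝ) ^ (-(N : ℝ)) * pValue K j (testToSmooth f)

/-- The functions `y ↦ a_ε(x, y)` with `x` in a compact set have their supports in a common compact
set, so that they are reproduced by a cutoff function. -/
theorem IsProperNet.exists_test {a : moderate (pSeminorm (sq Ω))} (ha : IsProperNet a)
    (K : CompactIn Ω) : ∃ θ : TestFunction Ω ℂ ⊤, ∀ ε, ∀ x ∈ K.1, ∀ y,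
      θ y * (a.1 ε).1 (x, y) = (a.1 ε).1 (x, y) := by
  obtain ⟨L, hL⟩ := ha K
  obtain ⟨χ, L', -, ⟨W, -, hW, -, h1⟩, h0⟩ := exists_compact_cutoff L Ω.isOpen le_rfl L.2.2
  have hsupp : tsupport χ.1 ⊆ L'.1 := closure_minimal
    (Function.support_subset_iff'.2 fun x hx => h0 x fun h => hx (interior_subset h))
    L'.2.1.isClosed
  refine ⟨⟨χ.1, contDiff_iff_contDiffAt.2 fun x => ?_,
    L'.2.1.of_isClosed_subset (isClosed_tsupport _) hsupp, hsupp.trans L'.2.2⟩,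
    fun ε x hx y => ?_⟩
  · by_cases hx : x ∈ tsupport χ.1
    · exact χ.contDiffAt_top (L'.2.2 (hsupp hx))
    · exact (contDiffAt_const (c := (0 : ℂ))).congr_of_eventuallyEq
        (notMem_tsupport_iff_eventuallyEq.1 hx)
  · by_cases hy : y ∈ L.1
    · exact (congrArg (· * _) (h1 y (hW hy))).trans (one_mul _)
    · rw [(hL ε x y).1 hx hy, mul_zero]

namespace LocalNet

/-- The distributions of the net, cut off by a test function. -/
def cut (τ : LocalNet Ω) (θ : TestFunction Ω ℂ ⊤) (ε : Idx) : SmoothFn Ω →ₗ[ℂ] ℂ :=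
  (τ.t ε).toLinearMap.comp (mulTest θ)

theorem isCompact_cut (τ : LocalNet Ω) (θ : TestFunction Ω ℂ ⊤) (ε : Idx) :
    IsCompactDistribution (τ.cut θ ε) := isCompactDistribution_mulTest _ _

theorem exists_basicNet (τ : LocalNet Ω) (θ : TestFunction Ω ℂ ⊤) :
    ∃ σ : BasicNet Ω, ∀ᶠ ε in toZero, σ.t ε = τ.cut θ ε := by
  classical
  obtain ⟨j, N, η, h⟩ := τ.bound (testSupport θ)
  let C : ℝ := 2 ^ j * pValue (testSupport θ) j (testToSmooth θ)
  have hC : 0 ≤ C := mul_nonneg (by positivity) (pValue_nonneg _ _ _)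
  -- for small `ε` the constant `C` is absorbed by a factor `ε⁻¹`
  let η' : Idx := ⟨min η (C + 1)⁻¹, lt_min η.pos (by positivity), (min_le_left _ _).trans η.2.2⟩
  refine ⟨⟨fun ε => if ε ≤ η' then τ.cut θ ε else 0, fun ε => ?_, testSupport θ, j, N + 1,
    fun f ε => ?_⟩, (eventually_le_toZero η').mono fun ε hε => if_pos hε⟩
  · split_ifs
    · exact τ.isCompact_cut θ ε
    · exact ⟨(testSupport θ, 0), 0, fun f => by simp⟩
  · have hp := pValue_nonneg (testSupport θ) j f
    have h0 := ε.pos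
    split_ifs with hε
    · have hε' : (ε : ℝ) ≤ min (η : ℝ) (C + 1)⁻¹ := hε
      have hεC : C ≤ (ε : ℝ)⁻¹ := by
        have := (le_inv_comm₀ h0 (by positivity)).1 (hε'.trans (min_le_right _ _))
        linarith
      refine (h (mulTest θ f) ε (tsupport_mulTest_subset θ f)
        (hε'.trans (min_le_left _ _))).trans ?_
      have e : (ε : ℝ) ^ (-((N + 1 : ℕ) : ℝ)) = (ε : ℝ) ^ (-(N : ℝ)) * (ε : ℝ)⁻¹ := by
        rw [← Real.rpow_neg_one, ← Real.rpow_add h0]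
        congr 1
        push_cast
        ring
      rw [e, mul_assoc]
      refine mul_le_mul_of_nonneg_left ?_ (Real.rpow_nonneg h0.le _)
      exact (pValue_mulBy_le (testToSmooth θ) f _ _).trans (mul_le_mul_of_nonneg_right hεC hp)
    · rw [LinearMap.zero_apply, norm_zero]
      exact mul_nonneg (Real.rpow_nonneg h0.le _) hp

end LocalNet

end TestFunctions

section LocalDual

variable {n : ℕ} {Ω : Opens (EuclideanSpace ℝ (Fin n))}

/-! ### Basic functionals on `𝒢_c(Ω)` -/

/-- A cutoff function which reproduces `y ↦ a_ε(x, y)` for all `x ∈ K`. -/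
def IsProperNet.test {a : moderate (pSeminorm (sq Ω))} (ha : IsProperNet a) (K : CompactIn Ω) :
    TestFunction Ω ℂ ⊤ := (ha.exists_test K).choose

theorem IsProperNet.test_mul {a : moderate (pSeminorm (sq Ω))} (ha : IsProperNet a)
    {K : CompactIn Ω} (ε : Idx) {x : EuclideanSpace ℝ (Fin n)} (hx : x ∈ K.1)
    (y : EuclideanSpace ℝ (Fin n)) : ha.test K y * (a.1 ε).1 (x, y) = (a.1 ε).1 (x, y) :=
  (ha.exists_test K).choose_spec ε x hx y

theorem applySlices_congr {t s : SmoothFn Ω →ₗ[ℂ] ℂ} (h : t = s) (ht : IsCompactDistribution t)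
    (hs : IsCompactDistribution s) (a : SmoothFn (sq Ω)) :
    applySlices t ht a = applySlices s hs a := by
  subst h
  rfl

/-- The class in `𝒢_c(Ω)` of the net `θ w_ε`, for a test function `θ`. -/
def cutGc (θ : TestFunction Ω ℂ ⊤) (w : moderate (pSeminorm Ω)) : Gc Ω :=
  ⟨GE.mk _ (mulNet (testToSmooth θ) w), testSupport θ, supp_subset_of_vanish fun ε x hx => by
    have h0 : (testToSmooth θ).1 x = 0 := image_eq_zero_of_notMem_tsupport hx
    rw [mulNet_apply, h0, zero_mul]⟩

theorem supp_cutGc_subset (θ : TestFunction Ω ℂ ⊤) (w : moderate (pSeminorm Ω)) :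
    supp (cutGc θ w).toG ⊆ (testSupport θ).1 :=
  supp_subset_of_vanish fun ε x hx => by
    have h0 : (testToSmooth θ).1 x = 0 := image_eq_zero_of_notMem_tsupport hx
    rw [mulNet_apply, h0, zero_mul]

namespace LocalNet

/-- The functional on `𝒢_c(Ω)` is given by the net. -/
def Represents (τ : LocalNet Ω) (T : BasicDualGc Ω) : Prop :=
  ∀ (u : Gc Ω) (f : Idx → TestFunction Ω ℂ ⊤)
    (hf : (fun ε => testToSmooth (f ε)) ∈ moderate (pSeminorm Ω)),
    (∃ K : CompactIn Ω, ∀ ε, tsupport (f ε) ⊆ K.1) → GE.mk _ ⟨_, hf⟩ = u.toG →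
      ∃ h : (fun ε => τ.t ε (f ε)) ∈ modScalars, T.1 u = CTilde.mk ⟨_, h⟩

theorem exists_represents (T : BasicDualGc Ω) : ∃ τ : LocalNet Ω, τ.Represents T := by
  obtain ⟨T, t, hb, hT⟩ := T
  exact ⟨⟨t, hb⟩, hT⟩

theorem Represents.apply_cutGc {τ : LocalNet Ω} {T : BasicDualGc Ω} (hτ : τ.Represents T)
    (θ : TestFunction Ω ℂ ⊤) (w : moderate (pSeminorm Ω)) :
    ∃ h : (fun ε => τ.cut θ ε (w.1 ε)) ∈ modScalars, T.1 (cutGc θ w) = CTilde.mk ⟨_, h⟩ :=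
  hτ (cutGc θ w) (fun ε => mulTest θ (w.1 ε)) (mulNet (testToSmooth θ) w).2
    ⟨testSupport θ, fun ε => tsupport_mulTest_subset θ (w.1 ε)⟩ rfl

variable (τ : LocalNet Ω) {a : moderate (pSeminorm (sq Ω))} (ha : IsProperNet a)

theorem cut_slice_eq {K K' : CompactIn Ω} (ε : Idx) {x : EuclideanSpace ℝ (Fin n)} (hx : x ∈ K.1)
    (hx' : x ∈ K'.1) : τ.cut (ha.test K) ε (slice x (a.1 ε)) =
      τ.cut (ha.test K') ε (slice x (a.1 ε)) :=
  congrArg (τ.t ε) (TestFunction.ext fun y => (ha.test_mul ε hx y).trans (ha.test_mul ε hx' y).symm)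

open Classical in
/-- The function `x ↦ t_ε(a_ε(x, ·))`, in terms of cutoff functions which may depend on `x`. -/
def applyVal (ε : Idx) (x : EuclideanSpace ℝ (Fin n)) : ℂ :=
  if hx : x ∈ Ω then τ.cut (ha.test (CompactIn.single x hx)) ε (slice x (a.1 ε)) else 0

theorem applyVal_eq {K : CompactIn Ω} (ε : Idx) {x : EuclideanSpace ℝ (Fin n)} (hx : x ∈ K.1) :
    τ.applyVal ha ε x =
      (applySlices (τ.cut (ha.test K) ε) (τ.isCompact_cut _ ε) (a.1 ε)).1 x := by
  have hΩ : x ∈ Ω := K.2.2 hx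
  unfold applyVal
  rw [dif_pos hΩ]
  exact τ.cut_slice_eq ha ε (Set.mem_singleton x) hx

/-- The smooth function `x ↦ t_ε(a_ε(x, ·))`. -/
def applyFn (ε : Idx) : SmoothFn Ω :=
  ⟨τ.applyVal ha ε, fun x hx => by
    obtain ⟨K, hK⟩ := (CompactIn.single x hx).exists_nhd
    refine (((applySlices (τ.cut (ha.test K) ε) (τ.isCompact_cut _ ε) (a.1 ε)).contDiffAt_top
      hx).congr_of_eventuallyEq ?_).contDiffWithinAt
    filter_upwards [isOpen_interior.mem_nhds (hK (Set.mem_singleton x))] with z hz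
      using τ.applyVal_eq ha ε (interior_subset hz), fun x hx => dif_neg hx⟩

theorem eventuallyEq_applySlices {K K' : CompactIn Ω} (hK : K.1 ⊆ interior K'.1) (ε : Idx)
    {x : EuclideanSpace ℝ (Fin n)} (hx : x ∈ K.1) : (τ.applyFn ha ε).1 =ᶠ[𝓝 x]
      (applySlices (τ.cut (ha.test K') ε) (τ.isCompact_cut _ ε) (a.1 ε)).1 := by
  filter_upwards [isOpen_interior.mem_nhds (hK hx)] with z hz
    using τ.applyVal_eq ha ε (interior_subset hz)

/-- On a compact set, `x ↦ t_ε(a_ε(x, ·))` only involves compactly supported distributions with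
uniform moderate bounds. -/
theorem exists_basicNet_pValue (K : CompactIn Ω) : ∃ σ : BasicNet Ω, ∀ᶠ ε in toZero, ∀ i,
    pValue K i (τ.applyFn ha ε) = pValue K i ((σ.apply a).1 ε) := by
  obtain ⟨K', hK⟩ := K.exists_nhd
  obtain ⟨σ, hσ⟩ := τ.exists_basicNet (ha.test K')
  refine ⟨σ, hσ.mono fun ε hε i => ?_⟩
  rw [pValue_congr i fun x hx => τ.eventuallyEq_applySlices ha hK ε hx]
  exact congrArg (pValue K i) (applySlices_congr hε (σ.isCompact ε) _ _).symm

/-- The net of smooth functions `x ↦ t_ε(a_ε(x, ·))`. -/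
def apply : moderate (pSeminorm Ω) :=
  ⟨τ.applyFn ha, fun κ => by
    obtain ⟨σ, hσ⟩ := τ.exists_basicNet_pValue ha κ.1
    exact ((σ.apply a).2 κ).of_le_eventually (fun _ => apply_nonneg _ _)
      (hσ.mono fun ε hε => (hε κ.2).le)⟩

theorem isRegularNet_apply (ha' : IsRegularNet a) : IsRegularNet (τ.apply ha) := by
  intro K
  obtain ⟨σ, hσ⟩ := τ.exists_basicNet_pValue ha K
  obtain ⟨N, hN⟩ := σ.isRegularNet_apply ha' K
  exact ⟨N, fun i => (hN i).of_le_eventually (fun _ => apply_nonneg _ _)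
    (hσ.mono fun ε hε => (hε i).le)⟩

variable {τ} {ha}

/-- `R T` is given by the functions `x ↦ t_ε(a_ε(x, ·))`: on a compact neighbourhood of the support
of `u`, the distributions may be cut off by one test function, and then commute with the integral. -/
theorem opDualC_eq {T : BasicDualGc Ω} (hτ : τ.Represents T) {k : G (sq Ω)}
    (hk : IsProperlySupported k) (hak : GE.mk _ a = k) :
    opDualC k hk T = G.toDual (GE.mk _ (τ.apply ha)) := by
  subst hak
  funext u
  obtain ⟨v, hv⟩ := GE.mk_surjective u.toG
  let K := u.nhd
  let w : moderate (pSeminorm Ω) := ⟨fun ε => intBilin K (a.1 ε) (v.1 ε), fun κ =>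
    (intBilin_bound K κ).moderate a v⟩
  have e1 : transposeOpC (GE.mk _ a) hk u = cutGc (ha.test K) w := by
    refine Subtype.val_injective ?_
    change intOver K (GE.mk _ a) u.toG = GE.mk _ (mulNet (testToSmooth (ha.test K)) w)
    rw [← hv]
    refine congrArg (GE.mk _) (Subtype.ext <| funext fun ε => Subtype.ext <| funext fun y => ?_)
    change ∫ x in K.1, (a.1 ε).1 (x, y) * (v.1 ε).1 x =
      ha.test K y * ∫ x in K.1, (a.1 ε).1 (x, y) * (v.1 ε).1 x
    rw [← integral_const_mul]
    refine setIntegral_congr_fun K.2.1.measurableSet fun x hx => ?_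
    beta_reduce
    rw [← mul_assoc, ha.test_mul ε hx y]
  obtain ⟨h, e2⟩ := hτ.apply_cutGc (ha.test K) w
  change T.1 (transposeOpC (GE.mk _ a) hk u) = pairOver K (GE.mk _ (τ.apply ha)) u.toG
  rw [e1, e2, ← hv]
  refine CTilde.mk_congr fun ε => (apply_intFn (τ.isCompact_cut _ ε) K (a.1 ε) (v.1 ε)).trans ?_
  refine setIntegral_congr_fun K.2.1.measurableSet fun x hx => ?_
  exact congrArg (· * (v.1 ε).1 x) (τ.applyVal_eq ha ε hx).symm

/-- Sets of nets with uniform moderate bounds, cut off by a fixed test function, are bounded in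
`𝒢_c(Ω)`. A continuous ultra-pseudo-seminorm is less than `1` on `θ ε ^ (d + M) w_ε` for suitable
`d` and `M`, and homogeneity gives a bound for `θ ε ^ c w_ε`. -/
theorem isBoundedGc_cutGc (θ : TestFunction Ω ℂ ⊤) (c : ℝ) {W : Set (moderate (pSeminorm Ω))}
    (hW : ∀ κ, ∃ N : ℕ, ∀ w ∈ W, BigO (fun ε => pSeminorm Ω κ (w.1 ε)) (-(N : ℝ))) :
    IsBoundedGc {g | ∃ w ∈ W, g = CTilde.mk (powScalar c) • cutGc θ w} := by
  intro Q
  obtain ⟨s, d, hs⟩ := exists_ball_of_continuous (Q.2 (testSupport θ))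
    (x := ⟨0, by rw [map_zero, supp_zero]; exact Set.empty_subset _⟩) Q.1.map_zero one_pos
  choose N hN using hW
  let M : ℕ := s.sup fun κ => N κ.1
  refine lt_of_le_of_lt (b := scale (c - (d + M))) ?_ (scale_lt_top _)
  refine iSup₂_le fun g hg => ?_
  obtain ⟨w, hw, rfl⟩ := hg
  have h1 : (Q.1.toFun (cutGc θ (scaleNet (d + M) w)) : ℝ≥0∞) < 1 := by
    refine hs ⟨cutGc θ (scaleNet (d + M) w), supp_cutGc_subset _ _⟩ fun κ hκ => ?_
    rw [map_zero, sub_zero]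
    refine GE.ups_mk_le_scale ?_
    have hle : ∀ ε : Idx, pSeminorm Ω κ.1 ((mulNet (testToSmooth θ) (scaleNet (d + M) w)).1 ε) ≤
        2 ^ κ.1.2 * pValue κ.1.1 κ.1.2 (testToSmooth θ) *
          ((ε : ℝ) ^ ((d : ℝ) + M) * pSeminorm Ω κ.1 (w.1 ε)) := by
      intro ε
      rw [← seminorm_scaleNet]
      exact pValue_mulBy_le _ _ _ _
    refine BigO.of_le (((((BigO.rpow _).mul (hN κ.1 w hw)).mono ?_).const_mul _))
      (fun _ => apply_nonneg _ _) hle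
    have : ((N κ.1 : ℕ) : ℝ) ≤ M := by
      exact_mod_cast Finset.le_sup (f := fun κ : NhdIndex (testSupport θ) => N κ.1) hκ
    linarith
  have e : CTilde.mk (powScalar c) • cutGc θ w =
      CTilde.mk (powScalar (c - (d + M))) • cutGc θ (scaleNet (d + M) w) := by
    have e' : cutGc θ (scaleNet (d + M) w) = CTilde.mk (powScalar (d + M)) • cutGc θ w := by
      refine Subtype.val_injective ?_
      refine congrArg (GE.mk _) (Subtype.ext <| funext fun ε => ?_)
      exact map_smul (mulBy (testToSmooth θ)) _ _
    rw [e', smul_smul, ← map_mul, powScalar_mul, sub_add_cancel]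
  rw [e]
  refine (Q.1.smul_le _ _).trans ?_
  exact (mul_le_mul' (enorm_powScalar_le _) h1.le).trans (mul_one _).le

/-- Closeness of two basic functionals on a bounded subset of `𝒢_c(Ω)` controls the seminorms of the
difference of the functions `x ↦ t_ε(a_ε(x, ·))` on a compact set. -/
theorem exists_bounded_test (ha : IsProperNet a) (K : CompactIn Ω) (I : Set ℕ) (c : ℕ)
    (hbd : ∀ L : CompactIn Ω, ∀ j, ∃ N : ℕ, ∀ i ∈ I,
      BigO (fun ε => pSeminorm (sq Ω) (K.prod L, j + i) (a.1 ε)) (-(N : ℝ))) :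
    ∃ B : Set (Gc Ω), IsBoundedGc B ∧ ∀ (S T : BasicDualGc Ω) (σ τ : LocalNet Ω),
      σ.Represents S → τ.Represents T → ⨆ u ∈ B, CTilde.enorm (T.1 u - S.1 u) < 1 →
      ∀ i ∈ I, BigO (fun ε => pSeminorm Ω (K, i) ((τ.apply ha - σ.apply ha).1 ε)) c := by
  obtain ⟨K', hK⟩ := K.exists_nhd
  let θ := ha.test K'
  refine ⟨_, isBoundedGc_cutGc θ (-c)
    (W := {w | ∃ i ∈ I, ∀ ε, w.1 ε ∈ derivSlices K i (a.1 ε)}) fun κ => ?_, ?_⟩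
  · obtain ⟨N, hN⟩ := hbd κ.1 κ.2
    refine ⟨N, ?_⟩
    rintro w ⟨i, hi, hw⟩
    exact (hN i hi).of_le (fun _ => apply_nonneg _ _)
      fun ε => pValue_le_of_mem_derivSlices (hw ε) _ _
  · intro S T σ τ hσ hτ hlt i hi
    choose w hw hle using fun ε => exists_derivSlice K i
      ((τ.isCompact_cut θ ε).sub (σ.isCompact_cut θ ε)) (a.1 ε)
    let w' : moderate (pSeminorm Ω) := ⟨w, moderate_of_derivSlices hw⟩
    obtain ⟨hS, eS⟩ := hσ.apply_cutGc θ w'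
    obtain ⟨hT, eT⟩ := hτ.apply_cutGc θ w'
    have h1 := (le_iSup₂ (f := fun u _ => CTilde.enorm (T.1 u - S.1 u))
      (CTilde.mk (powScalar (-(c : ℝ))) • cutGc θ w') ⟨w', ⟨i, hi, hw⟩, rfl⟩).trans_lt hlt
    rw [map_smul, map_smul, eS, eT, smul_eq_mul, smul_eq_mul, ← mul_sub, ← map_sub, ← map_mul,
      ← scale_zero, CTilde.enorm_mk_lt_scale] at h1
    obtain ⟨b, hb, hO⟩ := h1
    refine ((((BigO.rpow c).mul hO).const_mul 2).mono (by linarith)).of_le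
      (fun _ => apply_nonneg _ _) fun ε => ?_
    have e0 : pValue K i (τ.applyFn ha ε - σ.applyFn ha ε) =
        pValue K i (applySlices _ ((τ.isCompact_cut θ ε).sub (σ.isCompact_cut θ ε)) (a.1 ε)) :=
      pValue_congr i fun x hx => (τ.eventuallyEq_applySlices ha hK ε hx).sub
        (σ.eventuallyEq_applySlices ha hK ε hx)
    have e1 : ‖(powScalar (-(c : ℝ))).1 ε * (τ.cut θ ε (w ε) - σ.cut θ ε (w ε))‖ =
        (ε : ℝ) ^ (-(c : ℝ)) * ‖τ.cut θ ε (w ε) - σ.cut θ ε (w ε)‖ := by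
      rw [norm_mul, norm_powScalar]
    refine e0.le.trans ((hle ε).trans (mul_le_mul_of_nonneg_left (le_of_eq ?_) two_pos.le))
    refine Eq.trans ?_ (congrArg ((ε : ℝ) ^ (c : ℝ) * ·) e1.symm)
    rw [← mul_assoc, ← Real.rpow_add ε.pos, add_neg_cancel, Real.rpow_zero, one_mul]
    rfl

/-- A net of distributions which represents a basic functional. -/
def of (T : BasicDualGc Ω) : LocalNet Ω := (exists_represents T).choose

theorem of_represents (T : BasicDualGc Ω) : (of T).Represents T := (exists_represents T).choose_spec

theorem continuous_apply (ha : IsProperNet a) :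
    Continuous fun T : BasicDualGc Ω => (GE.mk _ ((of T).apply ha) : G Ω) := by
  refine continuous_gauge fun S κ δ hδ => ?_
  obtain ⟨c, hc⟩ := exists_scale_lt hδ
  obtain ⟨B, hB, h⟩ := exists_bounded_test ha κ.1 {κ.2} c fun L j => by
    obtain ⟨N, hN⟩ := a.2 (κ.1.prod L, j + κ.2)
    refine ⟨N, fun i hi => ?_⟩
    rw [Set.mem_singleton_iff.1 hi]
    exact hN
  refine ⟨{⟨B, hB⟩}, 1, one_pos, fun T hT => lt_of_le_of_lt ?_ hc⟩
  rw [← map_sub]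
  exact GE.ups_mk_le_scale (h S T _ _ (of_represents S) (of_represents T)
    (hT _ (Finset.mem_singleton_self _)) κ.2 rfl)

/-- The class of `x ↦ t_ε(a_ε(x, ·))` for regular properly supported kernels, an element of
`𝒢^∞(Ω)`. -/
def applyInf (τ : LocalNet Ω) (ha : IsProperNet a) (ha' : IsRegularNet a) : Ginf Ω :=
  ⟨GE.mk _ (τ.apply ha), τ.apply ha, rfl, τ.isRegularNet_apply ha ha'⟩

theorem continuous_applyInf (ha : IsProperNet a) (ha' : IsRegularNet a) :
    Continuous fun T : BasicDualGc Ω => (of T).applyInf ha ha' := by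
  refine continuous_gauge fun S K δ hδ => ?_
  obtain ⟨c, hc⟩ := exists_scale_lt hδ
  obtain ⟨B, hB, h⟩ := exists_bounded_test ha K Set.univ c fun L j =>
    ha'.exists_bound K L j _
  refine ⟨{⟨B, hB⟩}, 1, one_pos, fun T hT => lt_of_le_of_lt ?_ hc⟩
  change upsInf K (GE.mk _ ((of T).apply ha) - GE.mk _ ((of S).apply ha)) ≤ _
  rw [← map_sub]
  refine GE.upsOn_mk_le_scale ?_
  rintro ⟨K', i⟩ rfl
  exact h S T _ _ (of_represents S) (of_represents T) (hT _ (Finset.mem_singleton_self _)) i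
    (Set.mem_univ i)

end LocalNet

end LocalDual

end

end Colombeau

theorem mainTheorem10 {n : ℕ} (Ω : Opens (EuclideanSpace ℝ (Fin n))) (k : G (sq Ω)) :
    (∃ Φ : BasicDualG Ω → G Ω, Continuous Φ ∧ ∀ T, opDual k T = (Φ T).toDual) ∧
    (∀ hk : IsProperlySupported k,
      (∃ S : G Ω →L[CTilde] G Ω, ExtendsTranspose k S ∧
        ∃ Φ : BasicDualG Ω → Gc Ω, Continuous Φ ∧ ∀ T,
          opDual k T = (Φ T).toG.toDual ∧ (fun u => T.1 (S u)) = (Φ T).toDual) ∧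
      (∃ Φ : BasicDualGc Ω → G Ω, Continuous Φ ∧ ∀ T, opDualC k hk T = (Φ T).toDual)) ∧
    (k ∈ ginfSubmodule (sq Ω) →
      (∃ Φ : BasicDualG Ω → Ginf Ω, Continuous Φ ∧ ∀ T, opDual k T = G.toDual (Φ T).toG) ∧
      (∀ hk : IsProperlySupported k,
        (∃ S : G Ω →L[CTilde] G Ω, ExtendsTranspose k S ∧
          ∃ Φ : BasicDualG Ω → Gcinf Ω, Continuous Φ ∧ ∀ T,
            opDual k T = G.toDual (Φ T).toGc.toG ∧ (fun u => T.1 (S u)) = (Φ T).toGc.toDual) ∧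
        (∃ Φ : BasicDualGc Ω → Ginf Ω, Continuous Φ ∧ ∀ T,
          opDualC k hk T = G.toDual (Φ T).toG))) := by
  have key : ∀ a : moderate (pSeminorm (sq Ω)), GE.mk _ a = k → ∀ hk : IsProperlySupported k,
      ∃ χ : SmoothFn (sq Ω), IsProperNet (mulNet χ a) ∧ GE.mk _ (mulNet χ a) = k := by
    rintro a rfl hk
    exact exists_proper_rep a hk
  refine ⟨?_, fun hk => ?_, ?_⟩
  · obtain ⟨a, rfl⟩ := GE.mk_surjective k
    exact ⟨_, BasicNet.continuous_apply a, fun T => BasicNet.opDual_eq (BasicNet.of_represents T) a⟩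
  · obtain ⟨b, hb⟩ := GE.mk_surjective k
    obtain ⟨χ, ha, rfl⟩ := key b hb hk
    exact ⟨⟨transposeExt ha, extendsTranspose ha, _, BasicNet.continuous_applyC ha, fun T =>
        ⟨BasicNet.opDual_eq (BasicNet.of_represents T) _,
          BasicNet.apply_transposeExt (BasicNet.of_represents T) ha⟩⟩,
      _, LocalNet.continuous_apply ha, fun T =>
        LocalNet.opDualC_eq (LocalNet.of_represents T) hk rfl⟩
  · rintro ⟨b, hb, hreg : IsRegularNet b⟩
    refine ⟨⟨_, BasicNet.continuous_applyInf hreg, fun T => ?_⟩, fun hk => ?_⟩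
    · rw [← hb]
      exact BasicNet.opDual_eq (BasicNet.of_represents T) b
    · obtain ⟨χ, ha, rfl⟩ := key b hb hk
      have hreg' := hreg.mulNet χ
      exact ⟨⟨transposeExt ha, extendsTranspose ha, _, BasicNet.continuous_applyCInf ha hreg',
          fun T => ⟨BasicNet.opDual_eq (BasicNet.of_represents T) _,
            BasicNet.apply_transposeExt (BasicNet.of_represents T) ha⟩⟩,
        _, LocalNet.continuous_applyInf ha hreg', fun T =>
          LocalNet.opDualC_eq (LocalNet.of_represents T) hk rfl⟩
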